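/- All hypergraphs, faces and orders below are finite-dimensional and finite. **Hypergraphs.** A hypergraph $S$ consists of finite sets $S_k$ of $k$-faces ($k\in\omega$, almost all empty), functions $\gamma:S_{k+1}\to S_k$, and for each $a\in S_{k+1}$ a set $\delta(a)\subseteq S_k\sqcup\{1_u:u\in S_{k-1}\}$ which is either a singleton or a non-empty subset of $S_k$ (for $k=0$: one element of $S_0$). Put $\gamma(1_u)=\delta(1_u)=u$. A face $a$ is a loop if $\delta(a)=\{\gamma(a)\}$; $A^{-\lambda}$ denotes the set of faces in $A$ that are not loops; $\dot\delta(a)=\delta(a)\cap S$; $a\in S^\varepsilon$ if $\delta(a)=\{1_u\}$ for some $u$; $\theta(a)=\delta(a)\cup\{\gamma(a)\}$, $\dot\theta(a)=\theta(a)\cap S$; $\iota(\alpha)=\{x:\exists a,b\in\dot\delta^{-\lambda}(\alpha),\ \gamma(a)=x\in\delta(b)\}$ and $\iota(S_{k})=\bigcup_{\alpha\in S_k}\iota(\alpha)$. On $S_k$, $<^-$ (empty for $k=0$) is the transitive closure of $\gamma(a)\in\delta(b)$, and $<^+$ is the transitive closure of "$a\in\delta(\alpha)$ and $\gamma(\alpha)=b$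 for some $\alpha\in S_{k+1}^{-\lambda}$"; $x\perp y$ means $x<y$ or $y<x$ for the relation $<$ in question. Write $A\equiv_1B$ if $A\cup1_{\dot\theta(A\cap S)}=B\cup1_{\dot\theta(B\cap S)}$. A hypergraph morphism is a dimension-preserving map $f$ on faces that commutes with $\gamma$ and induces bijections $\delta(a)\to\delta(f(a))$, where $1_u\mapsto1_{f(u)}$. **Ordered face structures.** An ordered face structure is a hypergraph $S$ with $S_0\ne\emptyset$ and a binary relation $<^\sim$ on each $S_k$ such that: (globularity) $\gamma\gamma(a)=\gamma\delta(a)-\delta\dot\delta^{-\lambda}(a)$ and $\delta\gamma(a)\equiv_1\delta\delta(a)-\gamma\dot\delta^{-\lambda}(a)$ for $\dim a\ge2$; (local discreteness) no two faces in $\delta(a)$ are $<^+$-comparable; (strictness) all $<^+$ and $<^\sim$ are irreflexive and transitive, and $<^+$ is linear on $S_0$; (disjointness) $a<^\sim b$ implies $a<^-b$ and not $a\perp^+b$, and if $\theta(a)\cap\theta(b)=\emptyset$ then $a<^-b$ implies $a<^\sim b$; (pencil linearity) if $a\ne b$ and $\dot\theta(a)\cap\dot\theta(b)\neq\emptyset$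 then $a\perp^\sim b$ or $a\perp^+b$, and if $a\in S^\varepsilon$, $\dim a,\dim b\ge2$ and $\gamma\gamma(a)\in\iota(b)$ then $a<^\sim b$ or $a<^+b$; (loop filling) every loop is $\gamma(\alpha)$ for some $\alpha$ that is not a loop. ${\bf oFs}$ is the category of ordered face structures and hypergraph morphisms preserving $<^\sim$. ${\bf lFs}$ has as objects the hypergraphs with a binary relation on each $\dot\delta(a)$; its morphisms are the hypergraph morphisms which, for $\dim a>1$, restrict to isomorphisms of the sets $\dot\delta(a)\to\dot\delta(f(a))$ with these relations. The functor $|-|:{\bf oFs}\to{\bf lFs}$ restricts $<^\sim$ to the sets $\dot\delta(a)$. **Domains and codomains.** Let $X$ be a subhypergraph of $S$. Let ${\cal E}_x$ be the set of loops $l\in X$ with $\gamma(l)=x$ that are not of the form $\gamma(b)$ with $b\in X^{-\lambda}$. The stretching $[X]$ has as $k$-faces the cuts $(x,L,U)$, where $x\in X_k$, $L$ is a $<^\sim$-initial segment of ${\cal E}_x$ and $U={\cal E}_x-L$. Write $(x,-,U)$ and $(x,L,-)$ for the cut with the given upper or lower part. Then $\gamma(x,L,U)=(\gamma(x),-,\uparrow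 x)$ with $\uparrow x=\{b\in{\cal E}_{\gamma(x)}:x<^\sim b\}$; $\delta(x,L,U)=\{(t,\downarrow_t x,-):t\in\delta(x)\}$ with $\downarrow_tx=\{b\in{\cal E}_t:b<^\sim x\}$ if $\delta(x)\subseteq S$, and $\delta(x,L,U)=1_{(v,-,\uparrow\gamma(x))}$ if $\delta(x)=1_v$; and $(x,L,U)<^\sim(x',L',U')$ iff $x<^\sim x'$. There is a projection $[X]\to S$, $(x,L,U)\mapsto x$. Put ${\bf d}^{(k)}S=[d^{(k)}S]$ and ${\bf c}^{(k)}S=[c^{(k)}S]$, with projections ${\bf d}^{(k)}_S,{\bf c}^{(k)}_S$ to $S$, where $d^{(k)}S$ consists of $S_l$ for $l<k$ and $S_k-\gamma(S_{k+1}^{-\lambda})$, and $c^{(k)}S$ consists of $S_l$ for $l<k-1$, $S_{k-1}-\iota(S_{k+1})$ and $S_k-\delta(S^{-\lambda}_{k+1})$. **The $k$-tensor.** Let $S,T$ be ordered face structures, $k\in\omega$, and suppose ${\bf c}^{(k)}S={\bf d}^{(k)}T$ (more generally, let an isomorphism $\varphi:{\bf c}^{(k)}S\cong{\bf d}^{(k)}T$,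 bijective and preserving $<^\sim$ both ways, be given). The faces of $S\otimes_kT$ are the faces of $S$ together with the faces of $T$ not in $d^{(k)}T$. Let $\kappa_S$ be the inclusion; let $\kappa_T$ be the inclusion on the faces of $T$ not in $d^{(k)}T$, and the composite $d^{(k)}T\cong{\bf d}^{(k)}T\cong{\bf c}^{(k)}S\to S$ on $d^{(k)}T$. The operations $\gamma,\delta$ of $S\otimes_kT$ are those of $S$ on faces of $S$, and $\gamma(t)=\kappa_T(\gamma^T(t))$, $\delta(t)=\kappa_T(\delta^T(t))$ for faces $t$ of $T$ not in $d^{(k)}T$. Let $S_k\cap T_k$ denote the set of $k$-faces common to $\kappa_S(S)$ and $\kappa_T(T)$. The relation $<^\sim$ of $S\otimes_kT$ holds exactly in the following cases: * $x<^{S,\sim}y$ with $x,y\in S$, or $x<^{T,\sim}y$ with $x,y\in T$ of dimension $\ge k$; * $x\in S_{k+1}$, $y\in T_{k+1}$ and $x<^{S\otimes_kT,-}y$; * $x\in\delta(S_{k+1}^{-\lambda})\cap S_k$, $y\in\gamma(T_{k+1}^{-\lambda})$, and there is $z\in S_k\cap T_k$ with $x\le^{S,+}z$ and $z<^{T,\sim}y$;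 * $x\in\gamma(T_{k+1}^{-\lambda})$, $y\in\delta(S_{k+1}^{-\lambda})\cap S_k$, $x<^{S\otimes_kT,-}y$, and there is $z\in S_k\cap T_k$ with $y\le^{S,+}z$ and $x<^{T,\sim}z$. **Proposition.** Under these assumptions ${\bf c}^{(k)}S$, ${\bf d}^{(k)}T$ and $S\otimes_kT$ are ordered face structures, $\kappa_S:S\to S\otimes_kT$ and $\kappa_T:T\to S\otimes_kT$ are morphisms of ${\bf oFs}$, and the square with sides ${\bf c}^{(k)}_S:{\bf c}^{(k)}S\to S$, ${\bf d}^{(k)}_T\circ\varphi:{\bf c}^{(k)}S\to T$, $\kappa_S$, $\kappa_T$ commutes in ${\bf oFs}$. The functor $|-|$ sends this square to a pushout in ${\bf lFs}$. -/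

import Mathlib

open CategoryTheory

universe u

namespace FaceStructure

/-! ## Hypergraphs -/

/-- A hypergraph. All faces are collected in one finite type, graded by `dim`, so that
`S_k = {a | dim a = k}`. In `Face ⊕ Face`, `Sum.inl x` is the face `x` and `Sum.inr u` is the
empty face `1_u`, which has dimension `dim u + 1`. On empty faces `γ(1_u) = u = δ(1_u)`.
A face of dimension `0` has no codomain; there `γ a = a` is a convention without content. -/
structure Hypergraph : Type (u + 1) where
  Face : Type u
  finite : Finite Face
  dim : Face → ℕ
  γ : Face → Face
  δ : Face → Set (Face ⊕ Face)
  γ_zero : ∀ a, dim a = 0 → γ a = a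
  dim_γ : ∀ a, 0 < dim a → dim (γ a) + 1 = dim a
  dim_δ : ∀ a x, Sum.inl x ∈ δ a → dim x + 1 = dim a
  dim_δ_empty : ∀ a v, Sum.inr v ∈ δ a → dim v + 2 = dim a
  δ_total : ∀ a, 0 < dim a →
    (∃ y, δ a = {y}) ∨ ((δ a).Nonempty ∧ ∀ y ∈ δ a, ∃ x, y = Sum.inl x)
  δ_one : ∀ a, dim a = 1 → ∃ x, δ a = {Sum.inl x}

/-- A morphism of hypergraphs: it commutes with `γ` and restricts to bijections
`δ(a) → δ(f a)`, where `1_u` is sent to `1_{f u}`. -/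
@[ext]
structure HgHom (S T : Hypergraph.{u}) where
  toFun : S.Face → T.Face
  dim_map : ∀ a, T.dim (toFun a) = S.dim a
  map_γ : ∀ a, 0 < S.dim a → toFun (S.γ a) = T.γ (toFun a)
  bij_δ : ∀ a, 0 < S.dim a → Set.BijOn (Sum.map toFun toFun) (S.δ a) (T.δ (toFun a))

def HgHom.id (S : Hypergraph.{u}) : HgHom S S where
  toFun := _root_.id
  dim_map _ := rfl
  map_γ _ _ := rfl
  bij_δ a _ := by
    rw [Sum.map_id_id]; exact Set.bijOn_id _

def HgHom.comp {S T U : Hypergraph.{u}} (f : HgHom S T) (g : HgHom T U) : HgHom S U where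
  toFun := g.toFun ∘ f.toFun
  dim_map a := by simp [g.dim_map, f.dim_map]
  map_γ a h := by
    have h' : 0 < T.dim (f.toFun a) := by rw [f.dim_map]; exact h
    simp [f.map_γ a h, g.map_γ _ h']
  bij_δ a h := by
    have h' : 0 < T.dim (f.toFun a) := by rw [f.dim_map]; exact h
    have := (g.bij_δ _ h').comp (f.bij_δ a h)
    rwa [Sum.map_comp_map] at this

namespace Hypergraph

variable (S : Hypergraph.{u})

/-- `γ` on faces and empty faces. -/
def γExt : S.Face ⊕ S.Face → S.Face := Sum.elim S.γ _root_.id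

/-- `δ` on faces and empty faces. -/
def δExt : S.Face ⊕ S.Face → Set (S.Face ⊕ S.Face) := Sum.elim S.δ (fun v => {Sum.inl v})

/-- Loops: `δ(a) = γ(a)`. -/
def IsLoop (a : S.Face) : Prop := 0 < S.dim a ∧ S.δ a = {Sum.inl (S.γ a)}

/-- Empty-domain faces. -/
def IsEmptyDom (a : S.Face) : Prop := ∃ v, S.δ a = {Sum.inr v}

/-- The faces in `δ(a)` that are not loops. -/
def δNonloop (a : S.Face) : Set S.Face := {x | Sum.inl x ∈ S.δ a ∧ ¬ S.IsLoop x}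

/-- `θ(a) = δ(a) ∪ γ(a)`, for `a` of positive dimension. -/
def θ (a : S.Face) : Set (S.Face ⊕ S.Face) :=
  {y | 0 < S.dim a ∧ (y ∈ S.δ a ∨ y = Sum.inl (S.γ a))}

/-- The non-empty faces in `θ(a)`. -/
def θFaces (a : S.Face) : Set S.Face := {x | Sum.inl x ∈ S.θ a}

/-- Internal faces of `a`. -/
def ι (a : S.Face) : Set S.Face :=
  {x | ∃ b ∈ S.δNonloop a, ∃ c ∈ S.δNonloop a, 0 < S.dim b ∧ S.γ b = x ∧ Sum.inl x ∈ S.δ c}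

/-- `⋃ {δ(a) : a is not a loop}`, restricted to non-empty faces. -/
def δNonloops : Set S.Face := {x | ∃ a, ¬ S.IsLoop a ∧ Sum.inl x ∈ S.δ a}

/-- `{γ(a) : a is a face of positive dimension that is not a loop}`. -/
def γNonloops : Set S.Face := {x | ∃ a, 0 < S.dim a ∧ ¬ S.IsLoop a ∧ S.γ a = x}

/-- The elementary lower relation: `γ(a) ∈ δ(b)`. -/
def lowerStep (a b : S.Face) : Prop := 0 < S.dim a ∧ Sum.inl (S.γ a) ∈ S.δ b

/-- The relation `<⁻`. -/
def ltMinus : S.Face → S.Face → Prop := Relation.TransGen S.lowerStep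

/-- The elementary upper relation: `a ∈ δ(α)` and `γ(α) = b` for some `α` that is not a loop. -/
def upperStep (a b : S.Face) : Prop := ∃ c, ¬ S.IsLoop c ∧ Sum.inl a ∈ S.δ c ∧ S.γ c = b

/-- The upper order `<⁺`. -/
def ltPlus : S.Face → S.Face → Prop := Relation.TransGen S.upperStep

/-- `a ≤⁺ b`. -/
def lePlus (a b : S.Face) : Prop := a = b ∨ S.ltPlus a b

/-- `A ∪ 1_{θ(A ∩ S)}`. -/
def emptyClosure (A : Set (S.Face ⊕ S.Face)) : Set (S.Face ⊕ S.Face) :=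
  A ∪ {y | ∃ x v, Sum.inl x ∈ A ∧ v ∈ S.θFaces x ∧ y = Sum.inr v}

/-- `A ≡₁ B`. -/
def EqOne (A B : Set (S.Face ⊕ S.Face)) : Prop := S.emptyClosure A = S.emptyClosure B

end Hypergraph

/-! ## Ordered face structures -/

/-- A hypergraph with a binary relation `lt` (written `<~`) on each set of faces of a given
dimension. -/
structure OrdHypergraph : Type (u + 1) extends Hypergraph.{u} where
  lt : Face → Face → Prop
  lt_dim : ∀ a b, lt a b → dim a = dim b

/-- The axioms of ordered face structures. -/
structure IsOFS (S : OrdHypergraph.{u}) : Prop where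
  nonempty : ∃ a, S.dim a = 0
  glob_γ : ∀ a, 2 ≤ S.dim a →
    ({Sum.inl (S.γ (S.γ a))} : Set (S.Face ⊕ S.Face)) =
      ((fun y => Sum.inl (S.γExt y)) '' S.δ a) \ (⋃ x ∈ S.δNonloop a, S.δ x)
  glob_δ : ∀ a, 2 ≤ S.dim a →
    S.EqOne (S.δ (S.γ a))
      ((⋃ y ∈ S.δ a, S.δExt y) \ ((fun x => Sum.inl (S.γ x)) '' S.δNonloop a))
  discrete : ∀ a x y, Sum.inl x ∈ S.δ a → Sum.inl y ∈ S.δ a → ¬ S.ltPlus x y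
  ltPlus_irrefl : ∀ a, ¬ S.ltPlus a a
  ltPlus_linear : ∀ a b, S.dim a = 0 → S.dim b = 0 → a = b ∨ S.ltPlus a b ∨ S.ltPlus b a
  lt_irrefl : ∀ a, ¬ S.lt a a
  lt_trans : ∀ a b c, S.lt a b → S.lt b c → S.lt a c
  disjoint : ∀ a b, S.lt a b → ¬ S.ltPlus a b ∧ ¬ S.ltPlus b a
  lt_ltMinus : ∀ a b, S.lt a b → S.ltMinus a b
  lt_of_ltMinus : ∀ a b, S.θ a ∩ S.θ b = ∅ → S.ltMinus a b → S.lt a b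
  pencil : ∀ a b, a ≠ b → (S.θFaces a ∩ S.θFaces b).Nonempty →
    (S.lt a b ∨ S.lt b a) ∨ (S.ltPlus a b ∨ S.ltPlus b a)
  pencil_empty : ∀ a b, 2 ≤ S.dim a → 2 ≤ S.dim b → S.IsEmptyDom a →
    S.γ (S.γ a) ∈ S.ι b → S.lt a b ∨ S.ltPlus a b
  loop_filling : ∀ a, S.IsLoop a → a ∈ S.γNonloops

/-- A monotone morphism: a morphism of hypergraphs that preserves `<~`. -/
@[ext]
structure MonoHom (S T : OrdHypergraph.{u}) extends HgHom S.toHypergraph T.toHypergraph where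
  map_lt : ∀ a b, S.lt a b → T.lt (toFun a) (toFun b)

instance : Category OrdHypergraph.{u} where
  Hom S T := MonoHom S T
  id S := { HgHom.id S.toHypergraph with map_lt := fun _ _ h => h }
  comp f g := { HgHom.comp f.toHgHom g.toHgHom with
    map_lt := fun a b h => g.map_lt _ _ (f.map_lt a b h) }

/-- Ordered face structures. -/
structure OFS : Type (u + 1) where
  toOrd : OrdHypergraph.{u}
  isOFS : IsOFS toOrd

/-- The category **oFs** of ordered face structures and monotone morphisms. -/
instance : Category OFS.{u} where
  Hom S T := MonoHom S.toOrd T.toOrd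
  id S := 𝟙 S.toOrd
  comp {S T U} f g := (show S.toOrd ⟶ T.toOrd from f) ≫ (show T.toOrd ⟶ U.toOrd from g)

/-- A morphism of the underlying ordered hypergraphs is a morphism of **oFs**. -/
def OFS.ofHom {X Y : OrdHypergraph.{u}} (hX : IsOFS X) (hY : IsOFS Y) (f : X ⟶ Y) :
    OFS.mk X hX ⟶ OFS.mk Y hY := f

/-! ## Local face structures -/

/-- A local face structure: a hypergraph with a binary relation on the set of faces in `δ(a)`,
for each face `a`. -/
structure LFS : Type (u + 1) extends Hypergraph.{u} where
  rel : Face → Face → Face → Prop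
  rel_mem : ∀ a x y, rel a x y → Sum.inl x ∈ δ a ∧ Sum.inl y ∈ δ a

/-- A local morphism: a morphism of hypergraphs such that, for `dim a > 1`, the bijections of
the non-empty faces in `δ(a)` with those in `δ(f a)` are isomorphisms for the given relations. -/
@[ext]
structure LocalHom (S T : LFS.{u}) extends HgHom S.toHypergraph T.toHypergraph where
  rel_iff : ∀ a x y, 1 < S.dim a → Sum.inl x ∈ S.δ a → Sum.inl y ∈ S.δ a →
    (S.rel a x y ↔ T.rel (toFun a) (toFun x) (toFun y))

/-- The category **lFs** of local face structures and local morphisms. -/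
instance : Category LFS.{u} where
  Hom S T := LocalHom S T
  id S := { HgHom.id S.toHypergraph with rel_iff := fun _ _ _ _ _ _ => Iff.rfl }
  comp {S T U} f g := { HgHom.comp f.toHgHom g.toHgHom with
    rel_iff := fun a x y h hx hy => by
      have h0 : 0 < S.dim a := by omega
      refine (f.rel_iff a x y h hx hy).trans (g.rel_iff _ _ _ ?_ ?_ ?_)
      · rw [f.dim_map]; exact h
      · exact (f.bij_δ a h0).mapsTo hx
      · exact (f.bij_δ a h0).mapsTo hy }

/-! ## The forgetful functor -/

namespace IsOFS

open Relation

theorem step_of_mem {S : OrdHypergraph.{u}} {c d : S.Face} (h : Sum.inl c ∈ S.δ d) :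
    ReflTransGen S.upperStep c (S.γ d) := by
  by_cases hd : S.IsLoop d
  · rw [hd.2] at h
    cases h
    exact ReflTransGen.refl
  · exact ReflTransGen.single ⟨d, hd, h, rfl⟩

theorem γ_le_of_minus {S : OrdHypergraph.{u}} {a b : S.Face}
    (h : ReflTransGen S.lowerStep a b) :
    ReflTransGen S.upperStep (S.γ a) (S.γ b) := by
  induction h with
  | refl => exact ReflTransGen.refl
  | tail _ hs ih => exact ih.trans (step_of_mem hs.2)

theorem not_cycle {S : OrdHypergraph.{u}} (hS : IsOFS S) {a b : S.Face}
    (h : ReflTransGen S.upperStep a b) (h' : S.upperStep b a) : False :=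
  hS.ltPlus_irrefl a (TransGen.tail' h h')

theorem wf {S : OrdHypergraph.{u}} (hS : IsOFS S) :
    WellFounded (fun a b => S.ltPlus b a) := by
  have := S.finite
  have : IsTrans S.Face (fun a b => S.ltPlus b a) := ⟨fun _ _ _ h h' => TransGen.trans h' h⟩
  have : Std.Irrefl (fun a b => S.ltPlus b a) := ⟨hS.ltPlus_irrefl⟩
  exact Finite.wellFounded_of_trans_of_irrefl _

theorem no_minus_of_γ {S : OrdHypergraph.{u}} (hS : IsOFS S) {a b : S.Face}
    (hb : ¬ S.IsLoop b) (hg : S.γ a = S.γ b) : ¬ S.ltMinus a b := by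
  intro h
  obtain ⟨c, hac, hcb⟩ := TransGen.tail'_iff.1 h
  have h1 := γ_le_of_minus hac
  have h2 : S.upperStep (S.γ c) (S.γ b) := ⟨b, hb, hcb.2, rfl⟩
  rw [← hg] at h2
  exact hS.not_cycle h1 h2

theorem no_minus_of_δ {S : OrdHypergraph.{u}} (hS : IsOFS S) {a b x : S.Face}
    (ha : ¬ S.IsLoop a) (hxa : Sum.inl x ∈ S.δ a) (hxb : Sum.inl x ∈ S.δ b) :
    ¬ S.ltMinus a b := by
  intro h
  obtain ⟨c, hac, hcb⟩ := TransGen.tail'_iff.1 h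
  exact hS.discrete b x (S.γ c) hxb hcb.2
    (TransGen.head' ⟨a, ha, hxa, rfl⟩ (γ_le_of_minus hac))

theorem dim_pos_of_mem {S : OrdHypergraph.{u}} {x a : S.Face} (h : Sum.inl x ∈ S.δ a) :
    0 < S.dim a := by
  have := S.dim_δ a x h
  omega

theorem comparable {S : OrdHypergraph.{u}} (hS : IsOFS S) {a b x : S.Face}
    (ha : ¬ S.IsLoop a) (hb : ¬ S.IsLoop b) (hxa : Sum.inl x ∈ S.δ a)
    (hxb : Sum.inl x ∈ S.δ b) : a = b ∨ S.ltPlus a b ∨ S.ltPlus b a := by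
  by_cases hab : a = b
  · exact Or.inl hab
  rcases hS.pencil a b hab
    ⟨x, ⟨dim_pos_of_mem hxa, Or.inl hxa⟩, ⟨dim_pos_of_mem hxb, Or.inl hxb⟩⟩ with (h | h) | h
  · exact absurd (hS.lt_ltMinus _ _ h) (hS.no_minus_of_δ ha hxa hxb)
  · exact absurd (hS.lt_ltMinus _ _ h) (hS.no_minus_of_δ hb hxb hxa)
  · exact Or.inr h

theorem eq_of_γ {S : OrdHypergraph.{u}} (hS : IsOFS S) {a b c : S.Face} (hc : 2 ≤ S.dim c)
    (ha : a ∈ S.δNonloop c) (hb : b ∈ S.δNonloop c) (hg : S.γ a = S.γ b) : a = b := by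
  by_contra hab
  have da := S.dim_δ c a ha.1
  have db := S.dim_δ c b hb.1
  rcases hS.pencil a b hab ⟨S.γ a, ⟨by omega, Or.inr rfl⟩, ⟨by omega, Or.inr (by rw [hg])⟩⟩ with
    (h | h) | (h | h)
  · exact hS.no_minus_of_γ hb.2 hg (hS.lt_ltMinus _ _ h)
  · exact hS.no_minus_of_γ ha.2 hg.symm (hS.lt_ltMinus _ _ h)
  · exact hS.discrete c _ _ ha.1 hb.1 h
  · exact hS.discrete c _ _ hb.1 ha.1 h

/-- One step along the faces in `δ(a)` that are not loops. -/
def chain (S : OrdHypergraph.{u}) (a v w : S.Face) : Prop :=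
  ∃ z ∈ S.δNonloop a, Sum.inl v ∈ S.δ z ∧ S.γ z = w

theorem chain_up {S : OrdHypergraph.{u}} {a v w : S.Face} (h : chain S a v w) :
    S.upperStep v w := by
  obtain ⟨z, hz, hv, hw⟩ := h
  exact ⟨z, hz.2, hv, hw⟩

theorem exists_step {S : OrdHypergraph.{u}} (hS : IsOFS S) {a x : S.Face} (ha : 2 ≤ S.dim a)
    (hx : Sum.inl x ∈ S.δ a) : S.γ x = S.γ (S.γ a) ∨ ∃ z ∈ S.δNonloop a,
      Sum.inl (S.γ x) ∈ S.δ z := by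
  by_cases h : ∃ z ∈ S.δNonloop a, Sum.inl (S.γ x) ∈ S.δ z
  · exact Or.inr h
  · left
    have hm : (Sum.inl (S.γ x) : S.Face ⊕ S.Face) ∈
        ((fun y => Sum.inl (S.γExt y)) '' S.δ a) \ (⋃ z ∈ S.δNonloop a, S.δ z) := by
      refine ⟨⟨Sum.inl x, hx, rfl⟩, ?_⟩
      intro hm
      simp only [Set.mem_iUnion] at hm
      obtain ⟨z, hz, hm⟩ := hm
      exact h ⟨z, hz, hm⟩
    rw [← hS.glob_γ a ha] at hm
    exact Sum.inl_injective hm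

theorem chain_top {S : OrdHypergraph.{u}} (hS : IsOFS S) {a : S.Face} (ha : 2 ≤ S.dim a)
    (v : S.Face) : ∀ x, Sum.inl x ∈ S.δ a → S.γ x = v →
      ReflTransGen (chain S a) v (S.γ (S.γ a)) := by
  induction v using hS.wf.induction with
  | _ v ih =>
    rintro x hx rfl
    rcases hS.exists_step ha hx with h | ⟨z, hz, hv⟩
    · rw [h]
    · have hc : chain S a (S.γ x) (S.γ z) := ⟨z, hz, hv, rfl⟩
      exact ReflTransGen.head hc (ih _ (TransGen.single (chain_up hc)) z hz.1 rfl)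

theorem γ_mono {S : OrdHypergraph.{u}} (hS : IsOFS S) {a b : S.Face} (ha : 0 < S.dim a)
    (h : S.ltPlus a b) : ReflTransGen S.upperStep (S.γ a) (S.γ b) := by
  have key : ∀ a b : S.Face, 0 < S.dim a → S.upperStep a b →
      0 < S.dim b ∧ ReflTransGen S.upperStep (S.γ a) (S.γ b) := by
    rintro a b ha ⟨c, _, hac, rfl⟩
    have h1 := S.dim_δ c a hac
    have h2 := S.dim_γ c (by omega)
    exact ⟨by omega, ReflTransGen.mono (fun _ _ => chain_up) _ _
      (hS.chain_top (by omega) _ a hac rfl)⟩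
  have : 0 < S.dim b ∧ ReflTransGen S.upperStep (S.γ a) (S.γ b) := by
    induction h with
    | single h => exact key _ _ ha h
    | tail _ h ih => exact ⟨(key _ _ ih.1 h).1, ih.2.trans (key _ _ ih.1 h).2⟩
  exact this.2

theorem up_linear {S : OrdHypergraph.{u}} (hS : IsOFS S) (w : S.Face) : ∀ p q,
    ReflTransGen S.upperStep w p → ReflTransGen S.upperStep w q →
      ReflTransGen S.upperStep p q ∨ ReflTransGen S.upperStep q p := by
  induction w using hS.wf.induction with
  | _ w ih =>
    intro p q hp hq
    rcases ReflTransGen.cases_head hp with rfl | ⟨w1, h1, hp'⟩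
    · exact Or.inl hq
    rcases ReflTransGen.cases_head hq with rfl | ⟨w2, h2, hq'⟩
    · exact Or.inr hp
    have i1 := ih w1 (TransGen.single h1)
    have i2 := ih w2 (TransGen.single h2)
    obtain ⟨c, hc, hwc, rfl⟩ := h1
    obtain ⟨d, hd, hwd, rfl⟩ := h2
    rcases hS.comparable hc hd hwc hwd with rfl | h | h
    · exact i1 p q hp' hq'
    · exact i1 p q hp' ((hS.γ_mono (dim_pos_of_mem hwc) h).trans hq')
    · exact i2 p q ((hS.γ_mono (dim_pos_of_mem hwd) h).trans hp') hq'

theorem chain_trichotomy {S : OrdHypergraph.{u}} (hS : IsOFS S) {a : S.Face}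
    (ha : 2 ≤ S.dim a) {y : S.Face} (hy : Sum.inl y ∈ S.δ a) (v : S.Face) :
    ∀ x, Sum.inl x ∈ S.δ a → S.γ x = v →
      ReflTransGen (chain S a) v (S.γ y) ∨ ReflTransGen (chain S a) (S.γ y) v ∨
      ∃ z ∈ S.δNonloop a, ∃ p q, p ≠ q ∧ Sum.inl p ∈ S.δ z ∧ Sum.inl q ∈ S.δ z ∧
        ReflTransGen (chain S a) v p ∧ ReflTransGen (chain S a) (S.γ y) q := by
  induction v using hS.wf.induction with
  | _ v ih =>
    rintro x hx rfl
    rcases hS.exists_step ha hx with h | ⟨z, hz, hv⟩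
    · rw [h]
      exact Or.inr (Or.inl (hS.chain_top ha _ y hy rfl))
    have hc : chain S a (S.γ x) (S.γ z) := ⟨z, hz, hv, rfl⟩
    rcases ih _ (TransGen.single (chain_up hc)) z hz.1 rfl with h | h | h
    · exact Or.inl (ReflTransGen.head hc h)
    · rcases ReflTransGen.cases_tail h with h | ⟨q, hq, z', hz', hqz, hg⟩
      · left
        rw [← h]
        exact ReflTransGen.single hc
      · obtain rfl := hS.eq_of_γ ha hz' hz hg
        by_cases hqv : S.γ x = q
        · right; left
          rw [hqv]; exact hq
        · right; right
          exact ⟨z', hz', S.γ x, q, hqv, hv, hqz, ReflTransGen.refl, hq⟩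
    · obtain ⟨z', hz', p, q, hpq, hp, hq, h1, h2⟩ := h
      exact Or.inr (Or.inr ⟨z', hz', p, q, hpq, hp, hq, ReflTransGen.head hc h1, h2⟩)

theorem lt_of_chain {S : OrdHypergraph.{u}} (hS : IsOFS S) {a x y : S.Face}
    (ha : 2 ≤ S.dim a) (hx : Sum.inl x ∈ S.δ a) (hy : Sum.inl y ∈ S.δ a)
    (h : TransGen (chain S a) (S.γ x) (S.γ y)) : S.lt x y := by
  have pos : ∀ z, Sum.inl z ∈ S.δ a → 0 < S.dim z := fun z hz => by
    have := S.dim_δ a z hz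
    omega
  have base : ∀ z w, Sum.inl z ∈ S.δ a → w ∈ S.δNonloop a → Sum.inl (S.γ z) ∈ S.δ w →
      S.lt z w := by
    intro z w hz hw hm
    have hs : S.upperStep (S.γ z) (S.γ w) := ⟨w, hw.2, hm, rfl⟩
    have hne : z ≠ w := by
      rintro rfl
      exact hS.not_cycle ReflTransGen.refl hs
    rcases hS.pencil z w hne ⟨S.γ z, ⟨pos z hz, Or.inr rfl⟩, ⟨pos w hw.1, Or.inl hm⟩⟩ with
      (h | h) | (h | h)
    · exact h
    · exact (hS.not_cycle (γ_le_of_minus (hS.lt_ltMinus _ _ h).to_reflTransGen) hs).elim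
    · exact (hS.discrete a _ _ hz hw.1 h).elim
    · exact (hS.discrete a _ _ hw.1 hz h).elim
  have main : ∀ w, TransGen (chain S a) (S.γ x) w →
      ∃ z ∈ S.δNonloop a, S.γ z = w ∧ S.lt x z := by
    intro w h
    induction h with
    | single h =>
      obtain ⟨z, hz, hm, hg⟩ := h
      exact ⟨z, hz, hg, base x z hx hz hm⟩
    | tail _ h ih =>
      obtain ⟨z, hz, hg, hl⟩ := ih
      obtain ⟨z', hz', hm, hg'⟩ := h
      rw [← hg] at hm
      exact ⟨z', hz', hg', hS.lt_trans _ _ _ hl (base z z' hz.1 hz' hm)⟩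
  obtain ⟨z, hz, hg, hl⟩ := main _ h
  by_cases hzy : z = y
  · exact hzy ▸ hl
  rcases hS.pencil z y hzy
    ⟨S.γ z, ⟨pos z hz.1, Or.inr rfl⟩, ⟨pos y hy, Or.inr (by rw [hg])⟩⟩ with (h | h) | (h | h)
  · exact hS.lt_trans _ _ _ hl h
  · exact (hS.no_minus_of_γ hz.2 hg.symm (hS.lt_ltMinus _ _ h)).elim
  · exact (hS.discrete a _ _ hz.1 hy h).elim
  · exact (hS.discrete a _ _ hy hz.1 h).elim

theorem chain_map {S T : OrdHypergraph.{u}} (f : MonoHom S T) {a v w : S.Face}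
    (ha : 2 ≤ S.dim a) (h : ReflTransGen (chain S a) v w) :
    ReflTransGen T.upperStep (f.toFun v) (f.toFun w) := by
  induction h with
  | refl => exact ReflTransGen.refl
  | tail _ h ih =>
    obtain ⟨z, hz, hm, rfl⟩ := h
    have hd := S.dim_δ a z hz.1
    rw [f.map_γ z (by omega)]
    exact ih.trans (step_of_mem ((f.bij_δ z (by omega)).mapsTo hm))

/-- A monotone morphism of ordered face structures reflects `<~` on each `δ(a)`. -/
theorem reflect {S T : OrdHypergraph.{u}} (hS : IsOFS S) (hT : IsOFS T) (f : MonoHom S T)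
    {a x y : S.Face} (ha : 1 < S.dim a) (hx : Sum.inl x ∈ S.δ a) (hy : Sum.inl y ∈ S.δ a)
    (h : T.lt (f.toFun x) (f.toFun y)) : S.lt x y := by
  have asymm : ¬ S.lt y x := fun h' =>
    hT.lt_irrefl _ (hT.lt_trans _ _ _ h (f.map_lt _ _ h'))
  have hdx := S.dim_δ a x hx
  have hdy := S.dim_δ a y hy
  have hxy : x ≠ y := by
    rintro rfl
    exact hT.lt_irrefl _ h
  by_cases hg : S.γ x = S.γ y
  · rcases hS.pencil x y hxy
      ⟨S.γ x, ⟨by omega, Or.inr rfl⟩, ⟨by omega, Or.inr (by rw [hg])⟩⟩ with (h | h) | (h | h)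
    · exact h
    · exact (asymm h).elim
    · exact (hS.discrete a _ _ hx hy h).elim
    · exact (hS.discrete a _ _ hy hx h).elim
  rcases hS.chain_trichotomy ha hy _ x hx rfl with h' | h' | ⟨z, hz, p, q, hpq, hp, hq, h1, h2⟩
  · rcases reflTransGen_iff_eq_or_transGen.1 h' with h' | h'
    · exact (hg h'.symm).elim
    · exact hS.lt_of_chain ha hx hy h'
  · rcases reflTransGen_iff_eq_or_transGen.1 h' with h' | h'
    · exact (hg h').elim
    · exact (asymm (hS.lt_of_chain ha hy hx h')).elim
  · exfalso
    have hdz := S.dim_δ a z hz.1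
    have bij := f.bij_δ z (by omega)
    have l1 := chain_map f ha h1
    have l2 := chain_map f ha h2
    have l3 := γ_le_of_minus (hT.lt_ltMinus _ _ h).to_reflTransGen
    rw [← f.map_γ x (by omega), ← f.map_γ y (by omega)] at l3
    have hne : f.toFun p ≠ f.toFun q := fun he =>
      hpq (Sum.inl_injective (bij.injOn hp hq (congrArg Sum.inl he)))
    rcases hT.up_linear _ _ _ l1 (l3.trans l2) with l | l
    · rcases reflTransGen_iff_eq_or_transGen.1 l with l | l
      · exact hne l.symm
      · exact hT.discrete _ _ _ (bij.mapsTo hp) (bij.mapsTo hq) l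
    · rcases reflTransGen_iff_eq_or_transGen.1 l with l | l
      · exact hne l
      · exact hT.discrete _ _ _ (bij.mapsTo hq) (bij.mapsTo hp) l

end IsOFS

/-- The local face structure `|S|`: `<~` is restricted to the sets `δ(a)`. -/
def OrdHypergraph.toLocal (S : OrdHypergraph.{u}) : LFS.{u} where
  toHypergraph := S.toHypergraph
  rel a x y := Sum.inl x ∈ S.δ a ∧ Sum.inl y ∈ S.δ a ∧ S.lt x y
  rel_mem _ _ _ h := ⟨h.1, h.2.1⟩

/-- The forgetful functor `|-| : oFs ⥤ lFs`. It does not change underlying maps. -/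
def forget : OFS.{u} ⥤ LFS.{u} where
  obj S := S.toOrd.toLocal
  map {S T} f :=
    { f.toHgHom with
      rel_iff := fun a x y h hx hy => by
        have h0 : 0 < S.toOrd.dim a := lt_trans Nat.zero_lt_one h
        have bij := f.bij_δ a h0
        exact ⟨fun hr => ⟨bij.mapsTo hx, bij.mapsTo hy, f.map_lt x y hr.2.2⟩,
          fun hr => ⟨hx, hy, IsOFS.reflect S.isOFS T.isOFS f h hx hy hr.2.2⟩⟩ }

/-! ## Convex sets, cuts and stretching -/

/-- `X` is closed under `γ` and `δ`, i.e. it is a subhypergraph. -/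
structure IsSub (S : Hypergraph.{u}) (X : Set S.Face) : Prop where
  γ_mem : ∀ a ∈ X, S.γ a ∈ X
  δ_mem : ∀ a ∈ X, ∀ x, Sum.inl x ∈ S.δ a → x ∈ X
  δ_empty_mem : ∀ a ∈ X, ∀ v, Sum.inr v ∈ S.δ a → v ∈ X

/-- The least subhypergraph containing `Z`. -/
def span (S : Hypergraph.{u}) (Z : Set S.Face) : Set S.Face :=
  {a | ∀ X, IsSub S X → Z ⊆ X → a ∈ X}

theorem span_isSub (S : Hypergraph.{u}) (Z : Set S.Face) : IsSub S (span S Z) where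
  γ_mem _ ha X hX hZ := hX.γ_mem _ (ha X hX hZ)
  δ_mem _ ha _ hx X hX hZ := hX.δ_mem _ (ha X hX hZ) _ hx
  δ_empty_mem _ ha _ hv X hX hZ := hX.δ_empty_mem _ (ha X hX hZ) _ hv

theorem subset_span (S : Hypergraph.{u}) (Z : Set S.Face) : Z ⊆ span S Z :=
  fun _ ha _ _ hZ => hZ ha

/-- The empty loops of the subhypergraph `X` over the face `x`: loops `l` in `X` with
`γ(l) = x` that are not of the form `γ(b)`, for a face `b` in `X` that is not a loop. -/
def emptyLoops (S : Hypergraph.{u}) (X : Set S.Face) (x : S.Face) : Set S.Face :=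
  {l | l ∈ X ∧ S.IsLoop l ∧ S.γ l = x ∧ ¬ ∃ b ∈ X, 0 < S.dim b ∧ ¬ S.IsLoop b ∧ S.γ b = l}

/-- `(x, L, U)` is a cut, where `U` is the complement of `L` in the set of empty loops of `X`
over `x`. If `X` is convex then `<~` is a linear order on this set, and a cut is the same as an
initial segment `L` of it. -/
def IsCut (S : OrdHypergraph.{u}) (X : Set S.Face) (x : S.Face) (L : Set S.Face) : Prop :=
  L ⊆ emptyLoops S.toHypergraph X x ∧
    ∀ l ∈ L, ∀ l' ∈ emptyLoops S.toHypergraph X x, S.lt l' l → l' ∈ L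

/-- The lower part `E - ↑a` of the cut `(γ(a), -, ↑a)`, where `E` is the set of empty loops over
`x = γ(a)` and `↑a = {b ∈ E | a <~ b}`. -/
def cutAbove (S : OrdHypergraph.{u}) (X : Set S.Face) (a x : S.Face) : Set S.Face :=
  {b | b ∈ emptyLoops S.toHypergraph X x ∧ ¬ S.lt a b}

/-- The lower part `↓a = {b ∈ E | b <~ a}` of the cut `(x, ↓a, -)`, where `E` is the set of
empty loops over `x`. -/
def cutBelow (S : OrdHypergraph.{u}) (X : Set S.Face) (a x : S.Face) : Set S.Face :=
  {b | b ∈ emptyLoops S.toHypergraph X x ∧ S.lt b a}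

theorem isCut_above (S : OFS.{u}) (X : Set S.toOrd.Face) (a x : S.toOrd.Face) :
    IsCut S.toOrd X x (cutAbove S.toOrd X a x) :=
  ⟨fun _ h => h.1, fun _ hl _ hl' h => ⟨hl', fun h' => hl.2 (S.isOFS.lt_trans _ _ _ h' h)⟩⟩

theorem isCut_below (S : OFS.{u}) (X : Set S.toOrd.Face) (a x : S.toOrd.Face) :
    IsCut S.toOrd X x (cutBelow S.toOrd X a x) :=
  ⟨fun _ h => h.1, fun _ hl _ hl' h => ⟨hl', S.isOFS.lt_trans _ _ _ h hl.2⟩⟩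

theorem isCut_empty (S : OrdHypergraph.{u}) (X : Set S.Face) (x : S.Face) : IsCut S X x ∅ :=
  ⟨Set.empty_subset _, fun _ h => h.elim⟩

/-- The faces of the stretching `[X]`: the cuts `(x, L, U)` with `x ∈ X`. -/
def StretchFace (S : OrdHypergraph.{u}) (X : Set S.Face) : Type u :=
  {p : S.Face × Set S.Face // p.1 ∈ X ∧ IsCut S X p.1 p.2}

open Classical in
/-- `γ(x, L, U) = (γ(x), -, ↑x)`. -/
noncomputable def stretchγ (S : OFS.{u}) (X : Set S.toOrd.Face) (hX : IsSub S.toOrd.toHypergraph X)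
    (p : StretchFace S.toOrd X) : StretchFace S.toOrd X :=
  if S.toOrd.dim p.1.1 = 0 then p
  else ⟨(S.toOrd.γ p.1.1, cutAbove S.toOrd X p.1.1 (S.toOrd.γ p.1.1)),
    hX.γ_mem _ p.2.1, isCut_above S X _ _⟩

/-- `δ(x, L, U)` is `1_{(v, -, ↑γ(x))}` if `δ(x) = 1_v` (where `v = γγ(x)`), and
`{(t, ↓x, -) | t ∈ δ(x)}` otherwise. -/
def stretchδ (S : OrdHypergraph.{u}) (X : Set S.Face) (p : StretchFace S X) :
    Set (StretchFace S X ⊕ StretchFace S X) :=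
  {y | Sum.elim
    (fun q => Sum.inl q.1.1 ∈ S.δ p.1.1 ∧ q.1.2 = cutBelow S X p.1.1 q.1.1)
    (fun q => Sum.inr q.1.1 ∈ S.δ p.1.1 ∧ q.1.2 = cutAbove S X (S.γ p.1.1) q.1.1) y}

/-- The cut `(t, ↓x, -)`, for `t ∈ δ(x)`. -/
def below (S : OFS.{u}) (X : Set S.toOrd.Face) (hX : IsSub S.toOrd.toHypergraph X)
    (p : StretchFace S.toOrd X) (t : S.toOrd.Face) (ht : Sum.inl t ∈ S.toOrd.δ p.1.1) :
    StretchFace S.toOrd X :=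
  ⟨(t, cutBelow S.toOrd X p.1.1 t), hX.δ_mem _ p.2.1 _ ht, isCut_below S X _ _⟩

theorem stretchδ_image (S : OFS.{u}) (X : Set S.toOrd.Face)
    (hX : IsSub S.toOrd.toHypergraph X) (p : StretchFace S.toOrd X) :
    Set.BijOn (Sum.map (fun q : StretchFace S.toOrd X => q.1.1) (fun q => q.1.1))
      (stretchδ S.toOrd X p) (S.toOrd.δ p.1.1) := by
  refine ⟨?_, ?_, ?_⟩
  · rintro (q | q) hq
    · exact hq.1
    · exact hq.1
  · rintro (q | q) hq (r | r) hr h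
    · simp only [Sum.map_inl, Sum.inl.injEq] at h
      congr 1
      apply Subtype.ext
      apply Prod.ext h
      rw [hq.2, hr.2, h]
    · simp at h
    · simp at h
    · simp only [Sum.map_inr, Sum.inr.injEq] at h
      congr 1
      apply Subtype.ext
      apply Prod.ext h
      rw [hq.2, hr.2, h]
  · rintro (t | v) ht
    · exact ⟨Sum.inl (below S X hX p t ht), ⟨ht, rfl⟩, rfl⟩
    · exact ⟨Sum.inr ⟨(v, cutAbove S.toOrd X (S.toOrd.γ p.1.1) v),
        hX.δ_empty_mem _ p.2.1 _ ht, isCut_above S X _ _⟩, ⟨ht, rfl⟩, rfl⟩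

/-- If `δ'` is carried bijectively onto `δ`, it has the same shape. -/
theorem shape_of_bijOn {A B : Type u} {f : A → B} {s : Set (A ⊕ A)} {t : Set (B ⊕ B)}
    (h : Set.BijOn (Sum.map f f) s t)
    (ht : (∃ y, t = {y}) ∨ (t.Nonempty ∧ ∀ y ∈ t, ∃ x, y = Sum.inl x)) :
    (∃ y, s = {y}) ∨ (s.Nonempty ∧ ∀ y ∈ s, ∃ x, y = Sum.inl x) := by
  rcases ht with ⟨y, rfl⟩ | ⟨⟨y, hy⟩, hall⟩
  · left
    obtain ⟨x, hx, hxy⟩ := h.surjOn rfl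
    refine ⟨x, Set.eq_singleton_iff_unique_mem.2 ⟨hx, fun z hz => h.injOn hz hx ?_⟩⟩
    exact (h.mapsTo hz).trans (h.mapsTo hx).symm
  · right
    obtain ⟨x, hx, -⟩ := h.surjOn hy
    refine ⟨⟨x, hx⟩, ?_⟩
    rintro (z | z) hz
    · exact ⟨z, rfl⟩
    · obtain ⟨w, hw⟩ := hall _ (h.mapsTo hz)
      simp at hw

/-- The stretching `[X]` of a subhypergraph `X` of `S`. -/
noncomputable def stretch (S : OFS.{u}) (X : Set S.toOrd.Face)
    (hX : IsSub S.toOrd.toHypergraph X) : OrdHypergraph.{u} where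
  Face := StretchFace S.toOrd X
  finite := by
    have := S.toOrd.finite
    exact Subtype.finite
  dim p := S.toOrd.dim p.1.1
  γ := stretchγ S X hX
  δ := stretchδ S.toOrd X
  γ_zero p h := by simp [stretchγ, h]
  dim_γ p h := by
    have h' : S.toOrd.dim p.1.1 ≠ 0 := by omega
    simp only [stretchγ, h']
    exact S.toOrd.dim_γ _ h
  dim_δ _ _ h := S.toOrd.dim_δ _ _ h.1
  dim_δ_empty _ _ h := S.toOrd.dim_δ_empty _ _ h.1
  δ_total p h := shape_of_bijOn (stretchδ_image S X hX p) (S.toOrd.δ_total _ h)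
  δ_one p h := by
    obtain ⟨t, ht⟩ := S.toOrd.δ_one _ h
    have b := stretchδ_image S X hX p
    have hm : (Sum.inl t : S.toOrd.Face ⊕ S.toOrd.Face) ∈ S.toOrd.δ p.1.1 := by
      rw [ht]; rfl
    refine ⟨below S X hX p t hm, Set.eq_singleton_iff_unique_mem.2 ⟨⟨hm, rfl⟩, fun z hz => ?_⟩⟩
    refine b.injOn hz ⟨hm, rfl⟩ ?_
    have := b.mapsTo hz
    rw [ht] at this
    exact this
  lt p q := S.toOrd.lt p.1.1 q.1.1
  lt_dim p q h := S.toOrd.lt_dim _ _ h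

/-- The projection `[X] → S`. -/
noncomputable def stretchProj (S : OFS.{u}) (X : Set S.toOrd.Face)
    (hX : IsSub S.toOrd.toHypergraph X) : stretch S X hX ⟶ S.toOrd where
  toFun p := p.1.1
  dim_map _ := rfl
  map_γ p h := by
    have h' : S.toOrd.dim p.1.1 ≠ 0 := Nat.pos_iff_ne_zero.1 h
    change (stretchγ S X hX p).1.1 = _
    simp [stretchγ, h']
  bij_δ p _ := stretchδ_image S X hX p
  map_lt _ _ h := h

/-! ## `k`-domains and `k`-codomains -/

/-- The convex set `d^(k) S`. -/
def domSet (k : ℕ) (S : Hypergraph.{u}) : Set S.Face :=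
  {a | S.dim a < k ∨ (S.dim a = k ∧ a ∉ S.γNonloops)}

/-- The convex set `c^(k) S`. -/
def codSet (k : ℕ) (S : Hypergraph.{u}) : Set S.Face :=
  {a | S.dim a + 1 < k ∨ (S.dim a + 1 = k ∧ ∀ b, a ∉ S.ι b) ∨
    (S.dim a = k ∧ a ∉ S.δNonloops)}

/-- The `k`-domain `𝐝^(k) S = [d^(k) S]`. -/
noncomputable def dom (k : ℕ) (S : OFS.{u}) : OrdHypergraph.{u} :=
  stretch S (span S.toOrd.toHypergraph (domSet k S.toOrd.toHypergraph)) (span_isSub _ _)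

/-- The `k`-codomain `𝐜^(k) S = [c^(k) S]`. -/
noncomputable def cod (k : ℕ) (S : OFS.{u}) : OrdHypergraph.{u} :=
  stretch S (span S.toOrd.toHypergraph (codSet k S.toOrd.toHypergraph)) (span_isSub _ _)

/-- The map `𝐝^(k) S → S`. -/
noncomputable def domMap (k : ℕ) (S : OFS.{u}) : dom k S ⟶ S.toOrd := stretchProj _ _ _

/-- The map `𝐜^(k) S → S`. -/
noncomputable def codMap (k : ℕ) (S : OFS.{u}) : cod k S ⟶ S.toOrd := stretchProj _ _ _

/-- A face of `d^(k) S`, as a face of `𝐝^(k) S` (the cut with empty lower part). -/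
def domFace (k : ℕ) (S : OFS.{u}) (t : S.toOrd.Face)
    (ht : t ∈ domSet k S.toOrd.toHypergraph) : (dom k S).Face :=
  ⟨(t, ∅), subset_span _ _ ht, isCut_empty _ _ _⟩

/-! ## The `k`-tensor -/

section Tensor

variable (k : ℕ) (S T : OFS.{u}) (φ : cod k S ≅ dom k T)

/-- The faces of `S ⊗_k T`: the faces of `S`, and those faces of `T` which are not in `d^(k) T`,
i.e. the faces of dimension `> k` and the `k`-faces in `γ` of a face that is not a loop. -/
def TensorFace : Type u :=
  S.toOrd.Face ⊕ {t : T.toOrd.Face // t ∉ domSet k T.toOrd.toHypergraph}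

/-- The map `κ_S` on faces. -/
def tensorLeft (s : S.toOrd.Face) : TensorFace k S T := Sum.inl s

open Classical in
/-- The map `κ_T` on faces: a face in `d^(k) T` is sent to the corresponding face of `S`, via
`𝐝^(k) T ≅ 𝐜^(k) S → S`, the other faces to themselves. -/
noncomputable def tensorRight (t : T.toOrd.Face) : TensorFace k S T :=
  if h : t ∈ domSet k T.toOrd.toHypergraph then
    Sum.inl ((codMap k S).toFun (φ.inv.toFun (domFace k T t h)))
  else Sum.inr ⟨t, h⟩

def tensorDim : TensorFace k S T → ℕ :=
  Sum.elim S.toOrd.dim (fun t => T.toOrd.dim t.1)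

/-- The codomains in `S ⊗_k T`. -/
noncomputable def tensorγ : TensorFace k S T → TensorFace k S T :=
  Sum.elim (fun s => tensorLeft k S T (S.toOrd.γ s))
    (fun t => tensorRight k S T φ (T.toOrd.γ t.1))

/-- The domains in `S ⊗_k T`. -/
noncomputable def tensorδ : TensorFace k S T → Set (TensorFace k S T ⊕ TensorFace k S T) :=
  Sum.elim
    (fun s => Sum.map (tensorLeft k S T) (tensorLeft k S T) '' S.toOrd.δ s)
    (fun t => Sum.map (tensorRight k S T φ) (tensorRight k S T φ) '' T.toOrd.δ t.1)

theorem tensorDim_left (s : S.toOrd.Face) :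
    tensorDim k S T (tensorLeft k S T s) = S.toOrd.dim s := rfl

theorem tensorDim_right (t : T.toOrd.Face) :
    tensorDim k S T (tensorRight k S T φ t) = T.toOrd.dim t := by
  by_cases h : t ∈ domSet k T.toOrd.toHypergraph
  · have e : tensorRight k S T φ t =
      Sum.inl ((codMap k S).toFun (φ.inv.toFun (domFace k T t h))) := dif_pos h
    rw [e]
    change S.toOrd.dim _ = _
    rw [(codMap k S).dim_map, φ.inv.dim_map]
    rfl
  · have e : tensorRight k S T φ t = Sum.inr ⟨t, h⟩ := dif_neg h
    rw [e]
    rfl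

theorem shape_image {A B : Type u} (f : A → B) {s : Set (A ⊕ A)}
    (hs : (∃ y, s = {y}) ∨ (s.Nonempty ∧ ∀ y ∈ s, ∃ x, y = Sum.inl x)) :
    (∃ y, Sum.map f f '' s = {y}) ∨
      ((Sum.map f f '' s).Nonempty ∧ ∀ y ∈ Sum.map f f '' s, ∃ x, y = Sum.inl x) := by
  rcases hs with ⟨y, rfl⟩ | ⟨hne, hall⟩
  · exact Or.inl ⟨_, Set.image_singleton⟩
  · right
    refine ⟨hne.image _, ?_⟩
    rintro _ ⟨y, hy, rfl⟩
    obtain ⟨x, rfl⟩ := hall y hy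
    exact ⟨f x, rfl⟩

/-- The hypergraph `S ⊗_k T`. -/
noncomputable def tensorHg : Hypergraph.{u} where
  Face := TensorFace k S T
  finite := by
    have := S.toOrd.finite
    have := T.toOrd.finite
    unfold TensorFace
    infer_instance
  dim := tensorDim k S T
  γ := tensorγ k S T φ
  δ := tensorδ k S T φ
  γ_zero := by
    rintro (s | t) h
    · exact congrArg Sum.inl (S.toOrd.γ_zero s h)
    · change tensorRight k S T φ (T.toOrd.γ t.1) = _
      rw [T.toOrd.γ_zero t.1 h]
      exact dif_neg t.2
  dim_γ := by
    rintro (s | t) h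
    · exact S.toOrd.dim_γ s h
    · change tensorDim k S T (tensorRight k S T φ (T.toOrd.γ t.1)) + 1 = T.toOrd.dim t.1
      rw [tensorDim_right]
      exact T.toOrd.dim_γ t.1 h
  dim_δ := by
    rintro (s | t) x ⟨y | y, hy, hxy⟩
    · cases hxy
      exact S.toOrd.dim_δ s y hy
    · cases hxy
    · cases hxy
      rw [tensorDim_right]
      exact T.toOrd.dim_δ t.1 y hy
    · cases hxy
  dim_δ_empty := by
    rintro (s | t) x ⟨y | y, hy, hxy⟩
    · cases hxy
    · cases hxy
      exact S.toOrd.dim_δ_empty s y hy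
    · cases hxy
    · cases hxy
      rw [tensorDim_right]
      exact T.toOrd.dim_δ_empty t.1 y hy
  δ_total := by
    rintro (s | t) h
    · exact shape_image _ (S.toOrd.δ_total s h)
    · exact shape_image _ (T.toOrd.δ_total t.1 h)
  δ_one := by
    rintro (s | t) h
    · obtain ⟨x, hx⟩ := S.toOrd.δ_one s h
      refine ⟨tensorLeft k S T x, ?_⟩
      change Sum.map _ _ '' S.toOrd.δ s = _
      rw [hx, Set.image_singleton]
      rfl
    · obtain ⟨x, hx⟩ := T.toOrd.δ_one t.1 h
      refine ⟨tensorRight k S T φ x, ?_⟩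
      change Sum.map _ _ '' T.toOrd.δ t.1 = _
      rw [hx, Set.image_singleton]
      rfl

/-- The faces `zS` of `S` and `zT` of `T` are the same element of `S_k ∩ T_k`. -/
def Shared (zS : S.toOrd.Face) (zT : T.toOrd.Face) : Prop :=
  T.toOrd.dim zT = k ∧ tensorRight k S T φ zT = tensorLeft k S T zS

/-- The order `<~` of `S ⊗_k T`. -/
inductive TensorLt : TensorFace k S T → TensorFace k S T → Prop
  /-- On faces of `S` it is the order of `S`. -/
  | left (a b : S.toOrd.Face) : S.toOrd.lt a b →
      TensorLt (tensorLeft k S T a) (tensorLeft k S T b)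
  /-- On faces of `T` of dimension at least `k` it is the order of `T`. -/
  | right (a b : T.toOrd.Face) : k ≤ T.toOrd.dim a → T.toOrd.lt a b →
      TensorLt (tensorRight k S T φ a) (tensorRight k S T φ b)
  /-- In dimension `k + 1`, faces of `S` come before the faces of `T` that are above them in the
  relation `<⁻`. -/
  | cross (a : S.toOrd.Face) (b : T.toOrd.Face) :
      S.toOrd.dim a = k + 1 → T.toOrd.dim b = k + 1 →
      (tensorHg k S T φ).ltMinus (tensorLeft k S T a) (tensorRight k S T φ b) →
      TensorLt (tensorLeft k S T a) (tensorRight k S T φ b)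
  /-- In dimension `k`, for `x ∈ δ(S^{-λ}_{k+1})` and `y ∈ γ(T^{-λ}_{k+1})`: `x <~ y` if
  `x ≤⁺ z <~ y` for some `z ∈ S_k ∩ T_k`. -/
  | below (x zS : S.toOrd.Face) (y zT : T.toOrd.Face) :
      S.toOrd.dim x = k → x ∈ S.toOrd.δNonloops →
      T.toOrd.dim y = k → y ∈ T.toOrd.γNonloops →
      Shared k S T φ zS zT → S.toOrd.lePlus x zS → T.toOrd.lt zT y →
      TensorLt (tensorLeft k S T x) (tensorRight k S T φ y)
  /-- In dimension `k`, for `x ∈ δ(S^{-λ}_{k+1})` and `y ∈ γ(T^{-λ}_{k+1})`: `y <~ x` if `y <⁻ x`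
  and there is `z ∈ S_k ∩ T_k` with `x ≤⁺ z` and `y <~ z`. -/
  | above (x zS : S.toOrd.Face) (y zT : T.toOrd.Face) :
      S.toOrd.dim x = k → x ∈ S.toOrd.δNonloops →
      T.toOrd.dim y = k → y ∈ T.toOrd.γNonloops →
      (tensorHg k S T φ).ltMinus (tensorRight k S T φ y) (tensorLeft k S T x) →
      Shared k S T φ zS zT → S.toOrd.lePlus x zS → T.toOrd.lt y zT →
      TensorLt (tensorRight k S T φ y) (tensorLeft k S T x)

/-- The `k`-tensor `S ⊗_k T`. -/
noncomputable def tensor : OrdHypergraph.{u} where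
  toHypergraph := tensorHg k S T φ
  lt := TensorLt k S T φ
  lt_dim := by
    intro x y h
    change tensorDim k S T x = tensorDim k S T y
    cases h with
    | left a b h => exact S.toOrd.lt_dim a b h
    | right a b _ h =>
      rw [tensorDim_right, tensorDim_right]
      exact T.toOrd.lt_dim a b h
    | cross a b ha hb _ => rw [tensorDim_right, tensorDim_left, ha, hb]
    | below x zS y zT hx _ hy => rw [tensorDim_right, tensorDim_left, hx, hy]
    | above x zS y zT hx _ hy => rw [tensorDim_right, tensorDim_left, hx, hy]

end Tensor

end FaceStructure

open FaceStructure

/-! Since `a <⁻ b` says that `γ(a)` is `≤⁺` some face in `δ(b)` (`ltMinus_iff`), everything reduces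
to `≤⁺`. Upper paths can be refined to steps along minimal faces, those that are not codomains of
non-loops (`minStep_of_le`). Hence the faces below `b` behave like a pasting diagram: an upper path
leaves it only through `γ(b)` and enters it only through `δ(b)` (`LowerNode.up`, `UpperNode.down`),
and every face, loops included, that touches one of its inner nodes is strictly below `b`
(`Inner.ltPlus`). For loops this rests on loop filling and on pencil linearity for empty domains. It
yields the compatibilities of `<~` with `≤⁺` that are needed to glue.

The set `d^(k) T` contains all minimal faces of dimension at most `k`, so it has no empty loops.
Therefore `𝐝^(k) T` embeds in `T` and inherits the axioms (`isOFS_dom`), and `𝐜^(k) S` gets them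
through `φ`.

Let `f : d^(k) T → S` be the gluing map. It is injective outside dimension `k - 1`, and its
`k`-faces correspond to the maximal `k`-faces of `S`. Two `(k-1)`-faces with the same image are cuts
over one face of `S`; inserting loops one at a time joins them by a path of `k`-faces lying over
loops (`codPath`). These facts are collected in `IsGluing`. They imply that `f` reflects the strict
order in dimension `k - 1` (`ltPlus_of_map`), and that a `k`-face of `T` one of whose domain faces
is identified with its codomain has a singleton domain, so becomes a loop (`δ_eq_of_map_eq`).

In the tensor every `k`-face `a` of `S` lies below `f(z)` for exactly one `z`, and relations between
`a` and a new `k`-face of `T` are those between `z` and that face, up to a condition on `<⁻`. The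
axioms have to be rechecked mainly in dimensions `k` and `k + 1`, where faces are identified or
become loops, or where faces of `S` meet new faces of `T`.

The square is a pushout in local face structures because `κ_S` and `κ_T` are jointly surjective and
being a local morphism is a condition at single faces, which may be tested on preimages
(`LocalAt.of_comp`). -/

namespace FaceStructure

open Relation

/-! ## The orders of a hypergraph -/

namespace Hypergraph

variable {S : Hypergraph.{u}}

/-- The reflexive closure of the upper order. -/
abbrev le (S : Hypergraph.{u}) : S.Face → S.Face → Prop := ReflTransGen S.upperStep

theorem le_iff {a b : S.Face} : S.le a b ↔ a = b ∨ S.ltPlus a b := by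
  rw [eq_comm]
  exact reflTransGen_iff_eq_or_transGen

theorem ltPlus.le {a b : S.Face} (h : S.ltPlus a b) : S.le a b := TransGen.to_reflTransGen h

theorem dim_of_mem {c x : S.Face} (h : Sum.inl x ∈ S.δ c) : S.dim (S.γ c) = S.dim x := by
  have h1 := S.dim_δ c x h
  have h2 := S.dim_γ c (by omega)
  omega

theorem upperStep.dim_eq {a b : S.Face} (h : S.upperStep a b) : S.dim a = S.dim b := by
  obtain ⟨c, _, h, rfl⟩ := h
  exact (dim_of_mem h).symm

theorem le.dim_eq {a b : S.Face} (h : S.le a b) : S.dim a = S.dim b := by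
  induction h with
  | refl => rfl
  | tail _ h ih => exact ih.trans h.dim_eq

theorem ltPlus.dim_eq {a b : S.Face} (h : S.ltPlus a b) : S.dim a = S.dim b :=
  le.dim_eq h.le

theorem le_of_mem {c x : S.Face} (h : Sum.inl x ∈ S.δ c) : S.le x (S.γ c) := by
  by_cases hd : S.IsLoop c
  · rw [hd.2] at h
    cases h
    exact ReflTransGen.refl
  · exact ReflTransGen.single ⟨c, hd, h, rfl⟩

theorem ltPlus_of_mem {c x : S.Face} (hc : ¬ S.IsLoop c) (h : Sum.inl x ∈ S.δ c) :
    S.ltPlus x (S.γ c) := TransGen.single ⟨c, hc, h, rfl⟩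

/-- Each face of a lower path has its codomain in the domain of the next one, so the path projects
to an upper path one dimension down. Conversely, every face that carries an upper step can be
inserted as a lower step. Loops do no harm because `≤⁺` is reflexive. -/
theorem ltMinus_iff {a b : S.Face} :
    S.ltMinus a b ↔ 0 < S.dim a ∧ ∃ p, Sum.inl p ∈ S.δ b ∧ S.le (S.γ a) p := by
  constructor
  · intro h
    induction h with
    | single h => exact ⟨h.1, _, h.2, ReflTransGen.refl⟩
    | tail _ h ih =>
      obtain ⟨h0, p, hp, hle⟩ := ih
      exact ⟨h0, _, h.2, hle.trans (le_of_mem hp)⟩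
  · rintro ⟨h0, p, hp, hle⟩
    induction hle generalizing b with
    | refl => exact TransGen.single ⟨h0, hp⟩
    | tail _ h ih =>
      obtain ⟨c, _, hc, rfl⟩ := h
      have := S.dim_δ c _ hc
      exact TransGen.tail (ih hc) ⟨by omega, hp⟩

theorem ltMinus.dim_eq {a b : S.Face} (h : S.ltMinus a b) : S.dim a = S.dim b := by
  obtain ⟨h0, p, hp, hle⟩ := ltMinus_iff.1 h
  have h1 := S.dim_δ b p hp
  have h2 := S.dim_γ a h0
  have h3 := le.dim_eq hle
  omega

/-- A face that is not the codomain of a face that is not a loop. -/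
def IsMin (S : Hypergraph.{u}) (m : S.Face) : Prop := m ∉ S.γNonloops

/-- `w` is the codomain of a face below `b` that is not a loop. -/
def UpperNode (S : Hypergraph.{u}) (b w : S.Face) : Prop :=
  ∃ m, 0 < S.dim m ∧ ¬ S.IsLoop m ∧ S.le m b ∧ S.γ m = w

/-- `w` is in the domain of a face below `b` that is not a loop. -/
def LowerNode (S : Hypergraph.{u}) (b w : S.Face) : Prop :=
  ∃ m, ¬ S.IsLoop m ∧ S.le m b ∧ Sum.inl w ∈ S.δ m

/-- Faces inside the pasting diagram of the faces below `b`. -/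
def Inner (S : Hypergraph.{u}) (b w : S.Face) : Prop := S.UpperNode b w ∧ S.LowerNode b w

theorem UpperNode.mono {b b' w : S.Face} (h : S.UpperNode b w) (hb : S.le b b') :
    S.UpperNode b' w := by
  obtain ⟨m, h0, h1, h2, h3⟩ := h
  exact ⟨m, h0, h1, h2.trans hb, h3⟩

theorem LowerNode.mono {b b' w : S.Face} (h : S.LowerNode b w) (hb : S.le b b') :
    S.LowerNode b' w := by
  obtain ⟨m, h1, h2, h3⟩ := h
  exact ⟨m, h1, h2.trans hb, h3⟩

theorem Inner.mono {b b' w : S.Face} (h : S.Inner b w) (hb : S.le b b') : S.Inner b' w :=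
  ⟨h.1.mono hb, h.2.mono hb⟩

theorem δ_eq_of_inr {a v : S.Face} (h : Sum.inr v ∈ S.δ a) : S.δ a = {Sum.inr v} := by
  have := S.dim_δ_empty a v h
  rcases S.δ_total a (by omega) with ⟨y, hy⟩ | ⟨_, h'⟩
  · rw [hy] at h ⊢
    rw [Set.mem_singleton_iff.1 h]
  · obtain ⟨x, hx⟩ := h' _ h
    cases hx

theorem not_isLoop_of_isEmptyDom {a : S.Face} (h : S.IsEmptyDom a) : ¬ S.IsLoop a := by
  obtain ⟨v, hv⟩ := h
  intro h
  have := hv.symm.trans h.2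
  simp at this

theorem mem_θFaces {a x : S.Face} :
    x ∈ S.θFaces a ↔ 0 < S.dim a ∧ (Sum.inl x ∈ S.δ a ∨ x = S.γ a) := by
  simp [θFaces, θ]

theorem θFaces_of_mem {a x : S.Face} (h : Sum.inl x ∈ S.δ a) : x ∈ S.θFaces a := by
  have := S.dim_δ a x h
  exact mem_θFaces.2 ⟨by omega, Or.inl h⟩

theorem γ_mem_θFaces {a : S.Face} (h : 0 < S.dim a) : S.γ a ∈ S.θFaces a :=
  mem_θFaces.2 ⟨h, Or.inr rfl⟩

theorem dim_of_mem_θFaces {a x : S.Face} (h : x ∈ S.θFaces a) : S.dim x + 1 = S.dim a := by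
  obtain ⟨h0, h | rfl⟩ := mem_θFaces.1 h
  · exact S.dim_δ a x h
  · exact S.dim_γ a h0

theorem le_γ_of_mem_θFaces {a x : S.Face} (h : x ∈ S.θFaces a) : S.le x (S.γ a) := by
  obtain ⟨_, h | rfl⟩ := mem_θFaces.1 h
  · exact le_of_mem h
  · exact ReflTransGen.refl

theorem dim_of_mem_ι {b x : S.Face} (h : x ∈ S.ι b) : S.dim x + 2 = S.dim b := by
  obtain ⟨p, hp, q, hq, h0, rfl, _⟩ := h
  have h1 := S.dim_δ b p hp.1
  have h2 := S.dim_γ p h0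
  omega

end Hypergraph

/-! ## Combinatorics of ordered face structures -/

namespace IsOFS

open FaceStructure.Hypergraph

variable {S : OrdHypergraph.{u}} (hS : IsOFS S)
include hS

theorem wf_ltPlus : WellFounded S.ltPlus := by
  have := S.finite
  have : IsTrans S.Face S.ltPlus := ⟨fun _ _ _ h h' => TransGen.trans h h'⟩
  have : Std.Irrefl S.ltPlus := ⟨hS.ltPlus_irrefl⟩
  exact Finite.wellFounded_of_trans_of_irrefl _

theorem le_antisymm {a b : S.Face} (h : S.le a b) (h' : S.le b a) : a = b := by
  rcases le_iff.1 h with rfl | h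
  · rfl
  · exact (hS.ltPlus_irrefl a (h.trans_left h')).elim

theorem not_le_of_lt {a b : S.Face} (h : S.ltPlus a b) : ¬ S.le b a := fun h' =>
  hS.ltPlus_irrefl a (h.trans_left h')

theorem isLoop_of_γ_mem {a : S.Face} (h : Sum.inl (S.γ a) ∈ S.δ a) : S.IsLoop a := by
  by_contra hl
  exact hS.ltPlus_irrefl _ (ltPlus_of_mem hl h)

theorem γγ_not_mem {a z : S.Face} (ha : 2 ≤ S.dim a) (hz : z ∈ S.δNonloop a) :
    Sum.inl (S.γ (S.γ a)) ∉ S.δ z := by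
  intro h
  have hm : (Sum.inl (S.γ (S.γ a)) : S.Face ⊕ S.Face) ∈
      ({Sum.inl (S.γ (S.γ a))} : Set (S.Face ⊕ S.Face)) := rfl
  rw [hS.glob_γ a ha] at hm
  exact hm.2 (Set.mem_biUnion hz h)

theorem exists_γExt {a : S.Face} (ha : 2 ≤ S.dim a) :
    ∃ y ∈ S.δ a, S.γExt y = S.γ (S.γ a) := by
  have hm : (Sum.inl (S.γ (S.γ a)) : S.Face ⊕ S.Face) ∈
      ({Sum.inl (S.γ (S.γ a))} : Set (S.Face ⊕ S.Face)) := rfl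
  rw [hS.glob_γ a ha] at hm
  obtain ⟨⟨y, hy, h⟩, _⟩ := hm
  exact ⟨y, hy, Sum.inl_injective h⟩

/-- The closure in `≡₁` adds empty faces only, so on non-empty faces globularity is an honest
equality. -/
theorem mem_δγ_iff {a q : S.Face} (ha : 2 ≤ S.dim a) :
    Sum.inl q ∈ S.δ (S.γ a) ↔
      (∃ y ∈ S.δ a, Sum.inl q ∈ S.δExt y) ∧ ∀ z ∈ S.δNonloop a, S.γ z ≠ q := by
  have key : ∀ A : Set (S.Face ⊕ S.Face),
      (Sum.inl q : S.Face ⊕ S.Face) ∈ S.emptyClosure A ↔ Sum.inl q ∈ A := by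
    intro A
    simp [emptyClosure]
  rw [← key, hS.glob_δ a ha, key]
  simp

/-- Otherwise `γγ(A)` comes from a loop or an empty face in `δ(A)`, hence lies in `δδ(A)`, and
nothing removes it: it would lie in `δγ(A)` and make `γ(A)` a loop. -/
theorem exists_nonloop_γ {A : S.Face} (hA : 2 ≤ S.dim A) (h : ¬ S.IsLoop (S.γ A)) :
    ∃ z ∈ S.δNonloop A, S.γ z = S.γ (S.γ A) := by
  have dγ := S.dim_γ A (by omega)
  by_contra hno
  push Not at hno
  refine h (hS.isLoop_of_γ_mem ((hS.mem_δγ_iff hA).2 ⟨?_, hno⟩))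
  obtain ⟨y, hy, hyγ⟩ := hS.exists_γExt hA
  refine ⟨y, hy, ?_⟩
  rcases y with y | v
  · have hl : S.IsLoop y := by
      by_contra hl
      exact hno y ⟨hy, hl⟩ hyγ
    change Sum.inl _ ∈ S.δ y
    rw [hl.2, ← hyγ]
    rfl
  · rw [← hyγ]
    rfl

theorem chain_of_nonloop {A z : S.Face} (hA : 2 ≤ S.dim A) (hz : z ∈ S.δNonloop A) :
    ∃ z' ∈ S.δNonloop A, S.γ z' = S.γ (S.γ A) := by
  rcases ReflTransGen.cases_tail (hS.chain_top hA _ z hz.1 rfl) with h | ⟨_, _, z', hz', _, h⟩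
  · exact ⟨z, hz, h.symm⟩
  · exact ⟨z', hz', h⟩

/-- The chain of non-loops starting at `z` ends in `γγ(A)`, so globularity removes `γγ(A)` from
`δγ(A)`. -/
theorem not_isLoop_γ {A z : S.Face} (hA : 2 ≤ S.dim A) (hz : z ∈ S.δNonloop A) :
    ¬ S.IsLoop (S.γ A) := by
  intro hl
  obtain ⟨z', hz', h⟩ := hS.chain_of_nonloop hA hz
  have : Sum.inl (S.γ (S.γ A)) ∈ S.δ (S.γ A) := by rw [hl.2]; rfl
  exact ((hS.mem_δγ_iff hA).1 this).2 z' hz' h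

theorem not_isLoop_of_le {a b : S.Face} (h : S.le a b) (ha : ¬ S.IsLoop a) : ¬ S.IsLoop b := by
  induction h with
  | refl => exact ha
  | tail _ h ih =>
    obtain ⟨c, _, hc, rfl⟩ := h
    intro hl
    have h1 := S.dim_δ c _ hc
    have h2 := dim_of_mem hc
    have h3 := hl.1
    exact hS.not_isLoop_γ (by omega) ⟨hc, ih⟩ hl

/-- In pencil linearity the alternative `<~` would imply `<⁻`, and following codomains would then
close a cycle of `<⁺`. -/
theorem comparable_γ {a b : S.Face} (h0 : 0 < S.dim a) (h0' : 0 < S.dim b) (ha : ¬ S.IsLoop a)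
    (hb : ¬ S.IsLoop b) (h : S.γ a = S.γ b) : a = b ∨ S.ltPlus a b ∨ S.ltPlus b a := by
  by_cases hab : a = b
  · exact Or.inl hab
  rcases hS.pencil a b hab ⟨S.γ a, γ_mem_θFaces h0, h ▸ γ_mem_θFaces h0'⟩ with (h' | h') | h'
  · exact (hS.no_minus_of_γ hb h (hS.lt_ltMinus _ _ h')).elim
  · exact (hS.no_minus_of_γ ha h.symm (hS.lt_ltMinus _ _ h')).elim
  · exact Or.inr h'

/-- Faces in the domain of `γ(A)` are in the domain of a face of `δ(A)` that is not a loop, or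
are equal to `γγ(A)`. -/
theorem mem_δγ_cases {A p : S.Face} (hA : 2 ≤ S.dim A) (hp : Sum.inl p ∈ S.δ (S.γ A)) :
    (∃ z ∈ S.δNonloop A, Sum.inl p ∈ S.δ z) ∨ p = S.γ (S.γ A) := by
  obtain ⟨⟨y, hy, hpy⟩, hne⟩ := (hS.mem_δγ_iff hA).1 hp
  rcases y with y | v
  · by_cases hl : S.IsLoop y
    · have : p = S.γ y := by
        change Sum.inl p ∈ S.δ y at hpy
        rw [hl.2] at hpy
        exact Sum.inl_injective hpy
      rcases hS.exists_step hA hy with h | h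
      · exact Or.inr (this.trans h)
      · rw [← this] at h
        exact Or.inl h
    · exact Or.inl ⟨y, ⟨hy, hl⟩, hpy⟩
  · have hpv : p = v := Sum.inl_injective hpy
    obtain ⟨y', hy', h⟩ := hS.exists_γExt hA
    rw [δ_eq_of_inr hy] at hy'
    rw [hy'] at h
    exact Or.inr (hpv.trans h)

theorem mem_δγ_of_nonloop {A p : S.Face} (hA : 2 ≤ S.dim A) (hl : ¬ S.IsLoop (S.γ A))
    (hp : Sum.inl p ∈ S.δ (S.γ A)) : ∃ z ∈ S.δNonloop A, Sum.inl p ∈ S.δ z := by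
  rcases hS.mem_δγ_cases hA hp with h | rfl
  · exact h
  · exact (hl (hS.isLoop_of_γ_mem hp)).elim

theorem mem_or_of_mem {A z p : S.Face} (hA : 2 ≤ S.dim A) (hz : Sum.inl z ∈ S.δ A)
    (hp : Sum.inl p ∈ S.δ z) :
    Sum.inl p ∈ S.δ (S.γ A) ∨ ∃ z' ∈ S.δNonloop A, S.γ z' = p := by
  by_cases h : ∃ z' ∈ S.δNonloop A, S.γ z' = p
  · exact Or.inr h
  · push Not at h
    exact Or.inl ((hS.mem_δγ_iff hA).2 ⟨⟨_, hz, hp⟩, h⟩)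

omit hS in
theorem exists_of_mem_γNonloops {c : S.Face} (h : c ∈ S.γNonloops) (h0 : 0 < S.dim c) :
    ∃ A, 2 ≤ S.dim A ∧ ¬ S.IsLoop A ∧ S.γ A = c := by
  obtain ⟨A, hA0, hA, rfl⟩ := h
  have := S.dim_γ A hA0
  exact ⟨A, by omega, hA, rfl⟩

/-- If `c = γ(A)`, then some non-loop in `δ(A)` has the same codomain as `c` and is strictly below
it; the descent stops at a minimal face. -/
theorem exists_min_γ {c : S.Face} (h0 : 0 < S.dim c) (hc : ¬ S.IsLoop c) :
    ∃ m, 0 < S.dim m ∧ ¬ S.IsLoop m ∧ S.IsMin m ∧ S.le m c ∧ S.γ m = S.γ c := by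
  induction c using hS.wf_ltPlus.induction with
  | _ c ih =>
    by_cases hm : S.IsMin c
    · exact ⟨c, h0, hc, hm, ReflTransGen.refl, rfl⟩
    · obtain ⟨A, hA, hAl, rfl⟩ := exists_of_mem_γNonloops (not_not.1 hm) h0
      obtain ⟨z, hz, hpz⟩ := hS.exists_nonloop_γ hA hc
      have hlt := ltPlus_of_mem hAl hz.1
      obtain ⟨m, h1, h2, h3, h4, h5⟩ := ih z hlt (by rw [hlt.dim_eq]; exact h0) hz.2
      exact ⟨m, h1, h2, h3, h4.trans hlt.le, h5.trans hpz⟩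

omit hS in
theorem IsMin.eq_of_le {m x : S.Face} (hm : S.IsMin m) (h : S.le x m) : x = m := by
  rcases ReflTransGen.cases_tail h with h | ⟨y, _, c, hc, hy, h⟩
  · exact h.symm
  · have := S.dim_δ c y hy
    exact (hm ⟨c, by omega, hc, h⟩).elim

omit hS in
theorem IsMin.not_lt {m x : S.Face} (hm : S.IsMin m) : ¬ S.ltPlus x m := by
  intro h
  obtain ⟨y, _, c, hc, hy, h⟩ := TransGen.tail'_iff.1 h
  have := S.dim_δ c y hy
  exact hm ⟨c, by omega, hc, h⟩

/-- Non-loops sharing a domain face are `≤⁺`-comparable, and nothing is strictly below `m`. In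
particular at most one minimal non-loop starts at a given face. -/
theorem min_le_of_δ {m c p : S.Face} (hm : S.IsMin m) (hl : ¬ S.IsLoop m) (hc : ¬ S.IsLoop c)
    (hp : Sum.inl p ∈ S.δ m) (hp' : Sum.inl p ∈ S.δ c) : S.le m c := by
  rcases hS.comparable hl hc hp hp' with rfl | h | h
  · exact ReflTransGen.refl
  · exact h.le
  · exact (IsMin.not_lt hm h).elim

theorem min_le_of_γ {m c : S.Face} (hm : S.IsMin m) (hl : ¬ S.IsLoop m) (hc : ¬ S.IsLoop c)
    (h0 : 0 < S.dim m) (h0' : 0 < S.dim c) (h : S.γ m = S.γ c) : S.le m c := by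
  rcases hS.comparable_γ h0 h0' hl hc h with rfl | h | h
  · exact ReflTransGen.refl
  · exact h.le
  · exact (IsMin.not_lt hm h).elim

/-- An upper step along a minimal face. -/
def minStep (S : OrdHypergraph.{u}) (a b : S.Face) : Prop :=
  ∃ c, ¬ S.IsLoop c ∧ S.IsMin c ∧ Sum.inl a ∈ S.δ c ∧ S.γ c = b

/-- A step along `γ(A)` is replaced by a chain of steps along non-loops of `δ(A)`, which are
strictly smaller, until only minimal faces remain. -/
theorem minStep_of_mem {c p : S.Face} (hc : ¬ S.IsLoop c) (hp : Sum.inl p ∈ S.δ c) :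
    ReflTransGen (minStep S) p (S.γ c) := by
  induction c using hS.wf_ltPlus.induction generalizing p with
  | _ c ih =>
    by_cases hm : S.IsMin c
    · exact ReflTransGen.single ⟨c, hc, hm, hp, rfl⟩
    · obtain ⟨A, hA, hAl, rfl⟩ := exists_of_mem_γNonloops (not_not.1 hm) (dim_pos_of_mem hp)
      have hch : ∀ v w, ReflTransGen (chain S A) v w → ReflTransGen (minStep S) v w := by
        intro v w h
        induction h with
        | refl => exact ReflTransGen.refl
        | tail _ h ih' =>
          obtain ⟨z, hz, hv, rfl⟩ := h
          exact ih'.trans (ih z (ltPlus_of_mem hAl hz.1) hz.2 hv)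
      obtain ⟨z, hz, hpz⟩ := hS.mem_δγ_of_nonloop hA hc hp
      exact (ih z (ltPlus_of_mem hAl hz.1) hz.2 hpz).trans
        (hch _ _ (hS.chain_top hA _ z hz.1 rfl))

theorem minStep_of_le {a b : S.Face} (h : S.le a b) : ReflTransGen (minStep S) a b := by
  induction h with
  | refl => exact ReflTransGen.refl
  | tail _ h ih =>
    obtain ⟨c, hc, hp, rfl⟩ := h
    exact ih.trans (hS.minStep_of_mem hc hp)

omit hS in
theorem le_of_minStep {a b : S.Face} (h : ReflTransGen (minStep S) a b) : S.le a b :=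
  ReflTransGen.mono (fun _ _ ⟨c, hc, _, hp, h⟩ => ⟨c, hc, hp, h⟩) _ _ h

/-! ### Nodes -/

/-- When `e ∈ δ(A)` is replaced by `γ(A)`, the codomain of `e` either is `γγ(A)` or feeds into
another face of `δ(A)`. -/
theorem γ_eq_or_lowerNode {m e : S.Face} (h0 : 0 < S.dim m) (h : S.le m e) :
    S.γ m = S.γ e ∨ S.LowerNode e (S.γ m) := by
  induction h with
  | refl => exact Or.inl rfl
  | tail hme h ih =>
    have hle := ReflTransGen.single h
    obtain ⟨A, hAl, hA, rfl⟩ := h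
    rcases ih with ih | ih
    · have h1 := S.dim_δ A _ hA
      have h2 := le.dim_eq hme
      rcases hS.exists_step (by omega) hA with h | ⟨z, hz, hm⟩
      · exact Or.inl (ih.trans h)
      · exact Or.inr ⟨z, hz.2, le_of_mem hz.1, ih ▸ hm⟩
    · exact Or.inr (ih.mono hle)

theorem mem_or_upperNode {m e w : S.Face} (h : S.le m e) (hw : Sum.inl w ∈ S.δ m) :
    Sum.inl w ∈ S.δ e ∨ S.UpperNode e w := by
  induction h with
  | refl => exact Or.inl hw
  | tail _ h ih =>
    have hle := ReflTransGen.single h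
    obtain ⟨A, hAl, hA, rfl⟩ := h
    rcases ih with ih | ih
    · have h1 := S.dim_δ A _ hA
      have h2 := S.dim_δ _ _ ih
      rcases hS.mem_or_of_mem (by omega) hA ih with h | ⟨z, hz, hm⟩
      · exact Or.inl h
      · have := S.dim_δ A _ hz.1
        exact Or.inr ⟨z, by omega, hz.2, le_of_mem hz.1, hm⟩
    · exact Or.inr (ih.mono hle)

theorem UpperNode.cases {b w : S.Face} (h : S.UpperNode b w) : w = S.γ b ∨ S.LowerNode b w := by
  obtain ⟨m, h0, _, hle, rfl⟩ := h
  exact hS.γ_eq_or_lowerNode h0 hle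

theorem LowerNode.cases {b w : S.Face} (h : S.LowerNode b w) :
    Sum.inl w ∈ S.δ b ∨ S.UpperNode b w := by
  obtain ⟨m, _, hle, hw⟩ := h
  exact hS.mem_or_upperNode hle hw

omit hS in
theorem lowerNode_of_mem {b w : S.Face} (hb : ¬ S.IsLoop b) (h : Sum.inl w ∈ S.δ b) :
    S.LowerNode b w := ⟨b, hb, ReflTransGen.refl, h⟩

omit hS in
theorem upperNode_γ {b : S.Face} (h0 : 0 < S.dim b) (hb : ¬ S.IsLoop b) :
    S.UpperNode b (S.γ b) := ⟨b, h0, hb, ReflTransGen.refl, rfl⟩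

theorem LowerNode.lt {b w : S.Face} (h : S.LowerNode b w) : S.ltPlus w (S.γ b) := by
  obtain ⟨m, hm, hle, hw⟩ := h
  refine (ltPlus_of_mem hm hw).trans_left ?_
  rcases le_iff.1 hle with rfl | h
  · exact ReflTransGen.refl
  · exact hS.γ_mono (dim_pos_of_mem hw) h

/-- A minimal face that starts at a lower node of `b` shares it with some face below `b`, hence is
itself below `b`, and its codomain is `γ(b)` or again an inner node. So a path can leave the diagram
below `b` only through `γ(b)`. -/
theorem LowerNode.up {b w w' : S.Face} (h : S.LowerNode b w) (hle : S.le w w') :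
    w = w' ∨ S.le (S.γ b) w' ∨ S.Inner b w' := by
  replace hle := hS.minStep_of_le hle
  induction hle with
  | refl => exact Or.inl rfl
  | @tail v _ _ hs ih =>
    have hup := le_of_minStep (ReflTransGen.single hs)
    obtain ⟨c, hc, hcm, hv, rfl⟩ := hs
    have hc0 := dim_pos_of_mem hv
    have key : S.LowerNode b v → S.le (S.γ b) (S.γ c) ∨ S.Inner b (S.γ c) := by
      rintro ⟨m, hm, hle, hw⟩
      have hcb := (hS.min_le_of_δ hcm hc hm hv hw).trans hle
      have hU : S.UpperNode b (S.γ c) := ⟨c, hc0, hc, hcb, rfl⟩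
      rcases UpperNode.cases hS hU with h | h
      · rw [h]; exact Or.inl ReflTransGen.refl
      · exact Or.inr ⟨hU, h⟩
    rcases ih with rfl | ih | ih
    · exact Or.inr (key h)
    · exact Or.inr (Or.inl (ih.trans hup))
    · exact Or.inr (key ih.2)

/-- The dual statement: followed backwards, a path can leave the diagram below `b` only through
`δ(b)`. -/
theorem UpperNode.down {b w w' : S.Face} (h : S.UpperNode b w) (hle : S.le w' w) :
    w' = w ∨ (∃ q, Sum.inl q ∈ S.δ b ∧ S.le w' q) ∨ S.Inner b w' := by
  replace hle := hS.minStep_of_le hle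
  induction hle using ReflTransGen.head_induction_on with
  | refl => exact Or.inl rfl
  | @head v _ hs _ ih =>
    have hup := le_of_minStep (ReflTransGen.single hs)
    obtain ⟨c, hc, hcm, hv, rfl⟩ := hs
    have hc0 := dim_pos_of_mem hv
    have key : S.UpperNode b (S.γ c) → (∃ q, Sum.inl q ∈ S.δ b ∧ S.le v q) ∨ S.Inner b v := by
      rintro ⟨m, h0, hm, hle, hw⟩
      have hcb := (hS.min_le_of_γ hcm hc hm hc0 h0 hw.symm).trans hle
      have hL : S.LowerNode b v := ⟨c, hc, hcb, hv⟩
      rcases LowerNode.cases hS hL with h | h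
      · exact Or.inl ⟨_, h, ReflTransGen.refl⟩
      · exact Or.inr ⟨h, hL⟩
    rcases ih with h' | ⟨q, hq, h'⟩ | ih
    · exact Or.inr (key (h' ▸ h))
    · exact Or.inr (Or.inl ⟨q, hq, hup.trans h'⟩)
    · exact Or.inr (key ih.1)

/-- Let `b = γ(A)` and `m ≤⁺ e ∈ δ(A)`. A face of `δ(b)` lies in the domain of a non-loop `x ∈
δ(A)`. If it is `γ(e)`, globularity excludes it; otherwise `x` is comparable with `e`, so `x = e` by
local discreteness, and the claim descends to `e`. -/
theorem UpperNode.not_mem {b w : S.Face} (h : S.UpperNode b w) : Sum.inl w ∉ S.δ b := by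
  obtain ⟨m, h0, hm, hle, rfl⟩ := h
  intro hw
  induction hle with
  | refl => exact hm (hS.isLoop_of_γ_mem hw)
  | @tail e _ hme hs ih =>
    obtain ⟨A, hAl, hA, rfl⟩ := hs
    have h1 := S.dim_δ A _ hA
    have h2 := le.dim_eq hme
    have hel := hS.not_isLoop_of_le hme hm
    obtain ⟨_, hne⟩ := (hS.mem_δγ_iff (by omega)).1 hw
    obtain ⟨x, hx, hwx⟩ := hS.mem_δγ_of_nonloop (by omega) (hS.not_isLoop_γ (by omega) ⟨hA, hel⟩) hw
    rcases hS.γ_eq_or_lowerNode h0 hme with h | ⟨m', hm', hle', hw'⟩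
    · exact hne e ⟨hA, hel⟩ h.symm
    · have hcmp : S.le x e ∨ S.le e x := by
        rcases hS.comparable hx.2 hm' hwx hw' with rfl | h | h
        · exact Or.inl hle'
        · exact Or.inl (h.le.trans hle')
        · exact hS.up_linear _ _ _ h.le hle'
      have hxe : x = e := by
        rcases hcmp with h | h
        · exact (le_iff.1 h).resolve_right (hS.discrete A _ _ hx.1 hA)
        · exact ((le_iff.1 h).resolve_right (hS.discrete A _ _ hA hx.1)).symm
      exact ih (hxe ▸ hwx)

/-! ### Loops at inner nodes -/

/-- Fill `l = γ(W)`. If `W` does not have an empty domain, its domain consists of loops, since a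
non-loop would make `γ(W)` a non-loop; they lie over the same face strictly below `l`, so one can
descend. This makes the pencil axiom for empty domains applicable to arbitrary loops. -/
theorem exists_isEmptyDom {l : S.Face} (hl : S.IsLoop l) :
    ∃ E, S.IsEmptyDom E ∧ 2 ≤ S.dim E ∧ S.le (S.γ E) l ∧ S.γ (S.γ E) = S.γ l := by
  induction l using hS.wf_ltPlus.induction with
  | _ l ih =>
    obtain ⟨W, hW, hWl, rfl⟩ := exists_of_mem_γNonloops (hS.loop_filling l hl) hl.1
    by_cases hW' : S.IsEmptyDom W
    · exact ⟨W, hW', hW, ReflTransGen.refl, rfl⟩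
    · have : ∃ x, Sum.inl x ∈ S.δ W := by
        rcases S.δ_total W (by omega) with ⟨y | y, hy⟩ | ⟨⟨y, hy⟩, hall⟩
        · exact ⟨y, by rw [hy]; rfl⟩
        · exact (hW' ⟨y, hy⟩).elim
        · obtain ⟨x, rfl⟩ := hall y hy
          exact ⟨x, hy⟩
      obtain ⟨x, hx⟩ := this
      have hno : ∀ z, z ∉ S.δNonloop W := fun z hz => hS.not_isLoop_γ hW hz hl
      have hxl : S.IsLoop x := by
        by_contra h
        exact hno x ⟨hx, h⟩
      have hlt := ltPlus_of_mem hWl hx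
      obtain ⟨E, h1, h2, h3, h4⟩ := ih x hlt hxl
      refine ⟨E, h1, h2, h3.trans hlt.le, h4.trans ?_⟩
      rcases hS.exists_step hW hx with h | ⟨z, hz, _⟩
      · exact h
      · exact (hno z hz).elim

/-- The last step of the refined path runs along a minimal non-loop with codomain `γ(A)`, which can
only be `A`. -/
theorem IsMin.exists_mem_of_lt {A m : S.Face} (hA : S.IsMin A) (hAl : ¬ S.IsLoop A)
    (h0 : 0 < S.dim A) (h : S.le m (S.γ A)) (hne : m ≠ S.γ A) :
    ∃ e, Sum.inl e ∈ S.δ A ∧ S.le m e := by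
  rcases ReflTransGen.cases_tail (hS.minStep_of_le h) with h | ⟨e, he, c, hc, hcm, hec, h⟩
  · exact (hne h.symm).elim
  · have : A = c :=
      IsMin.eq_of_le hcm (hS.min_le_of_γ hA hAl hc h0 (dim_pos_of_mem hec) h.symm)
    exact ⟨e, this ▸ hec, le_of_minStep he⟩

/-- An inner node of the faces below `b` is an inner node of a face of the next dimension. -/
theorem Inner.exists_ι {b w : S.Face} (h : S.Inner b w) :
    ∃ A, 2 ≤ S.dim A ∧ S.le (S.γ A) b ∧ w ∈ S.ι A := by
  induction b using hS.wf_ltPlus.induction with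
  | _ b ih =>
    obtain ⟨⟨m, h0, hm, hmb, hmw⟩, ⟨m', hm', hmb', hw'⟩⟩ := h
    have db := le.dim_eq hmb
    have hbl := hS.not_isLoop_of_le hmb hm
    have hne : m ≠ b := by
      rintro rfl
      have := LowerNode.lt hS ⟨m', hm', hmb', hw'⟩
      rw [hmw] at this
      exact hS.ltPlus_irrefl _ this
    have hne' : m' ≠ b := by
      rintro rfl
      exact UpperNode.not_mem hS ⟨m, h0, hm, hmb, hmw⟩ hw'
    have hbm : b ∈ S.γNonloops := by
      by_contra hb
      exact hne (IsMin.eq_of_le hb hmb)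
    obtain ⟨A0, hA0, hA0l, rfl⟩ := exists_of_mem_γNonloops hbm (by omega)
    -- A minimal face over `b` is needed so that paths ending in `b` pass through its domain.
    obtain ⟨A, hA, hAl, hAm, hAA, hAγ⟩ := hS.exists_min_γ (by omega) hA0l
    have dA := le.dim_eq hAA
    obtain ⟨e, he, hle⟩ := IsMin.exists_mem_of_lt hS hAm hAl hA (hAγ ▸ hmb) (hAγ ▸ hne)
    obtain ⟨e', he', hle'⟩ := IsMin.exists_mem_of_lt hS hAm hAl hA (hAγ ▸ hmb') (hAγ ▸ hne')
    have hel := hS.not_isLoop_of_le hle hm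
    have hel' := hS.not_isLoop_of_le hle' hm'
    have hlt : S.ltPlus e (S.γ A0) := hAγ ▸ ltPlus_of_mem hAl he
    by_cases hee : e = e'
    · subst hee
      obtain ⟨B, h1, h2, h3⟩ := ih e hlt ⟨⟨m, h0, hm, hle, hmw⟩, ⟨m', hm', hle', hw'⟩⟩
      exact ⟨B, h1, h2.trans hlt.le, h3⟩
    -- Distinct faces of `δ(A)` are incomparable. If `w` were not `γ(e)`, or not in `δ(e')`, it
    -- would give comparable non-loops below `e` and `e'`, and upward linearity would make `e` and
    -- `e'` comparable.
    · have hnc : ¬ (S.le e e' ∨ S.le e' e) := by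
        rintro (h | h)
        · exact hS.discrete A _ _ he he' ((le_iff.1 h).resolve_left hee)
        · exact hS.discrete A _ _ he' he ((le_iff.1 h).resolve_left (Ne.symm hee))
      have de := le.dim_eq hle
      refine ⟨A, by omega, hAγ ▸ ReflTransGen.refl, e, ⟨he, hel⟩, e', ⟨he', hel'⟩, by omega, ?_, ?_⟩
      · rcases hS.γ_eq_or_lowerNode h0 hle with h | ⟨m2, hm2, hle2, hw2⟩
        · exact h.symm.trans hmw
        · exfalso
          rw [hmw] at hw2
          rcases hS.comparable hm2 hm' hw2 hw' with rfl | h | h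
          · exact hnc (hS.up_linear _ _ _ hle2 hle')
          · exact hnc (hS.up_linear _ _ _ hle2 (h.le.trans hle'))
          · exact hnc (hS.up_linear _ _ _ (h.le.trans hle2) hle')
      · rcases hS.mem_or_upperNode hle' hw' with h | ⟨m2, h02, hm2, hle2, hw2⟩
        · exact h
        · exfalso
          rcases hS.comparable_γ h0 h02 hm hm2 (hmw.trans hw2.symm) with rfl | h | h
          · exact hnc (hS.up_linear _ _ _ hle hle2)
          · exact hnc (hS.up_linear _ _ _ hle (h.le.trans hle2))
          · exact hnc (hS.up_linear _ _ _ (h.le.trans hle) hle2)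

omit hS in
theorem inner_of_ι {A w : S.Face} (h : w ∈ S.ι A) : S.Inner (S.γ A) w := by
  obtain ⟨p, hp, q, hq, h0, hpw, hwq⟩ := h
  exact ⟨⟨p, h0, hp.2, le_of_mem hp.1, hpw⟩, ⟨q, hq.2, le_of_mem hq.1, hwq⟩⟩

theorem γ_le_of_ι {E A : S.Face} (hE : S.IsEmptyDom E) (h2 : 2 ≤ S.dim E)
    (h : S.γ (S.γ E) ∈ S.ι A) : S.le (S.γ E) (S.γ A) := by
  have d1 := dim_of_mem_ι h
  rcases hS.pencil_empty E A h2 (by omega) hE h with h | h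
  · exact γ_le_of_minus (hS.lt_ltMinus _ _ h).to_reflTransGen
  · exact hS.γ_mono (by omega) h

/-- Below `l` lies `γ(E)` with `E` of empty domain over `w`, and `w` is internal to some `A` with
`γ(A) ≤⁺ b`. The pencil axiom gives `γ(E) ≤⁺ γ(A) ≤⁺ b`, so `l` and `b` are comparable by upward
linearity; `b ≤⁺ l` is impossible because `b` is above a non-loop. -/
theorem loop_le_of_inner {b l w : S.Face} (h : S.Inner b w) (hl : S.IsLoop l)
    (hw : S.γ l = w) : S.le l b := by
  obtain ⟨E, hE, hE2, hle, hEγ⟩ := hS.exists_isEmptyDom hl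
  obtain ⟨A, hA, hAb, hι⟩ := Inner.exists_ι hS h
  have h1 := (hS.γ_le_of_ι hE hE2 (by rw [hEγ, hw]; exact hι)).trans hAb
  rcases hS.up_linear _ _ _ hle h1 with h' | h'
  · exact h'
  · obtain ⟨m, h0, hm, hmb, _⟩ := h.1
    exact (hS.not_isLoop_of_le (hmb.trans h') hm hl).elim

/-- A face that touches an inner node of `b` is below `b`. -/
theorem Inner.ltPlus {b w z : S.Face} (h : S.Inner b w) (hz : w ∈ S.θFaces z) :
    S.ltPlus z b := by
  have hcomp : S.le z b ∨ S.le b z := by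
    by_cases hl : S.IsLoop z
    · left
      refine hS.loop_le_of_inner h hl ?_
      obtain ⟨_, h | h⟩ := mem_θFaces.1 hz
      · rw [hl.2] at h
        exact (Sum.inl_injective h).symm
      · exact h.symm
    obtain ⟨⟨m, h0, hm, hmb, hmw⟩, ⟨m', hm', hmb', hw'⟩⟩ := h
    obtain ⟨hz0, hz | hz⟩ := mem_θFaces.1 hz
    · rcases hS.comparable hl hm' hz hw' with rfl | h | h
      · exact Or.inl hmb'
      · exact Or.inl (h.le.trans hmb')
      · exact hS.up_linear _ _ _ h.le hmb'
    · rcases hS.comparable_γ hz0 h0 hl hm (hz.symm.trans hmw.symm) with rfl | h | h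
      · exact Or.inl hmb
      · exact Or.inl (h.le.trans hmb)
      · exact hS.up_linear _ _ _ h.le hmb
  -- Otherwise `w` would be an inner node of `z` too, but an inner node is neither in `δ(z)` nor
  -- equal to `γ(z)`.
  have hno : ¬ S.le b z := by
    intro hbz
    have h' := h.mono hbz
    obtain ⟨_, hz | hz⟩ := mem_θFaces.1 hz
    · exact UpperNode.not_mem hS h'.1 hz
    · have := LowerNode.lt hS h'.2
      rw [hz] at this
      exact hS.ltPlus_irrefl _ this
  rcases hcomp with h | h
  · rcases le_iff.1 h with rfl | h
    · exact (hno ReflTransGen.refl).elim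
    · exact h
  · exact (hno h).elim

end IsOFS

end FaceStructure

namespace FaceStructure

open Relation

namespace IsOFS

open FaceStructure.Hypergraph

variable {S : OrdHypergraph.{u}} (hS : IsOFS S)
include hS

/-! ### The two orders -/

theorem le_γ {a b : S.Face} (h0 : 0 < S.dim a) (h : S.le a b) : S.le (S.γ a) (S.γ b) := by
  rcases le_iff.1 h with rfl | h
  · exact ReflTransGen.refl
  · exact hS.γ_mono h0 h

theorem not_le_of_lt_tilde {a b : S.Face} (h : S.lt a b) : ¬ S.le a b ∧ ¬ S.le b a := by
  have := hS.disjoint a b h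
  constructor
  · intro h'
    rcases le_iff.1 h' with rfl | h'
    · exact hS.lt_irrefl _ h
    · exact this.1 h'
  · intro h'
    rcases le_iff.1 h' with rfl | h'
    · exact hS.lt_irrefl _ h
    · exact this.2 h'

/-- Pencil linearity decides if there is a common face. If not, `θ(a)` and `θ(b)` are disjoint,
since a common empty face would leave `δ(b)` without faces, against `a <⁻ b`; then disjointness
applies. -/
theorem lt_of_not_le {a b : S.Face}
    (h : S.ltMinus a b ∨ (S.θFaces a ∩ S.θFaces b).Nonempty)
    (h1 : ¬ S.le a b) (h2 : ¬ S.le b a) (h3 : ¬ S.lt b a) : S.lt a b := by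
  by_cases hθ : (S.θFaces a ∩ S.θFaces b).Nonempty
  · rcases hS.pencil a b (fun h => h1 (h ▸ ReflTransGen.refl)) hθ with (h | h) | (h | h)
    · exact h
    · exact (h3 h).elim
    · exact (h1 h.le).elim
    · exact (h2 h.le).elim
  · have hm := h.resolve_right hθ
    refine hS.lt_of_ltMinus a b ?_ hm
    rw [Set.eq_empty_iff_forall_notMem]
    rintro (y | v) ⟨hy, hy'⟩
    · exact hθ ⟨y, hy, hy'⟩
    · obtain ⟨_, hy' | hy'⟩ := hy'
      · obtain ⟨_, p, hp, _⟩ := ltMinus_iff.1 hm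
        rw [δ_eq_of_inr hy'] at hp
        simp at hp
      · simp at hy'

theorem lt_of_le_of_lt {x z w : S.Face} (h : S.le x z) (h' : S.lt z w) : S.lt x w := by
  have hz := hS.not_le_of_lt_tilde h'
  obtain ⟨h0, p, hp, hle⟩ := ltMinus_iff.1 (hS.lt_ltMinus _ _ h')
  have h0' : 0 < S.dim x := by rw [h.dim_eq]; exact h0
  refine hS.lt_of_not_le (Or.inl (ltMinus_iff.2 ⟨h0', p, hp, (hS.le_γ h0' h).trans hle⟩)) ?_ ?_ ?_
  · intro h1
    rcases hS.up_linear _ _ _ h h1 with h2 | h2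
    · exact hz.1 h2
    · exact hz.2 h2
  · exact fun h1 => hz.2 (h1.trans h)
  · exact fun h1 => (hS.not_le_of_lt_tilde (hS.lt_trans _ _ _ h' h1)).2 h

/-- When the left-hand face is made smaller `<⁻` survives by monotonicity of `γ`; on the right it
need not, so it is assumed. The last two clauses of the order of the tensor show the same asymmetry.
-/
theorem lt_of_lt_of_le {x z w : S.Face} (h' : S.lt w z) (h : S.le x z) (hm : S.ltMinus w x) :
    S.lt w x := by
  have hz := hS.not_le_of_lt_tilde h'
  refine hS.lt_of_not_le (Or.inl hm) ?_ ?_ ?_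
  · exact fun h1 => hz.1 (h1.trans h)
  · intro h1
    rcases hS.up_linear _ _ _ h h1 with h2 | h2
    · exact hz.2 h2
    · exact hz.1 h2
  · exact fun h1 => (hS.not_le_of_lt_tilde (hS.lt_trans _ _ _ h1 h')).1 h

/-- The path from `γ(x)` to `δ(x')` starts at `γ(z)` or at a lower node of `z`. It passes through
`γ(z)`, or it stops at a face that `z` and `x'` share, or it stops at an inner node of `z`; in the
last case `x'` would be below `z` by `Inner.ltPlus`. -/
theorem lt_of_lt_of_le_left {x x' z : S.Face} (h : S.lt x x') (hle : S.le x z)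
    (hn : ¬ S.le x' z) : S.lt z x' := by
  have hx := hS.not_le_of_lt_tilde h
  have hn' : ¬ S.le z x' := fun h1 => hx.1 (hle.trans h1)
  refine hS.lt_of_not_le ?_ hn' hn
    fun h1 => (hS.not_le_of_lt_tilde (hS.lt_trans _ _ _ h h1)).1 hle
  obtain ⟨h0, p, hp, hγ⟩ := ltMinus_iff.1 (hS.lt_ltMinus _ _ h)
  have h0' : 0 < S.dim z := by rw [← hle.dim_eq]; exact h0
  have hin : ¬ S.Inner z p := fun h1 => hn (Inner.ltPlus hS h1 (θFaces_of_mem hp)).le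
  have hlow : S.LowerNode z p → (S.θFaces z ∩ S.θFaces x').Nonempty := by
    intro h1
    rcases LowerNode.cases hS h1 with h2 | h2
    · exact ⟨p, θFaces_of_mem h2, θFaces_of_mem hp⟩
    · exact (hin ⟨h2, h1⟩).elim
  rcases hS.γ_eq_or_lowerNode h0 hle with h1 | h1
  · exact Or.inl (ltMinus_iff.2 ⟨h0', p, hp, h1 ▸ hγ⟩)
  rcases LowerNode.up hS h1 hγ with h2 | h2 | h2
  · exact Or.inr (hlow (h2 ▸ h1))
  · exact Or.inl (ltMinus_iff.2 ⟨h0', p, hp, h2⟩)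
  · exact (hin h2).elim

theorem lt_of_lt_of_le_right {x x' z : S.Face} (h : S.lt x x') (hle : S.le x' z)
    (hn : ¬ S.le x z) : S.lt x z := by
  have hx := hS.not_le_of_lt_tilde h
  have hn' : ¬ S.le z x := fun h1 => hx.2 (hle.trans h1)
  refine hS.lt_of_not_le ?_ hn hn'
    fun h1 => (hS.not_le_of_lt_tilde (hS.lt_trans _ _ _ h1 h)).2 hle
  obtain ⟨h0, p, hp, hγ⟩ := ltMinus_iff.1 (hS.lt_ltMinus _ _ h)
  have hin : ¬ S.Inner z (S.γ x) := fun h1 =>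
    hn (Inner.ltPlus hS h1 (γ_mem_θFaces h0)).le
  rcases hS.mem_or_upperNode hle hp with h1 | h1
  · exact Or.inl (ltMinus_iff.2 ⟨h0, p, h1, hγ⟩)
  rcases UpperNode.down hS h1 hγ with h2 | ⟨q, hq, h2⟩ | h2
  · rw [← h2] at h1
    rcases UpperNode.cases hS h1 with h3 | h3
    · refine Or.inr ⟨S.γ x, γ_mem_θFaces h0, h3 ▸ γ_mem_θFaces ?_⟩
      rw [← hle.dim_eq]
      exact dim_pos_of_mem hp
    · exact (hin ⟨h1, h3⟩).elim
  · exact Or.inl (ltMinus_iff.2 ⟨h0, q, hq, h2⟩)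
  · exact (hin h2).elim

/-- Pencil linearity for faces that touch comparable faces. -/
theorem pencil_of_le {a b x y : S.Face} (hx : x ∈ S.θFaces a) (hy : y ∈ S.θFaces b)
    (h : S.le x y) : (S.le a b ∨ S.le b a) ∨ (S.lt a b ∨ S.lt b a) := by
  have ha0 := (mem_θFaces.1 hx).1
  have hb0 := (mem_θFaces.1 hy).1
  suffices (S.le a b ∨ S.le b a) ∨ (S.ltMinus a b ∨ (S.θFaces a ∩ S.θFaces b).Nonempty) by
    by_contra hno
    push Not at hno
    exact hno.2.1 (hS.lt_of_not_le (this.resolve_left (by tauto)) hno.1.1 hno.1.2 hno.2.2)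
  have key : S.le (S.γ a) y → (S.le a b ∨ S.le b a) ∨
      (S.ltMinus a b ∨ (S.θFaces a ∩ S.θFaces b).Nonempty) := by
    intro h
    obtain ⟨_, hy | hy⟩ := mem_θFaces.1 hy
    · exact Or.inr (Or.inl (ltMinus_iff.2 ⟨ha0, y, hy, h⟩))
    by_cases hl : S.IsLoop b
    · refine Or.inr (Or.inl (ltMinus_iff.2 ⟨ha0, y, ?_, h⟩))
      rw [hl.2, hy]
      rfl
    · rcases UpperNode.down hS (upperNode_γ hb0 hl) (hy ▸ h) with h | ⟨q, hq, h⟩ | h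
      · exact Or.inr (Or.inr ⟨S.γ a, γ_mem_θFaces ha0, h ▸ γ_mem_θFaces hb0⟩)
      · exact Or.inr (Or.inl (ltMinus_iff.2 ⟨ha0, q, hq, h⟩))
      · exact Or.inl (Or.inl (Inner.ltPlus hS h (γ_mem_θFaces ha0)).le)
  obtain ⟨_, hxa | rfl⟩ := mem_θFaces.1 hx
  · by_cases hl : S.IsLoop a
    · rw [hl.2] at hxa
      exact key ((Sum.inl_injective hxa) ▸ h)
    · rcases LowerNode.up hS (lowerNode_of_mem hl hxa) h with rfl | h | h
      · exact Or.inr (Or.inr ⟨x, hx, hy⟩)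
      · exact key h
      · exact Or.inl (Or.inr (Inner.ltPlus hS h hy).le)
  · exact key h

/-- A path from `γ(a)` stays on upper nodes of `b` or passes through `γ(b)`, and in neither case can
it end in `δ(b)`. For `a = b` this says that a non-loop is not `<⁻` itself, whereas loops are. -/
theorem not_ltMinus_of_le {a b : S.Face} (ha : ¬ S.IsLoop a) (h : S.le a b) :
    ¬ S.ltMinus a b := by
  intro hm
  obtain ⟨h0, p, hp, hγ⟩ := ltMinus_iff.1 hm
  have hlt := ltPlus_of_mem (hS.not_isLoop_of_le h ha) hp
  have hU : S.UpperNode b (S.γ a) := ⟨a, h0, ha, h, rfl⟩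
  rcases UpperNode.cases hS hU with h1 | h1
  · exact hS.not_le_of_lt hlt (h1 ▸ hγ)
  rcases LowerNode.up hS h1 hγ with h2 | h2 | h2
  · exact UpperNode.not_mem hS hU (h2 ▸ hp)
  · exact hS.not_le_of_lt hlt h2
  · exact UpperNode.not_mem hS h2.1 hp

theorem not_ltMinus_of_le' {a b : S.Face} (ha : ¬ S.IsLoop a) (h : S.le a b) :
    ¬ S.ltMinus b a := by
  intro hm
  obtain ⟨_, p, hp, hγ⟩ := ltMinus_iff.1 hm
  exact hS.not_le_of_lt (LowerNode.lt hS ⟨a, ha, h, hp⟩) hγ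

/-- The first step of a path that starts in the domain of a minimal face. -/
theorem IsMin.γ_le {z p q : S.Face} (hz : S.IsMin z) (hl : ¬ S.IsLoop z)
    (hp : Sum.inl p ∈ S.δ z) (h : S.le p q) (hne : p ≠ q) : S.le (S.γ z) q := by
  rcases ReflTransGen.cases_head (hS.minStep_of_le h) with h | ⟨_, ⟨c, hc, hcm, hpc, rfl⟩, h⟩
  · exact (hne h).elim
  · rw [IsMin.eq_of_le hcm (hS.min_le_of_δ hz hl hc hp hpc)]
    exact le_of_minStep h

/-- The last step of a path that ends in the codomain of a minimal face. -/
theorem IsMin.le_mem {z q : S.Face} (hz : S.IsMin z) (hl : ¬ S.IsLoop z) (h0 : 0 < S.dim z)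
    (h : S.le q (S.γ z)) (hne : q ≠ S.γ z) : ∃ p, Sum.inl p ∈ S.δ z ∧ S.le q p :=
  IsMin.exists_mem_of_lt hS hz hl h0 h hne

/-- By `Inner.ltPlus`, `p` is strictly below `γ(y)`. Its path upwards enters the diagram of `y` at
some `q ∈ δ(y)`, unless `p` is already inside. If `p` is a node of `y`, minimality puts `z` below
`y`; otherwise the path to `q` starts along `z`, which gives `z <⁻ y`. -/
theorem lt_or_le_of_inner {y z p x : S.Face} (hz : S.IsMin z) (hl : ¬ S.IsLoop z)
    (hp : Sum.inl p ∈ S.δ z) (hy : ¬ S.IsLoop y) (h0 : 0 < S.dim y) (hx : x ∈ S.θFaces p)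
    (h : S.Inner (S.γ y) x) : S.le z y ∨ S.lt z y := by
  have hlt := Inner.ltPlus hS h hx
  by_cases hzy : S.le z y
  · exact Or.inl hzy
  right
  have h1 : ¬ S.le y z := fun h1 => hzy (IsMin.eq_of_le hz h1 ▸ ReflTransGen.refl)
  have hdz := dim_pos_of_mem hp
  rcases UpperNode.down hS (upperNode_γ h0 hy) hlt.le with h2 | ⟨q, hq, h2⟩ | ⟨_, m, hm, hle, h2⟩
  · exact (hS.ltPlus_irrefl _ (h2 ▸ hlt)).elim
  · by_cases hpq : p = q
    · exact (hzy (hS.min_le_of_δ hz hl hy hp (hpq ▸ hq))).elim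
    · refine hS.lt_of_not_le (Or.inl (ltMinus_iff.2
        ⟨hdz, q, hq, IsMin.γ_le hS hz hl hp h2 hpq⟩)) hzy h1 fun h3 => ?_
      obtain ⟨_, p', hp', h4⟩ := ltMinus_iff.1 (hS.lt_ltMinus _ _ h3)
      exact hS.discrete z p p' hp hp' (hlt.trans_left h4)
  · exact (hzy ((hS.min_le_of_δ hz hl hm hp h2).trans hle)).elim

/-! ### Internal faces under the upper order, and maximal faces -/

theorem not_isLoop_of_mem_ι {b w : S.Face} (h : w ∈ S.ι b) : ¬ S.IsLoop b := by
  intro hl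
  obtain ⟨p, hp, q, hq, h0, rfl, hw⟩ := h
  have h1 := hp.1
  have h2 := hq.1
  rw [hl.2] at h1 h2
  have : p = q := (Sum.inl_injective h1).trans (Sum.inl_injective h2).symm
  exact hp.2 (hS.isLoop_of_γ_mem (this ▸ hw))

/-- If `s` does not survive in `δγ(A)`, it is the codomain of a non-loop in `δ(A)`, whose domain
contains a strictly smaller non-loop with the same codomain. With its dual this carries internal
faces of a face in `δ(A)` over to `γ(A)`. -/
theorem exists_δNonloop_γ {A u : S.Face} (hA : 3 ≤ S.dim A) (s : S.Face)
    (hs : ∃ m, Sum.inl m ∈ S.δ A ∧ Sum.inl s ∈ S.δ m) (hl : ¬ S.IsLoop s) (hu : S.γ s = u) :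
    ∃ s' ∈ S.δNonloop (S.γ A), S.γ s' = u := by
  induction s using hS.wf_ltPlus.induction with
  | _ s ih =>
    obtain ⟨m, hm, hs⟩ := hs
    rcases hS.mem_or_of_mem (by omega) hm hs with h | ⟨z, hz, rfl⟩
    · exact ⟨s, ⟨h, hl⟩, hu⟩
    · have hdz := S.dim_δ _ _ hz.1
      obtain ⟨t, ht, htγ⟩ := hS.exists_nonloop_γ (by omega) hl
      exact ih t (ltPlus_of_mem hz.2 ht.1) ⟨z, hz.1, ht.1⟩ ht.2 (htγ.trans hu)

theorem exists_δNonloop_δ {A u : S.Face} (hA : 3 ≤ S.dim A) (s : S.Face)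
    (hs : ∃ m, Sum.inl m ∈ S.δ A ∧ Sum.inl s ∈ S.δ m) (hl : ¬ S.IsLoop s)
    (hu : Sum.inl u ∈ S.δ s) : ∃ s' ∈ S.δNonloop (S.γ A), Sum.inl u ∈ S.δ s' := by
  induction s using hS.wf_ltPlus.induction with
  | _ s ih =>
    obtain ⟨m, hm, hs⟩ := hs
    rcases hS.mem_or_of_mem (by omega) hm hs with h | ⟨z, hz, rfl⟩
    · exact ⟨s, ⟨h, hl⟩, hu⟩
    · have hdz := S.dim_δ _ _ hz.1
      obtain ⟨t, ht, htγ⟩ := hS.mem_δγ_of_nonloop (by omega) hl hu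
      exact ih t (ltPlus_of_mem hz.2 ht.1) ⟨z, hz.1, ht.1⟩ ht.2 htγ

theorem ι_mono {x z u : S.Face} (h : S.le x z) (hu : u ∈ S.ι x) : u ∈ S.ι z := by
  induction h with
  | refl => exact hu
  | tail _ h ih =>
    obtain ⟨A, hAl, hA, rfl⟩ := h
    have h1 := dim_of_mem_ι ih
    have h2 := S.dim_δ A _ hA
    obtain ⟨p, hp, q, hq, _, hγ, hδ⟩ := ih
    obtain ⟨p', hp', hγ'⟩ := hS.exists_δNonloop_γ (by omega) p ⟨_, hA, hp.1⟩ hp.2 hγ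
    obtain ⟨q', hq', hδ'⟩ := hS.exists_δNonloop_δ (by omega) q ⟨_, hA, hq.1⟩ hq.2 hδ
    have h3 := S.dim_δ _ _ hp'.1
    have h4 := dim_of_mem hA
    exact ⟨p', hp', q', hq', by omega, hγ', hδ'⟩

/-- Every face is below a maximal one. -/
theorem exists_top (x : S.Face) : ∃ z, S.le x z ∧ z ∉ S.δNonloops := by
  induction x using hS.wf.induction with
  | _ x ih =>
    by_cases h : x ∈ S.δNonloops
    · obtain ⟨c, hc, hx⟩ := h
      have hlt := ltPlus_of_mem hc hx
      obtain ⟨z, h1, h2⟩ := ih _ hlt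
      exact ⟨z, hlt.le.trans h1, h2⟩
    · exact ⟨x, ReflTransGen.refl, h⟩

omit hS in
theorem eq_of_top_le {z w : S.Face} (hz : z ∉ S.δNonloops) (h : S.le z w) : z = w := by
  rcases ReflTransGen.cases_head h with h | ⟨_, ⟨c, hc, hm, _⟩, _⟩
  · exact h
  · exact (hz ⟨c, hc, hm⟩).elim

theorem top_unique {x z w : S.Face} (hz : z ∉ S.δNonloops) (hw : w ∉ S.δNonloops)
    (h : S.le x z) (h' : S.le x w) : z = w := by
  rcases hS.up_linear _ _ _ h h' with h | h
  · exact eq_of_top_le hz h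
  · exact (eq_of_top_le hw h).symm

end IsOFS

open FaceStructure.Hypergraph

/-! ## Morphisms -/

namespace HgHom

variable {S T : Hypergraph.{u}} (h : HgHom S T)
include h

theorem inl_mem {a x : S.Face} (hx : Sum.inl x ∈ S.δ a) :
    Sum.inl (h.toFun x) ∈ T.δ (h.toFun a) := by
  have := S.dim_δ a x hx
  exact (h.bij_δ a (by omega)).mapsTo hx

theorem inr_mem {a x : S.Face} (hx : Sum.inr x ∈ S.δ a) :
    Sum.inr (h.toFun x) ∈ T.δ (h.toFun a) := by
  have := S.dim_δ_empty a x hx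
  exact (h.bij_δ a (by omega)).mapsTo hx

theorem exists_inl {a : S.Face} {y : T.Face} (hy : Sum.inl y ∈ T.δ (h.toFun a)) :
    ∃ x, Sum.inl x ∈ S.δ a ∧ h.toFun x = y := by
  have := T.dim_δ _ y hy
  rw [h.dim_map] at this
  obtain ⟨x | x, hx, e⟩ := (h.bij_δ a (by omega)).surjOn hy
  · exact ⟨x, hx, Sum.inl_injective e⟩
  · cases e

theorem exists_inr {a : S.Face} {y : T.Face} (hy : Sum.inr y ∈ T.δ (h.toFun a)) :
    ∃ x, Sum.inr x ∈ S.δ a ∧ h.toFun x = y := by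
  have := T.dim_δ_empty _ y hy
  rw [h.dim_map] at this
  obtain ⟨x | x, hx, e⟩ := (h.bij_δ a (by omega)).surjOn hy
  · cases e
  · exact ⟨x, hx, Sum.inr_injective e⟩

theorem isLoop_map {a : S.Face} (ha : S.IsLoop a) : T.IsLoop (h.toFun a) := by
  refine ⟨by rw [h.dim_map]; exact ha.1, ?_⟩
  rw [← h.map_γ a ha.1, ← (h.bij_δ a ha.1).image_eq, ha.2]
  simp

theorem isLoop_of_map {a : S.Face} (ha : T.IsLoop (h.toFun a))
    (hinj : ∀ x y, S.dim x + 1 = S.dim a → S.dim y + 1 = S.dim a →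
      h.toFun x = h.toFun y → x = y) : S.IsLoop a := by
  have h0 : 0 < S.dim a := h.dim_map a ▸ ha.1
  refine ⟨h0, ?_⟩
  have hm : Sum.inl (T.γ (h.toFun a)) ∈ T.δ (h.toFun a) := by rw [ha.2]; rfl
  obtain ⟨x, hx, e⟩ := h.exists_inl hm
  rw [← h.map_γ a h0] at e
  have hxγ : x = S.γ a := hinj _ _ (S.dim_δ a x hx) (S.dim_γ a h0) e
  subst hxγ
  refine Set.eq_singleton_iff_unique_mem.2 ⟨hx, fun y hy => ?_⟩
  have h1 := (h.bij_δ a h0).mapsTo hy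
  have h2 := (h.bij_δ a h0).mapsTo hx
  rw [ha.2] at h1 h2
  exact (h.bij_δ a h0).injOn hy hx (h1.trans h2.symm)

theorem isEmptyDom_map {a : S.Face} (ha : S.IsEmptyDom a) : T.IsEmptyDom (h.toFun a) := by
  obtain ⟨v, hv⟩ := ha
  exact ⟨_, δ_eq_of_inr (h.inr_mem (by rw [hv]; rfl))⟩

theorem isEmptyDom_of_map {a : S.Face} (ha : T.IsEmptyDom (h.toFun a)) : S.IsEmptyDom a := by
  obtain ⟨v, hv⟩ := ha
  obtain ⟨x, hx, _⟩ := h.exists_inr (a := a) (y := v) (by rw [hv]; rfl)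
  exact ⟨_, δ_eq_of_inr hx⟩

theorem mem_θFaces_map {a x : S.Face} (hx : x ∈ S.θFaces a) :
    h.toFun x ∈ T.θFaces (h.toFun a) := by
  obtain ⟨h0, hx | rfl⟩ := mem_θFaces.1 hx
  · exact θFaces_of_mem (h.inl_mem hx)
  · exact mem_θFaces.2 ⟨by rw [h.dim_map]; exact h0, Or.inr (h.map_γ a h0)⟩

theorem exists_mem_θFaces {a : S.Face} {y : T.Face} (hy : y ∈ T.θFaces (h.toFun a)) :
    ∃ x ∈ S.θFaces a, h.toFun x = y := by
  obtain ⟨h0, hy | rfl⟩ := mem_θFaces.1 hy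
  · obtain ⟨x, hx, e⟩ := h.exists_inl hy
    exact ⟨x, θFaces_of_mem hx, e⟩
  · rw [h.dim_map] at h0
    exact ⟨S.γ a, γ_mem_θFaces h0, h.map_γ a h0⟩

theorem lowerStep_map {a b : S.Face} (hab : S.lowerStep a b) :
    T.lowerStep (h.toFun a) (h.toFun b) := by
  refine ⟨by rw [h.dim_map]; exact hab.1, ?_⟩
  rw [← h.map_γ a hab.1]
  exact h.inl_mem hab.2

theorem ltMinus_map {a b : S.Face} (hab : S.ltMinus a b) :
    T.ltMinus (h.toFun a) (h.toFun b) :=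
  TransGen.lift h.toFun (fun _ _ h' => h.lowerStep_map h') _ _ hab

/-- Only `≤⁺` is preserved in general: the face carrying the step may be sent to a loop. -/
theorem le_map_of_upperStep {a b : S.Face} (hab : S.upperStep a b) :
    T.le (h.toFun a) (h.toFun b) := by
  obtain ⟨c, _, ha, rfl⟩ := hab
  have := S.dim_δ c a ha
  rw [h.map_γ c (by omega)]
  exact le_of_mem (h.inl_mem ha)

theorem le_map {a b : S.Face} (hab : S.le a b) : T.le (h.toFun a) (h.toFun b) := by
  induction hab with
  | refl => exact ReflTransGen.refl
  | tail _ hs ih => exact ih.trans (h.le_map_of_upperStep hs)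

theorem upperStep_map {a b : S.Face} (hab : S.upperStep a b)
    (hl : ∀ c, S.dim c = S.dim a + 1 → T.IsLoop (h.toFun c) → S.IsLoop c) :
    T.upperStep (h.toFun a) (h.toFun b) := by
  obtain ⟨c, hc, ha, rfl⟩ := hab
  have := S.dim_δ c a ha
  exact ⟨h.toFun c, fun h' => hc (hl c this.symm h'), h.inl_mem ha,
    (h.map_γ c (by omega)).symm⟩

theorem ltPlus_map {a b : S.Face} (hab : S.ltPlus a b)
    (hl : ∀ c, S.dim c = S.dim a + 1 → T.IsLoop (h.toFun c) → S.IsLoop c) :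
    T.ltPlus (h.toFun a) (h.toFun b) := by
  induction hab with
  | single hs => exact TransGen.single (h.upperStep_map hs hl)
  | tail hs' hs ih =>
    refine TransGen.tail ih (h.upperStep_map hs ?_)
    rw [← ltPlus.dim_eq hs']
    exact hl

theorem mem_ι_map {b u : S.Face} (hu : u ∈ S.ι b)
    (hl : ∀ c, S.dim c + 1 = S.dim b → T.IsLoop (h.toFun c) → S.IsLoop c) :
    h.toFun u ∈ T.ι (h.toFun b) := by
  obtain ⟨p, hp, q, hq, h0, hγ, hδ⟩ := hu
  refine ⟨h.toFun p, ⟨h.inl_mem hp.1, fun h' => hp.2 (hl p (S.dim_δ _ _ hp.1) h')⟩,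
    h.toFun q, ⟨h.inl_mem hq.1, fun h' => hq.2 (hl q (S.dim_δ _ _ hq.1) h')⟩,
    by rw [h.dim_map]; exact h0, ?_, h.inl_mem hδ⟩
  rw [← h.map_γ p h0, hγ]

end HgHom

/-! ## Globularity -/

/-- Globularity at `a`, spelled out for the elements of the sets. -/
structure Hypergraph.GlobAt (S : Hypergraph.{u}) (a : S.Face) : Prop where
  exists_γ : ∃ y ∈ S.δ a, S.γExt y = S.γ (S.γ a)
  γγ_not_mem : ∀ z ∈ S.δNonloop a, Sum.inl (S.γ (S.γ a)) ∉ S.δ z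
  step : ∀ y ∈ S.δ a, S.γExt y = S.γ (S.γ a) ∨ ∃ z ∈ S.δNonloop a, Sum.inl (S.γExt y) ∈ S.δ z
  mem_iff : ∀ q, Sum.inl q ∈ S.δ (S.γ a) ↔
    (∃ y ∈ S.δ a, Sum.inl q ∈ S.δExt y) ∧ ∀ z ∈ S.δNonloop a, S.γ z ≠ q
  inr_of_γ : ∀ v, Sum.inr v ∈ S.δ (S.γ a) →
    (∃ x, Sum.inl x ∈ S.δ a ∧ Sum.inr v ∈ S.δ x) ∨
      ∃ q, Sum.inl q ∈ S.δ (S.γ a) ∧ v ∈ S.θFaces q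
  γ_of_inr : ∀ x v, Sum.inl x ∈ S.δ a → Sum.inr v ∈ S.δ x →
    Sum.inr v ∈ S.δ (S.γ a) ∨ ∃ q, Sum.inl q ∈ S.δ (S.γ a) ∧ v ∈ S.θFaces q

namespace Hypergraph.GlobAt

theorem glob_γ {S : Hypergraph.{u}} {a : S.Face} (h : S.GlobAt a) :
    ({Sum.inl (S.γ (S.γ a))} : Set (S.Face ⊕ S.Face)) =
      ((fun y => Sum.inl (S.γExt y)) '' S.δ a) \ (⋃ x ∈ S.δNonloop a, S.δ x) := by
  ext w
  simp only [Set.mem_singleton_iff, Set.mem_sdiff, Set.mem_image, Set.mem_iUnion, not_exists]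
  constructor
  · rintro rfl
    obtain ⟨y, hy, e⟩ := h.exists_γ
    exact ⟨⟨y, hy, by rw [e]⟩, h.γγ_not_mem⟩
  · rintro ⟨⟨y, hy, rfl⟩, hno⟩
    rcases h.step y hy with e | ⟨z, hz, hm⟩
    · rw [e]
    · exact (hno z hz hm).elim

theorem glob_δ {S : Hypergraph.{u}} {a : S.Face} (h : S.GlobAt a) :
    S.EqOne (S.δ (S.γ a))
      ((⋃ y ∈ S.δ a, S.δExt y) \ ((fun x => Sum.inl (S.γ x)) '' S.δNonloop a)) := by
  have key : ∀ q, Sum.inl q ∈ S.δ (S.γ a) ↔ (Sum.inl q : S.Face ⊕ S.Face) ∈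
      ((⋃ y ∈ S.δ a, S.δExt y) \ ((fun x => Sum.inl (S.γ x)) '' S.δNonloop a)) := by
    intro q
    rw [h.mem_iff q]
    simp
  unfold EqOne
  ext (q | v)
  · have h1 : ∀ A : Set (S.Face ⊕ S.Face),
        (Sum.inl q : S.Face ⊕ S.Face) ∈ S.emptyClosure A ↔ Sum.inl q ∈ A := by
      intro A
      simp [emptyClosure]
    rw [h1, h1, key]
  · have h1 : ∀ A : Set (S.Face ⊕ S.Face),
        (Sum.inr v : S.Face ⊕ S.Face) ∈ S.emptyClosure A ↔
          Sum.inr v ∈ A ∨ ∃ q, Sum.inl q ∈ A ∧ v ∈ S.θFaces q := by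
      intro A
      simp [emptyClosure]
    rw [h1, h1]
    simp only [← key]
    have h2 : (Sum.inr v : S.Face ⊕ S.Face) ∈
        ((⋃ y ∈ S.δ a, S.δExt y) \ ((fun x => Sum.inl (S.γ x)) '' S.δNonloop a)) ↔
        ∃ x, Sum.inl x ∈ S.δ a ∧ Sum.inr v ∈ S.δ x := by
      simp [δExt]
    rw [h2]
    constructor
    · rintro (hv | hv)
      · exact h.inr_of_γ v hv
      · exact Or.inr hv
    · rintro (⟨x, hx, hv⟩ | hv)
      · exact h.γ_of_inr x v hx hv
      · exact Or.inr hv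

end Hypergraph.GlobAt

theorem IsOFS.globAt {S : OrdHypergraph.{u}} (hS : IsOFS S) {a : S.Face} (ha : 2 ≤ S.dim a) :
    S.GlobAt a := by
  have h1 : ∀ (A : Set (S.Face ⊕ S.Face)) v,
        (Sum.inr v : S.Face ⊕ S.Face) ∈ S.emptyClosure A ↔
          Sum.inr v ∈ A ∨ ∃ q, Sum.inl q ∈ A ∧ v ∈ S.θFaces q := by
      intro A
      simp [emptyClosure]
  have h2 : ∀ v, (Sum.inr v : S.Face ⊕ S.Face) ∈
        ((⋃ y ∈ S.δ a, S.δExt y) \ ((fun x => Sum.inl (S.γ x)) '' S.δNonloop a)) ↔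
        ∃ x, Sum.inl x ∈ S.δ a ∧ Sum.inr v ∈ S.δ x := by
      simp [δExt]
  have key : ∀ q, Sum.inl q ∈ S.δ (S.γ a) ↔ (Sum.inl q : S.Face ⊕ S.Face) ∈
      ((⋃ y ∈ S.δ a, S.δExt y) \ ((fun x => Sum.inl (S.γ x)) '' S.δNonloop a)) := by
    intro q
    rw [hS.mem_δγ_iff ha]
    simp
  have h3 : ∀ v, (Sum.inr v ∈ S.δ (S.γ a) ∨ ∃ q, Sum.inl q ∈ S.δ (S.γ a) ∧ v ∈ S.θFaces q) ↔
      ((∃ x, Sum.inl x ∈ S.δ a ∧ Sum.inr v ∈ S.δ x) ∨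
        ∃ q, Sum.inl q ∈ S.δ (S.γ a) ∧ v ∈ S.θFaces q) := by
    intro v
    have := hS.glob_δ a ha
    unfold EqOne at this
    rw [← h1, this, h1, h2]
    simp only [← key]
  refine ⟨hS.exists_γExt ha, fun z hz => hS.γγ_not_mem ha hz, ?_, fun q => hS.mem_δγ_iff ha,
    fun v hv => (h3 v).1 (Or.inl hv), fun x v hx hv => (h3 v).2 (Or.inl ⟨x, hx, hv⟩)⟩
  rintro (y | v) hy
  · exact hS.exists_step ha hy
  · obtain ⟨y', hy', h⟩ := hS.exists_γExt ha
    rw [δ_eq_of_inr hy] at hy'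
    rw [Set.mem_singleton_iff.1 hy'] at h
    exact Or.inl h

namespace HgHom

variable {S T : Hypergraph.{u}} (h : HgHom S T)
include h

theorem γExt_map {a : S.Face} {y : S.Face ⊕ S.Face} (ha : 2 ≤ S.dim a) (hy : y ∈ S.δ a) :
    h.toFun (S.γExt y) = T.γExt (Sum.map h.toFun h.toFun y) := by
  rcases y with y | v
  · have := S.dim_δ a y hy
    exact h.map_γ y (by omega)
  · rfl

theorem γγ_map {a : S.Face} (ha : 2 ≤ S.dim a) :
    T.γ (T.γ (h.toFun a)) = h.toFun (S.γ (S.γ a)) := by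
  have := S.dim_γ a (by omega)
  rw [← h.map_γ a (by omega), ← h.map_γ _ (by omega)]

theorem exists_δExt {a : S.Face} {q : T.Face} :
    (∃ y ∈ T.δ (h.toFun a), Sum.inl q ∈ T.δExt y) ↔
      ∃ p, h.toFun p = q ∧ ∃ y ∈ S.δ a, Sum.inl p ∈ S.δExt y := by
  constructor
  · rintro ⟨y | v, hy, hq⟩
    · obtain ⟨x, hx, rfl⟩ := h.exists_inl hy
      obtain ⟨p, hp, rfl⟩ := h.exists_inl (show Sum.inl q ∈ T.δ (h.toFun x) from hq)
      exact ⟨p, rfl, Sum.inl x, hx, hp⟩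
    · obtain ⟨x, hx, rfl⟩ := h.exists_inr hy
      exact ⟨x, (Sum.inl_injective hq).symm, Sum.inr x, hx, rfl⟩
  · rintro ⟨p, rfl, y | v, hy, hq⟩
    · exact ⟨_, h.inl_mem hy, h.inl_mem (show Sum.inl p ∈ S.δ y from hq)⟩
    · cases Sum.inl_injective hq
      exact ⟨_, h.inr_mem hy, rfl⟩

/-- Globularity is preserved if the conditions that involve differences of sets are. -/
theorem globAt_of {a : S.Face} (ha : 2 ≤ S.dim a) (hg : S.GlobAt a)
    (h1 : ∀ z ∈ T.δNonloop (h.toFun a), Sum.inl (h.toFun (S.γ (S.γ a))) ∉ T.δ z)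
    (h2 : ∀ y ∈ S.δ a, h.toFun (S.γExt y) = h.toFun (S.γ (S.γ a)) ∨
      ∃ z ∈ T.δNonloop (h.toFun a), Sum.inl (h.toFun (S.γExt y)) ∈ T.δ z)
    (h3 : ∀ q, Sum.inl q ∈ S.δ (S.γ a) → ∀ z ∈ T.δNonloop (h.toFun a), T.γ z ≠ h.toFun q)
    (h4 : ∀ q, (∃ y ∈ S.δ a, Sum.inl q ∈ S.δExt y) →
      (∀ z ∈ T.δNonloop (h.toFun a), T.γ z ≠ h.toFun q) →
      ∃ q', Sum.inl q' ∈ S.δ (S.γ a) ∧ h.toFun q' = h.toFun q) :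
    T.GlobAt (h.toFun a) := by
  have d := S.dim_γ a (by omega)
  have e1 := h.map_γ a (by omega)
  have e2 := h.γγ_map ha
  refine ⟨?_, ?_, ?_, ?_, ?_, ?_⟩
  · obtain ⟨y, hy, e⟩ := hg.exists_γ
    exact ⟨_, (h.bij_δ a (by omega)).mapsTo hy, by rw [e2, ← h.γExt_map ha hy, e]⟩
  · rw [e2]
    exact h1
  · intro y hy
    obtain ⟨y, hy', rfl⟩ := (h.bij_δ a (by omega)).surjOn hy
    rw [e2, ← h.γExt_map ha hy']
    exact h2 y hy'
  · intro q
    rw [← e1, h.exists_δExt]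
    constructor
    · intro hq
      obtain ⟨p, hp, rfl⟩ := h.exists_inl hq
      exact ⟨⟨p, rfl, ((hg.mem_iff p).1 hp).1⟩, h3 p hp⟩
    · rintro ⟨⟨p, rfl, hp⟩, hno⟩
      obtain ⟨q', hq', e⟩ := h4 p hp hno
      rw [← e]
      exact h.inl_mem hq'
  · intro v hv
    rw [← e1] at hv ⊢
    obtain ⟨v, hv', rfl⟩ := h.exists_inr hv
    rcases hg.inr_of_γ v hv' with ⟨x, hx, hv'⟩ | ⟨q, hq, hv'⟩
    · exact Or.inl ⟨_, h.inl_mem hx, h.inr_mem hv'⟩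
    · exact Or.inr ⟨_, h.inl_mem hq, h.mem_θFaces_map hv'⟩
  · intro x v hx hv
    rw [← e1]
    obtain ⟨x, hx', rfl⟩ := h.exists_inl hx
    obtain ⟨v, hv', rfl⟩ := h.exists_inr hv
    rcases hg.γ_of_inr x v hx' hv' with hv' | ⟨q, hq, hv'⟩
    · exact Or.inl (h.inr_mem hv')
    · exact Or.inr ⟨_, h.inl_mem hq, h.mem_θFaces_map hv'⟩

theorem exists_δNonloop {a : S.Face} {z : T.Face} (hz : z ∈ T.δNonloop (h.toFun a)) :
    ∃ x ∈ S.δNonloop a, h.toFun x = z := by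
  obtain ⟨x, hx, rfl⟩ := h.exists_inl hz.1
  exact ⟨x, ⟨hx, fun hl => hz.2 (h.isLoop_map hl)⟩, rfl⟩

theorem mem_of_map {c x : S.Face} (hx : Sum.inl (h.toFun x) ∈ T.δ (h.toFun c))
    (hinj : ∀ x y, S.dim x + 1 = S.dim c → S.dim y + 1 = S.dim c →
      h.toFun x = h.toFun y → x = y) : Sum.inl x ∈ S.δ c := by
  obtain ⟨y, hy, e⟩ := h.exists_inl hx
  have hd := T.dim_δ _ _ hx
  rw [h.dim_map, h.dim_map] at hd
  exact hinj _ _ (S.dim_δ c y hy) hd e ▸ hy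

/-- Globularity at `a` is preserved by morphisms that are injective two dimensions below. -/
theorem globAt_map {a : S.Face} (ha : 2 ≤ S.dim a) (hg : S.GlobAt a)
    (hinj : ∀ x y, S.dim x + 2 = S.dim a → S.dim y + 2 = S.dim a →
      h.toFun x = h.toFun y → x = y) : T.GlobAt (h.toFun a) := by
  have dγ := S.dim_γ a (by omega)
  have dγγ := S.dim_γ (S.γ a) (by omega)
  have hinj' : ∀ z, Sum.inl z ∈ S.δ a → ∀ x y, S.dim x + 1 = S.dim z → S.dim y + 1 = S.dim z →
      h.toFun x = h.toFun y → x = y := by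
    intro z hz x y hx hy
    have := S.dim_δ a z hz
    exact hinj x y (by omega) (by omega)
  have hN : ∀ z ∈ S.δNonloop a, h.toFun z ∈ T.δNonloop (h.toFun a) := fun z hz =>
    ⟨h.inl_mem hz.1, fun hl => hz.2 (h.isLoop_of_map hl (hinj' z hz.1))⟩
  refine h.globAt_of ha hg ?_ ?_ ?_ ?_
  · intro z hz hm
    obtain ⟨z, hz', rfl⟩ := h.exists_δNonloop hz
    exact hg.γγ_not_mem z hz' (h.mem_of_map hm (hinj' z hz'.1))
  · intro y hy
    rcases hg.step y hy with e | ⟨z, hz, hm⟩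
    · exact Or.inl (by rw [e])
    · exact Or.inr ⟨_, hN z hz, h.inl_mem hm⟩
  · intro q hq z hz e
    obtain ⟨z, hz', rfl⟩ := h.exists_δNonloop hz
    have dz := S.dim_δ a z hz'.1
    have dzγ := S.dim_γ z (by omega)
    have dq := S.dim_δ _ _ hq
    rw [← h.map_γ z (by omega)] at e
    exact ((hg.mem_iff q).1 hq).2 z hz' (hinj _ _ (by omega) (by omega) e)
  · intro q hq hno
    refine ⟨q, (hg.mem_iff q).2 ⟨hq, fun z hz e => hno _ (hN z hz) ?_⟩, rfl⟩
    have dz := S.dim_δ a z hz.1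
    rw [← h.map_γ z (by omega), e]

/-- Globularity is reflected by injective morphisms. -/
theorem globAt_of_map {a : S.Face} (ha : 2 ≤ S.dim a) (hinj : Function.Injective h.toFun)
    (hg : T.GlobAt (h.toFun a)) : S.GlobAt a := by
  have dγ := S.dim_γ a (by omega)
  have e1 := h.map_γ a (by omega)
  have e2 := h.γγ_map ha
  have hN : ∀ z ∈ S.δNonloop a, h.toFun z ∈ T.δNonloop (h.toFun a) := fun z hz =>
    ⟨h.inl_mem hz.1, fun hl => hz.2 (h.isLoop_of_map hl fun _ _ _ _ e => hinj e)⟩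
  have hmem : ∀ {c x : S.Face}, Sum.inl (h.toFun x) ∈ T.δ (h.toFun c) → Sum.inl x ∈ S.δ c :=
    fun hx => h.mem_of_map hx fun _ _ _ _ e => hinj e
  have hmem' : ∀ {c x : S.Face}, Sum.inr (h.toFun x) ∈ T.δ (h.toFun c) → Sum.inr x ∈ S.δ c := by
    intro c x hx
    obtain ⟨y, hy, e⟩ := h.exists_inr hx
    exact hinj e ▸ hy
  have hθ : ∀ {c x : S.Face}, h.toFun x ∈ T.θFaces (h.toFun c) → x ∈ S.θFaces c := by
    intro c x hx
    obtain ⟨y, hy, e⟩ := h.exists_mem_θFaces hx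
    exact hinj e ▸ hy
  refine ⟨?_, ?_, ?_, ?_, ?_, ?_⟩
  · obtain ⟨y, hy, e⟩ := hg.exists_γ
    obtain ⟨y, hy', rfl⟩ := (h.bij_δ a (by omega)).surjOn hy
    rw [e2, ← h.γExt_map ha hy'] at e
    exact ⟨y, hy', hinj e⟩
  · intro z hz hm
    refine hg.γγ_not_mem _ (hN z hz) ?_
    rw [e2]
    exact h.inl_mem hm
  · intro y hy
    have := hg.step _ ((h.bij_δ a (by omega)).mapsTo hy)
    rw [e2, ← h.γExt_map ha hy] at this
    rcases this with e | ⟨z, hz, hm⟩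
    · exact Or.inl (hinj e)
    · obtain ⟨z, hz', rfl⟩ := h.exists_δNonloop hz
      exact Or.inr ⟨z, hz', hmem hm⟩
  · intro q
    have := hg.mem_iff (h.toFun q)
    rw [← e1, h.exists_δExt] at this
    constructor
    · intro hq
      obtain ⟨⟨p, e, hp⟩, hno⟩ := this.1 (h.inl_mem hq)
      refine ⟨hinj e ▸ hp, fun z hz e => hno _ (hN z hz) ?_⟩
      have dz := S.dim_δ a z hz.1
      rw [← h.map_γ z (by omega), e]
    · rintro ⟨hq, hno⟩
      refine hmem (this.2 ⟨⟨q, rfl, hq⟩, fun z hz e => ?_⟩)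
      obtain ⟨z, hz', rfl⟩ := h.exists_δNonloop hz
      have dz := S.dim_δ a z hz'.1
      rw [← h.map_γ z (by omega)] at e
      exact hno z hz' (hinj e)
  · intro v hv
    have := h.inr_mem hv
    rw [e1] at this
    rcases hg.inr_of_γ _ this with ⟨x, hx, hv⟩ | ⟨q, hq, hv⟩
    · obtain ⟨x, hx', rfl⟩ := h.exists_inl hx
      exact Or.inl ⟨x, hx', hmem' hv⟩
    · rw [← e1] at hq
      obtain ⟨q, hq', rfl⟩ := h.exists_inl hq
      exact Or.inr ⟨q, hq', hθ hv⟩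
  · intro x v hx hv
    rcases hg.γ_of_inr _ _ (h.inl_mem hx) (h.inr_mem hv) with hv | ⟨q, hq, hv⟩
    · rw [← e1] at hv
      exact Or.inl (hmem' hv)
    · rw [← e1] at hq
      obtain ⟨q, hq', rfl⟩ := h.exists_inl hq
      exact Or.inr ⟨q, hq', hθ hv⟩

end HgHom

/-! ## Ordered face structures from injective morphisms -/

/-- Along an injective morphism that reflects both orders the remaining axioms pull back. The
existence statements do not, as their witnesses could lie outside the image, so they appear as
hypotheses. -/
theorem IsOFS.of_injective {D T : OrdHypergraph.{u}} (hT : IsOFS T) (j : MonoHom D T)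
    (hinj : Function.Injective j.toFun) (hlt : ∀ a b, T.lt (j.toFun a) (j.toFun b) → D.lt a b)
    (hne : ∃ a, D.dim a = 0)
    (hle : ∀ a b, T.ltPlus (j.toFun a) (j.toFun b) → D.ltPlus a b)
    (hmin : ∀ a b, D.lt a b → D.ltMinus a b)
    (hfill : ∀ a, D.IsLoop a → a ∈ D.γNonloops) : IsOFS D := by
  have hl : ∀ c, T.IsLoop (j.toFun c) → D.IsLoop c := fun c h =>
    j.isLoop_of_map h fun _ _ _ _ e => hinj e
  have hle' : ∀ a b, D.ltPlus a b → T.ltPlus (j.toFun a) (j.toFun b) := fun a b h =>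
    j.ltPlus_map h fun c _ => hl c
  have hg : ∀ a, 2 ≤ D.dim a → D.GlobAt a := fun a ha =>
    j.globAt_of_map ha hinj (hT.globAt (by rw [j.dim_map]; exact ha))
  refine ⟨hne, fun a ha => (hg a ha).glob_γ, fun a ha => (hg a ha).glob_δ, ?_, ?_, ?_, ?_, ?_, ?_,
    hmin, ?_, ?_, ?_, hfill⟩
  · exact fun a x y hx hy h => hT.discrete _ _ _ (j.inl_mem hx) (j.inl_mem hy) (hle' _ _ h)
  · exact fun a h => hT.ltPlus_irrefl _ (hle' _ _ h)
  · intro a b ha hb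
    rcases hT.ltPlus_linear (j.toFun a) (j.toFun b) (by rw [j.dim_map]; exact ha)
      (by rw [j.dim_map]; exact hb) with h | h | h
    · exact Or.inl (hinj h)
    · exact Or.inr (Or.inl (hle _ _ h))
    · exact Or.inr (Or.inr (hle _ _ h))
  · exact fun a h => hT.lt_irrefl _ (j.map_lt _ _ h)
  · exact fun a b c h h' => hlt _ _ (hT.lt_trans _ _ _ (j.map_lt _ _ h) (j.map_lt _ _ h'))
  · exact fun a b h => ⟨fun h' => (hT.disjoint _ _ (j.map_lt _ _ h)).1 (hle' _ _ h'),
      fun h' => (hT.disjoint _ _ (j.map_lt _ _ h)).2 (hle' _ _ h')⟩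
  · intro a b hθ h
    refine hlt _ _ (hT.lt_of_ltMinus _ _ ?_ (j.ltMinus_map h))
    rw [Set.eq_empty_iff_forall_notMem]
    have hex : ∀ c y, y ∈ T.θ (j.toFun c) → ∃ x ∈ D.θ c, Sum.map j.toFun j.toFun x = y := by
      rintro c y ⟨h0, hy⟩
      rw [j.dim_map] at h0
      rcases hy with hy | rfl
      · obtain ⟨x, hx, e⟩ := (j.bij_δ c h0).surjOn hy
        exact ⟨x, ⟨h0, Or.inl hx⟩, e⟩
      · exact ⟨_, ⟨h0, Or.inr rfl⟩, congrArg Sum.inl (j.map_γ c h0)⟩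
    rintro y ⟨hy, hy'⟩
    obtain ⟨x, hx, rfl⟩ := hex a y hy
    obtain ⟨x', hx', e⟩ := hex b _ hy'
    have := (Sum.map_injective.2 ⟨hinj, hinj⟩) e
    subst this
    have : x' ∈ D.θ a ∩ D.θ b := ⟨hx, hx'⟩
    rw [hθ] at this
    exact this
  · rintro a b hab ⟨x, hx, hx'⟩
    rcases hT.pencil _ _ (fun e => hab (hinj e))
      ⟨_, j.mem_θFaces_map hx, j.mem_θFaces_map hx'⟩ with (h | h) | (h | h)
    · exact Or.inl (Or.inl (hlt _ _ h))
    · exact Or.inl (Or.inr (hlt _ _ h))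
    · exact Or.inr (Or.inl (hle _ _ h))
    · exact Or.inr (Or.inr (hle _ _ h))
  · intro a b ha hb hE hι
    have := hT.pencil_empty (j.toFun a) (j.toFun b) (by rw [j.dim_map]; exact ha)
      (by rw [j.dim_map]; exact hb) (j.isEmptyDom_map hE)
      (by rw [j.γγ_map ha]; exact j.mem_ι_map hι fun c _ => hl c)
    rcases this with h | h
    · exact Or.inl (hlt _ _ h)
    · exact Or.inr (hle _ _ h)

/-- Being an ordered face structure is invariant under isomorphism. -/
theorem IsOFS.of_iso {D T : OrdHypergraph.{u}} (hT : IsOFS T) (φ : D ≅ T) : IsOFS D := by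
  have h1 : ∀ x, φ.inv.toFun (φ.hom.toFun x) = x := fun x =>
    congrFun (congrArg (fun f : MonoHom D D => f.toFun) φ.hom_inv_id) x
  have h2 : ∀ x, φ.hom.toFun (φ.inv.toFun x) = x := fun x =>
    congrFun (congrArg (fun f : MonoHom T T => f.toFun) φ.inv_hom_id) x
  have hl : ∀ c, D.IsLoop (φ.inv.toFun c) → T.IsLoop c := fun c h => by
    have := φ.hom.isLoop_map h
    rwa [h2] at this
  have hle : ∀ a b, T.ltPlus (φ.hom.toFun a) (φ.hom.toFun b) → D.ltPlus a b := by
    intro a b h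
    have := φ.inv.ltPlus_map h fun c _ => hl c
    rwa [h1, h1] at this
  refine hT.of_injective φ.hom (Function.LeftInverse.injective h1) ?_ ?_ hle ?_ ?_
  · intro a b h
    have := φ.inv.map_lt _ _ h
    rwa [h1, h1] at this
  · obtain ⟨a, ha⟩ := hT.nonempty
    exact ⟨φ.inv.toFun a, by rw [φ.inv.dim_map]; exact ha⟩
  · intro a b h
    have := φ.inv.ltMinus_map (hT.lt_ltMinus _ _ (φ.hom.map_lt _ _ h))
    rwa [h1, h1] at this
  · intro a h
    obtain ⟨c, h0, hc, e⟩ := hT.loop_filling _ (φ.hom.isLoop_map h)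
    refine ⟨φ.inv.toFun c, by rw [φ.inv.dim_map]; exact h0, fun h => hc (hl c h), ?_⟩
    rw [← φ.inv.map_γ c h0, e, h1]

/-! ## The `k`-domain -/

section Dom

variable {k : ℕ} {T : OFS.{u}}

theorem span_eq_of_isSub {S : Hypergraph.{u}} {Z : Set S.Face} (h : IsSub S Z) : span S Z = Z :=
  Set.Subset.antisymm (fun _ ha => ha Z h (fun _ h => h)) (subset_span S Z)

theorem domSet_isSub (k : ℕ) (S : Hypergraph.{u}) : IsSub S (domSet k S) := by
  have hdim : ∀ a ∈ domSet k S, S.dim a ≤ k := by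
    rintro a (h | h)
    · exact h.le
    · exact h.1.le
  refine ⟨fun a ha => ?_, fun a ha x hx => ?_, fun a ha v hv => ?_⟩
  · by_cases h0 : S.dim a = 0
    · rw [S.γ_zero a h0]
      exact ha
    · have := S.dim_γ a (by omega)
      have := hdim a ha
      exact Or.inl (by omega)
  · have := S.dim_δ a x hx
    have := hdim a ha
    exact Or.inl (by omega)
  · have := S.dim_δ_empty a v hv
    have := hdim a ha
    exact Or.inl (by omega)

theorem span_domSet (k : ℕ) (S : Hypergraph.{u}) : span S (domSet k S) = domSet k S :=
  span_eq_of_isSub (domSet_isSub k S)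

theorem mem_domSet_of_isMin {S : Hypergraph.{u}} {c : S.Face} (h : S.dim c ≤ k)
    (hm : S.IsMin c) : c ∈ domSet k S := by
  rcases Nat.lt_or_eq_of_le h with h | h
  · exact Or.inl h
  · exact Or.inr ⟨h, hm⟩

/-- A loop is the codomain of a minimal non-loop. For loops of dimension less than `k` that face
stays in `d^(k)`; loops of dimension `k` are codomains and so not in `d^(k)` at all. Hence
stretching adds nothing. -/
theorem emptyLoops_domSet (x : T.toOrd.Face) :
    emptyLoops T.toOrd.toHypergraph (span T.toOrd.toHypergraph (domSet k T.toOrd.toHypergraph)) x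
      = ∅ := by
  rw [span_domSet, Set.eq_empty_iff_forall_notMem]
  rintro l ⟨hl, hll, _, hno⟩
  obtain ⟨b, hb0, hbl, hbγ⟩ := T.isOFS.loop_filling l hll
  obtain ⟨m, hm0, hml, hmm, _, hmγ⟩ := T.isOFS.exists_min_γ hb0 hbl
  have hd := T.toOrd.dim_γ m hm0
  rw [hmγ, hbγ] at hd
  refine hno ⟨m, mem_domSet_of_isMin ?_ hmm, hm0, hml, hmγ.trans hbγ⟩
  rcases hl with h | h
  · omega
  · exact (h.2 ⟨b, hb0, hbl, hbγ⟩).elim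

theorem domMap_injective (k : ℕ) (T : OFS.{u}) : Function.Injective (domMap k T).toFun := by
  have hE : ∀ p : (dom k T).Face, p.1.2 = ∅ := by
    intro p
    have := p.2.2.1
    rw [emptyLoops_domSet] at this
    exact Set.subset_empty_iff.1 this
  intro p q h
  refine Subtype.ext (Prod.ext h ?_)
  rw [hE, hE]

theorem domMap_mem (p : (dom k T).Face) :
    (domMap k T).toFun p ∈ domSet k T.toOrd.toHypergraph := by
  exact (span_domSet k T.toOrd.toHypergraph).subset p.2.1

/-- After refinement the path runs along minimal faces of dimension at most `k`, all of which lie in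
`d^(k)`. -/
theorem dom_le_of_le {p q : (dom k T).Face} (hd : T.toOrd.dim ((domMap k T).toFun p) < k)
    (h : T.toOrd.le ((domMap k T).toFun p) ((domMap k T).toFun q)) : (dom k T).le p q := by
  have hinj := domMap_injective k T
  have key : ∀ w, ReflTransGen (IsOFS.minStep T.toOrd) ((domMap k T).toFun p) w →
      ∃ q, (domMap k T).toFun q = w ∧ (dom k T).le p q := by
    intro w h
    induction h with
    | refl => exact ⟨p, rfl, ReflTransGen.refl⟩
    | tail _ hs ih =>
      obtain ⟨q, rfl, hq⟩ := ih
      obtain ⟨c, hc, hcm, hqc, rfl⟩ := hs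
      have h1 := T.toOrd.dim_δ _ _ hqc
      have h2 := le.dim_eq ((domMap k T).le_map hq)
      have hcX : c ∈ domSet k T.toOrd.toHypergraph := mem_domSet_of_isMin (by omega) hcm
      have h3 : (domMap k T).toFun ((dom k T).γ (domFace k T c hcX)) = T.toOrd.γ c :=
        (domMap k T).map_γ (domFace k T c hcX) (show 0 < T.toOrd.dim c by omega)
      refine ⟨(dom k T).γ (domFace k T c hcX), h3, hq.trans (le_of_mem ?_)⟩
      exact (domMap k T).mem_of_map (c := domFace k T c hcX) hqc fun _ _ _ _ e => hinj e
  obtain ⟨q', e, hq'⟩ := key _ (T.isOFS.minStep_of_le h)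
  rwa [hinj e] at hq'

theorem isOFS_dom (k : ℕ) (T : OFS.{u}) : IsOFS (dom k T) := by
  have hinj := domMap_injective k T
  refine T.isOFS.of_injective (domMap k T) hinj (fun a b h => h) ?_ ?_ ?_ ?_
  · obtain ⟨a, ha⟩ := T.isOFS.nonempty
    obtain ⟨m, hm, hmin⟩ : ∃ m, T.toOrd.le m a ∧ T.toOrd.IsMin m := by
      induction a using T.isOFS.wf_ltPlus.induction with
      | _ a ih =>
        by_cases h : T.toOrd.IsMin a
        · exact ⟨a, ReflTransGen.refl, h⟩
        · obtain ⟨c, h0, hc, rfl⟩ := not_not.1 h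
          have hd := T.toOrd.dim_γ c h0
          obtain ⟨x, hx⟩ := T.toOrd.δ_one c (by omega)
          have hlt := ltPlus_of_mem hc (x := x) (by rw [hx]; rfl)
          obtain ⟨m, h1, h2⟩ := ih x hlt (hlt.dim_eq.trans ha)
          exact ⟨m, h1.trans hlt.le, h2⟩
    exact ⟨domFace k T m (mem_domSet_of_isMin (by rw [hm.dim_eq]; omega) hmin),
      hm.dim_eq.trans ha⟩
  · intro p q h
    by_cases hd : T.toOrd.dim ((domMap k T).toFun p) < k
    · rcases le_iff.1 (dom_le_of_le hd h.le) with rfl | h'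
      · exact (T.isOFS.ltPlus_irrefl _ h).elim
      · exact h'
    · have h1 := ltPlus.dim_eq h
      rcases domMap_mem q with h2 | h2
      · omega
      · exact (IsOFS.IsMin.not_lt h2.2 h).elim
  · intro p q h
    obtain ⟨h0, w, hw, hle⟩ := ltMinus_iff.1 (T.isOFS.lt_ltMinus _ _ h)
    obtain ⟨w, hw', rfl⟩ := (domMap k T).exists_inl (a := q) hw
    have e := (domMap k T).map_γ p h0
    have h1 := T.toOrd.dim_γ _ h0
    have h2 : T.toOrd.dim p.1.1 ≤ k := by
      rcases domMap_mem p with h2 | h2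
      · exact h2.le
      · exact h2.1.le
    refine ltMinus_iff.2 ⟨h0, w, hw', dom_le_of_le ?_ ?_⟩
    · rw [e]
      change T.toOrd.dim (T.toOrd.γ p.1.1) < k
      omega
    · rw [e]
      exact hle
  · intro p hp
    have hl := (domMap k T).isLoop_map hp
    obtain ⟨b, hb0, hbl, hbγ⟩ := T.isOFS.loop_filling _ hl
    obtain ⟨m, hm0, hml, hmm, _, hmγ⟩ := T.isOFS.exists_min_γ hb0 hbl
    have hd := T.toOrd.dim_γ m hm0
    rw [hmγ, hbγ] at hd
    have hm : m ∈ domSet k T.toOrd.toHypergraph := by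
      refine mem_domSet_of_isMin ?_ hmm
      rcases domMap_mem p with h | h
      · omega
      · exact (h.2 ⟨b, hb0, hbl, hbγ⟩).elim
    refine ⟨domFace k T m hm, hm0, fun h => hml ((domMap k T).isLoop_map h), hinj ?_⟩
    rw [(domMap k T).map_γ (domFace k T m hm) hm0]
    exact hmγ.trans hbγ

/-- The axioms come from `T`, not from `S`: the projection to `S` may identify `(k-1)`-faces, so the
pullback argument is not available on that side. -/
theorem isOFS_cod {S : OFS.{u}} (φ : cod k S ≅ dom k T) : IsOFS (cod k S) :=
  (isOFS_dom k T).of_iso φ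

end Dom

/-! ## The `k`-codomain -/

section Cod

variable {k : ℕ} {S : OFS.{u}}

theorem dim_le_of_mem_codSet {S : Hypergraph.{u}} {a : S.Face} (h : a ∈ codSet k S) :
    S.dim a ≤ k := by
  rcases h with h | h | h <;> omega

/-- By `Inner.ltPlus` a face that touches an internal face of `b` is strictly below `γ(b)`, which a
maximal face cannot be. -/
theorem not_mem_ι_of_top {a x b : S.toOrd.Face} (ha : a ∉ S.toOrd.δNonloops)
    (hx : x ∈ S.toOrd.θFaces a) : x ∉ S.toOrd.ι b := by
  intro h
  have hlt := IsOFS.Inner.ltPlus S.isOFS (IsOFS.inner_of_ι h) hx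
  exact S.isOFS.ltPlus_irrefl _ (IsOFS.eq_of_top_le ha hlt.le ▸ hlt)

theorem codSet_isSub (k : ℕ) (S : OFS.{u}) :
    IsSub S.toOrd.toHypergraph (codSet k S.toOrd.toHypergraph) := by
  have key : ∀ a ∈ codSet k S.toOrd.toHypergraph, ∀ x ∈ S.toOrd.θFaces a,
      x ∈ codSet k S.toOrd.toHypergraph := by
    intro a ha x hx
    have hd := dim_of_mem_θFaces hx
    rcases ha with h | h | h
    · exact Or.inl (by omega)
    · exact Or.inl (by omega)
    · exact Or.inr (Or.inl ⟨by omega, fun b => not_mem_ι_of_top h.2 hx⟩)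
  refine ⟨fun a ha => ?_, fun a ha x hx => key a ha x (θFaces_of_mem hx), fun a ha v hv => ?_⟩
  · by_cases h0 : S.toOrd.dim a = 0
    · rw [S.toOrd.γ_zero a h0]
      exact ha
    · exact key a ha _ (γ_mem_θFaces (by omega))
  · have := S.toOrd.dim_δ_empty a v hv
    have := dim_le_of_mem_codSet ha
    exact Or.inl (by omega)

theorem span_codSet (k : ℕ) (S : OFS.{u}) :
    span S.toOrd.toHypergraph (codSet k S.toOrd.toHypergraph) = codSet k S.toOrd.toHypergraph :=
  span_eq_of_isSub (codSet_isSub k S)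

theorem codMap_mem (p : (cod k S).Face) :
    (codMap k S).toFun p ∈ codSet k S.toOrd.toHypergraph :=
  (span_codSet k S).subset p.2.1

/-- The empty loops of `c^(k) S`. -/
abbrev codLoops (k : ℕ) (S : OFS.{u}) (x : S.toOrd.Face) : Set S.toOrd.Face :=
  emptyLoops S.toOrd.toHypergraph (span S.toOrd.toHypergraph (codSet k S.toOrd.toHypergraph)) x

/-- The loop has dimension less than `k` and a filler `b`. If `dim b < k`, a minimal filler stays in
`c^(k) S`, as internal faces are codomains of non-loops. If `dim b = k`, the maximal face above `b`
is a filler, because otherwise the loop would be internal and not in `c^(k) S`. -/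
theorem codLoops_eq_empty {x : S.toOrd.Face} (hx : S.toOrd.dim x + 1 ≠ k) :
    codLoops k S x = ∅ := by
  unfold codLoops
  rw [span_codSet, Set.eq_empty_iff_forall_notMem]
  rintro l ⟨hl, hll, rfl, hno⟩
  have hd := S.toOrd.dim_γ l hll.1
  have hlk := dim_le_of_mem_codSet hl
  obtain ⟨b, hb0, hbl, rfl⟩ := S.isOFS.loop_filling l hll
  have hdb := S.toOrd.dim_γ b hb0
  rcases Nat.lt_or_ge (S.toOrd.dim b) k with hbk | hbk
  · obtain ⟨m, hm0, hml, hmm, hmb, hmγ⟩ := S.isOFS.exists_min_γ hb0 hbl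
    refine hno ⟨m, ?_, hm0, hml, hmγ⟩
    have := hmb.dim_eq
    rcases Nat.lt_or_ge (S.toOrd.dim m + 1) k with h | h
    · exact Or.inl h
    · refine Or.inr (Or.inl ⟨by omega, ?_⟩)
      rintro b' ⟨p, hp, _, _, hp0, hpm, _⟩
      exact hmm ⟨p, hp0, hp.2, hpm⟩
  · obtain ⟨z, hz, htop⟩ := S.isOFS.exists_top b
    have hdz := hz.dim_eq
    have hzl := S.isOFS.not_isLoop_of_le hz hbl
    rcases S.isOFS.γ_eq_or_lowerNode hb0 hz with h | h
    · exact hno ⟨z, Or.inr (Or.inr ⟨by omega, htop⟩), by omega, hzl, h.symm⟩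
    · obtain ⟨A, _, _, hι⟩ := IsOFS.Inner.exists_ι S.isOFS ⟨⟨b, hb0, hbl, hz, rfl⟩, h⟩
      rcases hl with h | h | h
      · omega
      · exact h.2 A hι
      · omega

theorem mem_codLoops {x l : S.toOrd.Face} (hx : S.toOrd.dim x + 1 = k) :
    l ∈ codLoops k S x ↔ S.toOrd.IsLoop l ∧ S.toOrd.γ l = x ∧ l ∉ S.toOrd.δNonloops := by
  unfold codLoops
  rw [span_codSet]
  constructor
  · rintro ⟨hl, hll, rfl, _⟩
    have hd := S.toOrd.dim_γ l hll.1
    refine ⟨hll, rfl, ?_⟩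
    rcases hl with h | h | h
    · omega
    · omega
    · exact h.2
  · rintro ⟨hll, rfl, hl⟩
    have hd := S.toOrd.dim_γ l hll.1
    refine ⟨Or.inr (Or.inr ⟨by omega, hl⟩), hll, rfl, ?_⟩
    rintro ⟨b, hb, hb0, _, rfl⟩
    have := S.toOrd.dim_γ b hb0
    have := dim_le_of_mem_codSet hb
    omega

theorem codMap_inj {p q : (cod k S).Face} (hd : (cod k S).dim p + 1 ≠ k)
    (h : (codMap k S).toFun p = (codMap k S).toFun q) : p = q := by
  have hE : ∀ p : (cod k S).Face, (cod k S).dim p + 1 ≠ k → p.1.2 = ∅ := by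
    intro p hp
    have h1 := p.2.2.1
    have h2 : codLoops k S p.1.1 = ∅ := codLoops_eq_empty hp
    exact Set.subset_empty_iff.1 (h2 ▸ h1)
  have hd' : (cod k S).dim q + 1 ≠ k := by
    rwa [← (codMap k S).dim_map q, ← h, (codMap k S).dim_map]
  refine Subtype.ext (Prod.ext h ?_)
  rw [hE p hd, hE q hd']

theorem lt_or_lt_of_mem_codLoops {x l l' : S.toOrd.Face} (hx : S.toOrd.dim x + 1 = k)
    (hl : l ∈ codLoops k S x) (hl' : l' ∈ codLoops k S x) (hne : l ≠ l') :
    S.toOrd.lt l l' ∨ S.toOrd.lt l' l := by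
  rw [mem_codLoops hx] at hl hl'
  rcases S.isOFS.pencil l l' hne ⟨x, mem_θFaces.2 ⟨hl.1.1, Or.inr hl.2.1.symm⟩,
    mem_θFaces.2 ⟨hl'.1.1, Or.inr hl'.2.1.symm⟩⟩ with h | h | h
  · exact h
  · exact (hne (IsOFS.eq_of_top_le hl.2.2 h.le)).elim
  · exact (hne (IsOFS.eq_of_top_le hl'.2.2 h.le).symm).elim

/-- A step along a face over a loop. -/
def codStep (k : ℕ) (S : OFS.{u}) (p q : (cod k S).Face) : Prop :=
  ∃ c : (cod k S).Face, (cod k S).dim c = k ∧ (cod k S).δ c = {Sum.inl p} ∧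
    (cod k S).γ c = q ∧ S.toOrd.IsLoop ((codMap k S).toFun c)

/-- Over the loop `l` there is a `k`-face of the stretching with domain `(x, ↓l, -)` and codomain
`(x, -, ↑l)`. The loops over `x` are linearly ordered, so the lower part of the codomain is `↓l`
with `l` added: the loop has become a step past one loop. -/
theorem codStep_insert {x l : S.toOrd.Face} {L : Set S.toOrd.Face} (hx : S.toOrd.dim x + 1 = k)
    (hl : l ∈ codLoops k S x) (hL : ∀ b, b ∈ L ↔ b ∈ codLoops k S x ∧ S.toOrd.lt b l)
    (p q : (cod k S).Face) (hp : p.1 = (x, L)) (hq : q.1 = (x, insert l L)) :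
    codStep k S p q := by
  obtain ⟨hll, hlγ, hlt⟩ := (mem_codLoops hx).1 hl
  have hd := S.toOrd.dim_γ l hll.1
  rw [hlγ] at hd
  let c : (cod k S).Face := ⟨(l, ∅), hl.1, isCut_empty _ _ _⟩
  have hδ : S.toOrd.δ l = {Sum.inl x} := by rw [hll.2, hlγ]
  refine ⟨c, show S.toOrd.dim l = k by omega, ?_, ?_, hll⟩
  · have hmem : Sum.inl p ∈ (cod k S).δ c := by
      change Sum.inl p.1.1 ∈ S.toOrd.δ l ∧ p.1.2 = cutBelow S.toOrd _ l p.1.1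
      rw [hp]
      refine ⟨by rw [hδ]; rfl, Set.ext hL⟩
    refine Set.eq_singleton_iff_unique_mem.2 ⟨hmem, fun y hy => ?_⟩
    have hb := (codMap k S).bij_δ c hll.1
    have h1 := hb.mapsTo hy
    have h2 := hb.mapsTo hmem
    change _ ∈ S.toOrd.δ l at h1 h2
    rw [hδ] at h1 h2
    exact hb.injOn hy hmem (h1.trans h2.symm)
  · have h0 : S.toOrd.dim c.1.1 ≠ 0 := by
      change S.toOrd.dim l ≠ 0
      omega
    have e : stretchγ S _ (span_isSub _ _) c = _ := if_neg h0
    refine Subtype.ext ((congrArg Subtype.val e).trans (Eq.trans ?_ hq.symm))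
    refine Prod.ext hlγ ?_
    change cutAbove S.toOrd _ l (S.toOrd.γ l) = insert l L
    rw [hlγ]
    ext b
    change (b ∈ codLoops k S x ∧ ¬ S.toOrd.lt l b) ↔ b = l ∨ b ∈ L
    rw [hL]
    constructor
    · rintro ⟨hb, hn⟩
      by_cases hbl : b = l
      · exact Or.inl hbl
      · exact Or.inr ⟨hb, (lt_or_lt_of_mem_codLoops hx hb hl hbl).resolve_right hn⟩
    · rintro (rfl | ⟨hb, h⟩)
      · exact ⟨hl, S.isOFS.lt_irrefl _⟩
      · exact ⟨hb, fun h' => S.isOFS.lt_irrefl _ (S.isOFS.lt_trans _ _ _ h h')⟩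

theorem codPath_of_subset {x : S.toOrd.Face} (hx : S.toOrd.dim x + 1 = k) (n : ℕ)
    (p q : (cod k S).Face) (hp : p.1.1 = x) (hq : q.1.1 = x) (h : p.1.2 ⊆ q.1.2)
    (hn : (q.1.2 \ p.1.2).ncard = n) : ReflTransGen (codStep k S) p q := by
  have hfin : ∀ s : Set S.toOrd.Face, s.Finite := fun s => by
    have := S.toOrd.finite
    exact Set.toFinite s
  induction n generalizing p with
  | zero =>
    have h1 : q.1.2 \ p.1.2 = ∅ := (Set.ncard_eq_zero (hfin _)).1 hn
    have : p = q := Subtype.ext (Prod.ext (hp.trans hq.symm)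
      (Set.Subset.antisymm h (Set.sdiff_eq_empty.1 h1)))
    rw [this]
  | succ n ih =>
    have hcp : p.1.2 ⊆ codLoops k S x := hp ▸ p.2.2.1
    have hcq : q.1.2 ⊆ codLoops k S x := hq ▸ q.2.2.1
    have hne : (q.1.2 \ p.1.2).Nonempty := by
      rw [← Set.ncard_pos (hfin _)]
      omega
    have hwf : WellFounded S.toOrd.lt := by
      have := S.toOrd.finite
      have : IsTrans S.toOrd.Face S.toOrd.lt := ⟨S.isOFS.lt_trans⟩
      have : Std.Irrefl S.toOrd.lt := ⟨S.isOFS.lt_irrefl⟩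
      exact Finite.wellFounded_of_trans_of_irrefl _
    -- Loops are inserted in the order `<~`. For the least missing loop `l` the present lower part
    -- is exactly `↓l`, as `codStep_insert` requires.
    obtain ⟨l, hl, hmin⟩ := hwf.has_min _ hne
    have hlE := hcq hl.1
    have hL : ∀ b, b ∈ p.1.2 ↔ b ∈ codLoops k S x ∧ S.toOrd.lt b l := by
      intro b
      constructor
      · intro hb
        refine ⟨hcp hb, (lt_or_lt_of_mem_codLoops hx (hcp hb) hlE ?_).resolve_right ?_⟩
        · rintro rfl
          exact hl.2 hb
        · exact fun hlt => hl.2 (p.2.2.2 b hb l (hp ▸ hlE) hlt)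
      · rintro ⟨hb, hlt⟩
        by_contra hbp
        exact hmin b ⟨q.2.2.2 l hl.1 b (hq ▸ hb) hlt, hbp⟩ hlt
    have hcut : IsCut S.toOrd (span S.toOrd.toHypergraph (codSet k S.toOrd.toHypergraph)) x
        (insert l p.1.2) := by
      refine ⟨Set.insert_subset hlE hcp, ?_⟩
      rintro b (rfl | hb) b' hb' hlt
      · exact Or.inr ((hL b').2 ⟨hb', hlt⟩)
      · exact Or.inr (p.2.2.2 b hb b' (hp ▸ hb') hlt)
    let p' : (cod k S).Face := ⟨(x, insert l p.1.2), hp ▸ p.2.1, hcut⟩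
    refine ReflTransGen.head (codStep_insert hx hlE hL p p' (Prod.ext hp rfl) rfl)
      (ih p' rfl (Set.insert_subset hl.1 h) ?_)
    have : q.1.2 \ p'.1.2 = (q.1.2 \ p.1.2) \ {l} := by
      ext b
      simp only [p', Set.mem_sdiff, Set.mem_insert_iff, Set.mem_singleton_iff]
      tauto
    rw [this, Set.ncard_sdiff_singleton_of_mem hl, hn]
    rfl

/-- Initial segments of a linear order are nested, so one of the cuts is reached from the other by
inserting loops. -/
theorem codPath {p q : (cod k S).Face} (hd : (cod k S).dim p + 1 = k)
    (h : (codMap k S).toFun p = (codMap k S).toFun q) :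
    ReflTransGen (codStep k S) p q ∨ ReflTransGen (codStep k S) q p := by
  have hq : q.1.1 = p.1.1 := h.symm
  by_cases hs : p.1.2 ⊆ q.1.2
  · exact Or.inl (codPath_of_subset hd _ p q rfl hq hs rfl)
  · right
    refine codPath_of_subset hd _ q p hq rfl ?_ rfl
    obtain ⟨l, hl, hlq⟩ := Set.not_subset.1 hs
    intro b hb
    have hlE : l ∈ codLoops k S p.1.1 := p.2.2.1 hl
    have hbE : b ∈ codLoops k S p.1.1 := hq ▸ q.2.2.1 hb
    have hne : b ≠ l := by
      rintro rfl
      exact hlq hb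
    rcases lt_or_lt_of_mem_codLoops hd hbE hlE hne with hlt | hlt
    · exact p.2.2.2 l hl b hbE hlt
    · exact (hlq (q.2.2.2 b hb l (hq ▸ hlE) hlt)).elim

end Cod

/-! ## Gluing maps -/

/-- A step of `T` along a `k`-face of `d^(k) T` that is sent to a loop. -/
def loopStep (k : ℕ) (S T : OrdHypergraph.{u}) (f : T.Face → S.Face) (p q : T.Face) : Prop :=
  ∃ c ∈ domSet k T.toHypergraph, T.dim c = k ∧ T.δ c = {Sum.inl p} ∧ T.γ c = q ∧ S.IsLoop (f c)

/-- The properties of the map `d^(k) T ≅ 𝐝^(k) T ≅ 𝐜^(k) S → S` that are used to show that the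
tensor is an ordered face structure. -/
structure IsGluing (k : ℕ) (S T : OrdHypergraph.{u}) (f : T.Face → S.Face) : Prop where
  dim_map : ∀ t ∈ domSet k T.toHypergraph, S.dim (f t) = T.dim t
  map_γ : ∀ t ∈ domSet k T.toHypergraph, 0 < T.dim t → f (T.γ t) = S.γ (f t)
  bij_δ : ∀ t ∈ domSet k T.toHypergraph, 0 < T.dim t →
    Set.BijOn (Sum.map f f) (T.δ t) (S.δ (f t))
  lt_iff : ∀ a ∈ domSet k T.toHypergraph, ∀ b ∈ domSet k T.toHypergraph,
    (T.lt a b ↔ S.lt (f a) (f b))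
  top : ∀ t ∈ domSet k T.toHypergraph, T.dim t = k → f t ∉ S.δNonloops
  surj : ∀ s, S.dim s = k → s ∉ S.δNonloops → ∃ t ∈ domSet k T.toHypergraph, f t = s
  inj : ∀ a ∈ domSet k T.toHypergraph, ∀ b ∈ domSet k T.toHypergraph, T.dim a + 1 ≠ k →
    f a = f b → a = b
  not_mem_ι : ∀ t, T.dim t + 1 = k → ∀ b, f t ∉ S.ι b
  fiber : ∀ p q, T.dim p + 1 = k → T.dim q + 1 = k → f p = f q →
    ReflTransGen (loopStep k S T f) p q ∨ ReflTransGen (loopStep k S T f) q p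

section Glue

variable (k : ℕ) (S T : OFS.{u}) (φ : cod k S ≅ dom k T)

/-- The map `d^(k) T ≅ 𝐝^(k) T ≅ 𝐜^(k) S`, as a morphism to `S`. -/
noncomputable def glueHom : dom k T ⟶ S.toOrd := φ.inv ≫ codMap k S

open Classical in
/-- The map `d^(k) T ≅ 𝐝^(k) T ≅ 𝐜^(k) S → S`, with arbitrary values outside of `d^(k) T`. -/
noncomputable def glueMap (t : T.toOrd.Face) : S.toOrd.Face :=
  if h : t ∈ domSet k T.toOrd.toHypergraph then (glueHom k S T φ).toFun (domFace k T t h)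
  else S.isOFS.nonempty.choose

variable {k S T}

theorem glueMap_domMap (p : (dom k T).Face) :
    glueMap k S T φ ((domMap k T).toFun p) = (glueHom k S T φ).toFun p := by
  unfold glueMap
  rw [dif_pos (domMap_mem p)]
  exact congrArg _ (domMap_injective k T rfl)

theorem exists_domMap {t : T.toOrd.Face} (ht : t ∈ domSet k T.toOrd.toHypergraph) :
    ∃ p, (domMap k T).toFun p = t := ⟨domFace k T t ht, rfl⟩

theorem hom_inv_apply (x : (cod k S).Face) : φ.inv.toFun (φ.hom.toFun x) = x :=
  congrFun (congrArg (fun f : MonoHom _ _ => f.toFun) φ.hom_inv_id) x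

theorem inv_hom_apply (x : (dom k T).Face) : φ.hom.toFun (φ.inv.toFun x) = x :=
  congrFun (congrArg (fun f : MonoHom _ _ => f.toFun) φ.inv_hom_id) x

theorem glueMap_hom (p : (cod k S).Face) :
    glueMap k S T φ ((domMap k T).toFun (φ.hom.toFun p)) = (codMap k S).toFun p := by
  rw [glueMap_domMap]
  exact congrArg (codMap k S).toFun (hom_inv_apply φ p)

theorem isGluing_glueMap : IsGluing k S.toOrd T.toOrd (glueMap k S T φ) := by
  have hmem : ∀ t, T.toOrd.dim t + 1 = k → t ∈ domSet k T.toOrd.toHypergraph := fun t h =>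
    Or.inl (by omega)
  have hcod : ∀ p, (glueHom k S T φ).toFun p ∈ codSet k S.toOrd.toHypergraph := fun p =>
    codMap_mem _
  have hpath : ∀ p q, ReflTransGen (codStep k S) p q → ReflTransGen
      (loopStep k S.toOrd T.toOrd (glueMap k S T φ)) ((domMap k T).toFun (φ.hom.toFun p))
        ((domMap k T).toFun (φ.hom.toFun q)) := by
    intro p q h
    induction h with
    | refl => exact ReflTransGen.refl
    | tail _ hs ih =>
      obtain ⟨c, hc, hδ, rfl, hl⟩ := hs
      have h0 : 0 < (cod k S).dim c := by
        rw [← (codMap k S).dim_map]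
        exact hl.1
      have h0' : 0 < (dom k T).dim (φ.hom.toFun c) := by
        rw [φ.hom.dim_map]
        exact h0
      refine ih.tail ⟨(domMap k T).toFun (φ.hom.toFun c), domMap_mem _, ?_, ?_, ?_, ?_⟩
      · rw [(domMap k T).dim_map, φ.hom.dim_map]
        exact hc
      · rw [← ((domMap k T).bij_δ _ h0').image_eq, ← (φ.hom.bij_δ _ h0).image_eq, hδ]
        simp
      · rw [φ.hom.map_γ c h0, (domMap k T).map_γ _ h0']
      · rw [glueMap_hom]
        exact hl
  refine ⟨?_, ?_, ?_, ?_, ?_, ?_, ?_, ?_, ?_⟩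
  · intro t ht
    obtain ⟨p, rfl⟩ := exists_domMap ht
    rw [glueMap_domMap, (glueHom k S T φ).dim_map, (domMap k T).dim_map]
  · intro t ht h0
    obtain ⟨p, rfl⟩ := exists_domMap ht
    rw [(domMap k T).dim_map] at h0
    rw [← (domMap k T).map_γ p h0, glueMap_domMap, glueMap_domMap, (glueHom k S T φ).map_γ p h0]
  · intro t ht h0
    obtain ⟨p, rfl⟩ := exists_domMap ht
    rw [(domMap k T).dim_map] at h0
    have h1 := (domMap k T).bij_δ p h0
    have h2 := (glueHom k S T φ).bij_δ p h0
    have h3 : Sum.map (glueHom k S T φ).toFun (glueHom k S T φ).toFun =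
        Sum.map (glueMap k S T φ) (glueMap k S T φ) ∘
          Sum.map (domMap k T).toFun (domMap k T).toFun := by
      rw [Sum.map_comp_map]
      have : (glueHom k S T φ).toFun = glueMap k S T φ ∘ (domMap k T).toFun :=
        funext fun p => (glueMap_domMap φ p).symm
      rw [this]
    rw [h3] at h2
    rw [glueMap_domMap]
    refine ⟨?_, ?_, ?_⟩
    · intro y hy
      obtain ⟨x, hx, rfl⟩ := h1.surjOn hy
      exact h2.mapsTo hx
    · intro y hy y' hy' e
      obtain ⟨x, hx, rfl⟩ := h1.surjOn hy
      obtain ⟨x', hx', rfl⟩ := h1.surjOn hy'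
      rw [h2.injOn hx hx' e]
    · intro y hy
      obtain ⟨x, hx, rfl⟩ := h2.surjOn hy
      exact ⟨_, h1.mapsTo hx, rfl⟩
  · intro a ha b hb
    obtain ⟨p, rfl⟩ := exists_domMap ha
    obtain ⟨q, rfl⟩ := exists_domMap hb
    rw [glueMap_domMap, glueMap_domMap]
    constructor
    · exact fun h => (glueHom k S T φ).map_lt p q h
    · intro h
      have := φ.hom.map_lt (φ.inv.toFun p) (φ.inv.toFun q) h
      rw [inv_hom_apply, inv_hom_apply] at this
      exact this
  · intro t ht hd
    obtain ⟨p, rfl⟩ := exists_domMap ht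
    rw [glueMap_domMap]
    rw [(domMap k T).dim_map, ← (glueHom k S T φ).dim_map] at hd
    rcases hcod p with h | h | h
    · omega
    · omega
    · exact h.2
  · intro s hs htop
    let c : (cod k S).Face := ⟨(s, ∅), subset_span _ _ (Or.inr (Or.inr ⟨hs, htop⟩)),
      isCut_empty _ _ _⟩
    exact ⟨(domMap k T).toFun (φ.hom.toFun c), domMap_mem _, glueMap_hom φ c⟩
  · intro a ha b hb hd h
    obtain ⟨p, rfl⟩ := exists_domMap ha
    obtain ⟨q, rfl⟩ := exists_domMap hb
    rw [glueMap_domMap, glueMap_domMap] at h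
    rw [(domMap k T).dim_map, ← φ.inv.dim_map] at hd
    have := congrArg φ.hom.toFun (codMap_inj hd h)
    rw [inv_hom_apply, inv_hom_apply] at this
    rw [this]
  · intro t hd b
    obtain ⟨p, rfl⟩ := exists_domMap (hmem t hd)
    rw [glueMap_domMap]
    rw [(domMap k T).dim_map, ← (glueHom k S T φ).dim_map] at hd
    rcases hcod p with h | h | h
    · omega
    · exact h.2 b
    · omega
  · intro p q hp hq h
    obtain ⟨p, rfl⟩ := exists_domMap (hmem p hp)
    obtain ⟨q, rfl⟩ := exists_domMap (hmem q hq)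
    rw [glueMap_domMap, glueMap_domMap] at h
    rw [(domMap k T).dim_map, ← φ.inv.dim_map] at hp
    have h1 := inv_hom_apply φ p
    have h2 := inv_hom_apply φ q
    rcases codPath hp h with h | h
    · have := hpath _ _ h
      rw [h1, h2] at this
      exact Or.inl this
    · have := hpath _ _ h
      rw [h1, h2] at this
      exact Or.inr this

theorem tensorRight_of_mem {t : T.toOrd.Face} (ht : t ∈ domSet k T.toOrd.toHypergraph) :
    tensorRight k S T φ t = Sum.inl (glueMap k S T φ t) := by
  have h1 : glueMap k S T φ t = (glueHom k S T φ).toFun (domFace k T t ht) := dif_pos ht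
  rw [h1]
  exact dif_pos ht

theorem tensorRight_of_not_mem {t : T.toOrd.Face} (ht : t ∉ domSet k T.toOrd.toHypergraph) :
    tensorRight k S T φ t = Sum.inr ⟨t, ht⟩ := dif_neg ht

end Glue

namespace IsGluing

variable {k : ℕ} {S T : OrdHypergraph.{u}} {f : T.Face → S.Face} (hf : IsGluing k S T f)
include hf

omit hf in
theorem isMin_of_mem {t : T.Face} (ht : t ∈ domSet k T.toHypergraph) (hd : T.dim t = k) :
    T.IsMin t := by
  rcases ht with h | h
  · omega
  · exact h.2

omit hf in
theorem not_isLoop_of_mem (hT : IsOFS T) {t : T.Face} (ht : t ∈ domSet k T.toHypergraph)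
    (hd : T.dim t = k) : ¬ T.IsLoop t := fun hl =>
  isMin_of_mem ht hd (hT.loop_filling t hl)

theorem inl_mem {c p : T.Face} (hc : c ∈ domSet k T.toHypergraph) (hp : Sum.inl p ∈ T.δ c) :
    Sum.inl (f p) ∈ S.δ (f c) := by
  have := T.dim_δ c p hp
  exact (hf.bij_δ c hc (by omega)).mapsTo hp

theorem exists_inl {c : T.Face} {x : S.Face} (hc : c ∈ domSet k T.toHypergraph)
    (hx : Sum.inl x ∈ S.δ (f c)) : ∃ p, Sum.inl p ∈ T.δ c ∧ f p = x := by
  have h0 := S.dim_δ _ x hx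
  rw [hf.dim_map c hc] at h0
  obtain ⟨p | p, hp, e⟩ := (hf.bij_δ c hc (by omega)).surjOn hx
  · exact ⟨p, hp, Sum.inl_injective e⟩
  · cases e

/-- The map to `S` preserves the upper order in dimensions less than `k`. -/
theorem le_map (hT : IsOFS T) {p q : T.Face} (hd : T.dim p < k) (h : T.le p q) :
    S.le (f p) (f q) := by
  replace h := hT.minStep_of_le h
  induction h with
  | refl => exact ReflTransGen.refl
  | @tail v _ h' hs ih =>
    obtain ⟨c, hc, hcm, hv, rfl⟩ := hs
    have h1 := T.dim_δ c v hv
    have h2 := le.dim_eq (IsOFS.le_of_minStep h')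
    have hcX : c ∈ domSet k T.toHypergraph := mem_domSet_of_isMin (by omega) hcm
    rw [hf.map_γ c hcX (by omega)]
    exact ih.trans (le_of_mem (hf.inl_mem hcX hv))

theorem loopPath_le {p q : T.Face} (h : ReflTransGen (loopStep k S T f) p q) :
    T.le p q ∧ f p = f q := by
  induction h with
  | refl => exact ⟨ReflTransGen.refl, rfl⟩
  | @tail v _ _ hs ih =>
    obtain ⟨c, hcX, hck, hδ, rfl, hl⟩ := hs
    have hv : Sum.inl v ∈ T.δ c := by rw [hδ]; rfl
    have hd := T.dim_δ c v hv
    have h1 := hf.inl_mem hcX hv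
    rw [hl.2] at h1
    refine ⟨ih.1.trans (le_of_mem hv), ih.2.trans ?_⟩
    rw [hf.map_γ c hcX (by omega)]
    exact Sum.inl_injective h1

/-- `p` is the greatest element of its fibre: a loop path out of `p` would start along a minimal
face sharing `p` with `z`, that is along `z`, which is not sent to a loop. Dually, `γ(z)` is the
least element of its fibre, see `γ_le`. -/
theorem le_of_δ (hT : IsOFS T) {z p q : T.Face} (hz : z ∈ domSet k T.toHypergraph)
    (hd : T.dim z = k) (hl : ¬ S.IsLoop (f z)) (hp : Sum.inl p ∈ T.δ z) (hq : T.dim q + 1 = k)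
    (h : f q = f p) : T.le q p := by
  have hdp := T.dim_δ z p hp
  rcases hf.fiber q p hq (by omega) h with h' | h'
  · exact (hf.loopPath_le h').1
  · rcases ReflTransGen.cases_head h' with rfl | ⟨_, ⟨c, hcX, hck, hδ, _, hcl⟩, _⟩
    · exact ReflTransGen.refl
    · have := IsOFS.IsMin.eq_of_le (isMin_of_mem hcX hck) (hT.min_le_of_δ (isMin_of_mem hz hd)
        (not_isLoop_of_mem hT hz hd) (not_isLoop_of_mem hT hcX hck) hp (by rw [hδ]; rfl))
      exact (hl (this ▸ hcl)).elim

theorem γ_le (hT : IsOFS T) {z q : T.Face} (hz : z ∈ domSet k T.toHypergraph)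
    (hd : T.dim z = k) (h0 : 0 < k) (hl : ¬ S.IsLoop (f z)) (hq : T.dim q + 1 = k)
    (h : f q = f (T.γ z)) : T.le (T.γ z) q := by
  have hdp := T.dim_γ z (by omega)
  rcases hf.fiber q (T.γ z) hq (by omega) h with h' | h'
  · rcases ReflTransGen.cases_tail h' with h' | ⟨_, _, ⟨c, hcX, hck, _, hγ, hcl⟩⟩
    · rw [h']
    · have := IsOFS.IsMin.eq_of_le (isMin_of_mem hcX hck) (hT.min_le_of_γ (isMin_of_mem hz hd)
        (not_isLoop_of_mem hT hz hd) (not_isLoop_of_mem hT hcX hck) (by omega) (by omega) hγ.symm)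
      exact (hl (this ▸ hcl)).elim
  · exact (hf.loopPath_le h').1

theorem exists_top (hS : IsOFS S) {a : S.Face} (ha : S.dim a = k) :
    ∃ z ∈ domSet k T.toHypergraph, T.dim z = k ∧ S.le a (f z) := by
  obtain ⟨w, hw, htop⟩ := hS.exists_top a
  obtain ⟨z, hz, rfl⟩ := hf.surj w (hw.dim_eq.symm.trans ha) htop
  exact ⟨z, hz, by rw [← hf.dim_map z hz, ← hw.dim_eq, ha], hw⟩

theorem not_inner (hS : IsOFS S) {t : T.Face} (hd : T.dim t + 1 = k) (b : S.Face) :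
    ¬ S.Inner b (f t) := by
  intro h
  obtain ⟨A, _, _, hι⟩ := IsOFS.Inner.exists_ι hS h
  exact hf.not_mem_ι t hd A hι

/-- The map to `S` reflects the strict upper order in dimension `k - 1`. -/
theorem ltPlus_of_map (hS : IsOFS S) (hT : IsOFS T) {p q : T.Face} (hp : T.dim p + 1 = k)
    (h : S.ltPlus (f p) (f q)) (hq : T.dim q + 1 = k) : T.ltPlus p q := by
  generalize hv : f p = v at h
  induction v using hS.wf.induction generalizing p with
  | _ v ih =>
    subst hv
    have hdp : S.dim (f p) = T.dim p := hf.dim_map p (Or.inl (by omega))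
    obtain ⟨_, ⟨c, hc, hpc, rfl⟩, hle⟩ := TransGen.head'_iff.1 h
    have hdc := S.dim_δ c _ hpc
    -- Replace the first face of the path in `S` by the maximal face `f(z)` above it. Since `f(p)`
    -- is not an inner node it lies in `δ(f(z))`, so `p` is below a face of `δ(z)` and strictly
    -- below `γ(z)`. The rest of the path must pass through `γ(f(z))`, and the induction continues
    -- from `γ(z)`.
    obtain ⟨z, hz, hzk, hcz⟩ := hf.exists_top hS (a := c) (by omega)
    have hzl := hS.not_isLoop_of_le hcz hc
    have hL : S.LowerNode (f z) (f p) := ⟨c, hc, hcz, hpc⟩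
    have hpz : Sum.inl (f p) ∈ S.δ (f z) := by
      rcases hS.mem_or_upperNode hcz hpc with h' | h'
      · exact h'
      · exact (hf.not_inner hS hp _ ⟨h', hL⟩).elim
    obtain ⟨p1, hp1, e⟩ := hf.exists_inl hz hpz
    have hp1l := hf.le_of_δ hT hz hzk hzl hp1 hp e.symm
    have h1 := ltPlus_of_mem (not_isLoop_of_mem hT hz hzk) hp1
    have hγ := hf.map_γ z hz (by omega)
    have hdγ := T.dim_γ z (by omega)
    have hlt : S.ltPlus (f p) (f (T.γ z)) := by
      rw [hγ]
      exact ltPlus_of_mem hzl hpz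
    rcases IsOFS.LowerNode.up hS hL h.le with h' | h' | h'
    · rw [h'] at h
      exact (hS.ltPlus_irrefl _ h).elim
    · rw [← hγ] at h'
      rcases le_iff.1 h' with h' | h'
      · exact (h1.trans_left (hf.γ_le hT hz hzk (by omega) hzl hq h'.symm)).trans_right hp1l
      · exact (h1.trans (ih _ hlt (by omega) rfl h')).trans_right hp1l
    · exact (hf.not_inner hS hq _ h').elim

theorem le_of_map (hS : IsOFS S) (hT : IsOFS T) {p q : T.Face} (hp : T.dim p + 1 = k)
    (hq : T.dim q + 1 = k) (h : S.le (f p) (f q)) : f p = f q ∨ T.ltPlus p q := by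
  rcases le_iff.1 h with h | h
  · exact Or.inl h
  · exact Or.inr (hf.ltPlus_of_map hS hT hp h hq)

theorem le_or_le {p q : T.Face} (hp : T.dim p + 1 = k) (hq : T.dim q + 1 = k)
    (h : f p = f q) : T.le p q ∨ T.le q p :=
  (hf.fiber p q hp hq h).imp (fun h => (hf.loopPath_le h).1) fun h => (hf.loopPath_le h).1

/-- Faces of one fibre are `≤⁺`-comparable, distinct faces of `δ(t)` are not. Hence `κ_T` is
bijective on domains although it identifies `(k-1)`-faces. -/
theorem eq_of_mem_δ (hT : IsOFS T) {t p q : T.Face} (ht : T.dim t = k) (hp : Sum.inl p ∈ T.δ t)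
    (hq : Sum.inl q ∈ T.δ t) (h : f p = f q) : p = q := by
  have h1 := T.dim_δ t p hp
  have h2 := T.dim_δ t q hq
  rcases hf.le_or_le (by omega) (by omega) h with h | h
  · exact (le_iff.1 h).resolve_right (hT.discrete t _ _ hp hq)
  · exact ((le_iff.1 h).resolve_right (hT.discrete t _ _ hq hp)).symm

/-- If a `k`-face of `T` has a face in its domain over the same face of `S` as its codomain then
its domain is a singleton. -/
theorem δ_eq_of_map_eq (hT : IsOFS T) {t p : T.Face} (ht : T.dim t = k)
    (hp : Sum.inl p ∈ T.δ t) (h : f p = f (T.γ t)) : T.δ t = {Sum.inl p} := by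
  by_cases hl : T.IsLoop t
  · rw [hl.2] at hp ⊢
    rw [Set.mem_singleton_iff.1 hp]
  have hdp := T.dim_δ t p hp
  have hdγ := T.dim_γ t (by omega)
  have hlt := ltPlus_of_mem hl hp
  have hpath : ReflTransGen (loopStep k S T f) p (T.γ t) := by
    rcases hf.fiber p (T.γ t) (by omega) (by omega) h with h | h
    · exact h
    · exact (hT.not_le_of_lt hlt (hf.loopPath_le h).1).elim
  -- Every face of `δ(t)` is below `γ(t)`. Followed down the loop path it either equals the codomain
  -- of the current step or is below its only domain face, because the step is along a minimal face;
  -- local discreteness then gives `q = p`.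
  have key : ∀ w, ReflTransGen (loopStep k S T f) p w → ∀ q, Sum.inl q ∈ T.δ t → T.le q w →
      q = p := by
    intro w hw
    induction hw with
    | refl =>
      exact fun q hq hqp => (le_iff.1 hqp).resolve_right (hT.discrete t _ _ hq hp)
    | @tail v w h' hs ih =>
      intro q hq hqw
      have hle := (hf.loopPath_le (h'.tail hs)).1
      obtain ⟨c, hcX, hck, hδ, rfl, _⟩ := hs
      by_cases hqe : q = T.γ c
      · rw [← hqe] at hle
        exact ((le_iff.1 hle).resolve_right (hT.discrete t _ _ hp hq)).symm
      · obtain ⟨p', hp', hle'⟩ := IsOFS.IsMin.le_mem hT (isMin_of_mem hcX hck)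
          (not_isLoop_of_mem hT hcX hck) (by omega) hqw hqe
        rw [hδ] at hp'
        cases Sum.inl_injective hp'
        exact ih q hq hle'
  refine Set.eq_singleton_iff_unique_mem.2 ⟨hp, ?_⟩
  rintro (q | v) hy
  · rw [key _ hpath q hy (le_of_mem hy)]
  · rw [δ_eq_of_inr hy] at hp
    simp at hp

/-! ### Fibres inside a `k`-face -/

/-- Going down from the codomain of `e` along faces over loops, one does not leave `e` unless `e`
becomes a loop. -/
theorem upperNode_of_loopPath (hT : IsOFS T) {e q w : T.Face} (he : T.dim e = k)
    (hel : ∀ p, Sum.inl p ∈ T.δ e → f p ≠ f (T.γ e)) (h : ReflTransGen (loopStep k S T f) q w)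
    (hw : T.UpperNode e w) (hwf : f w = f (T.γ e)) : T.UpperNode e q := by
  induction h with
  | refl => exact hw
  | @tail v w h' hs ih =>
    have hvw := (hf.loopPath_le (ReflTransGen.single hs)).2
    obtain ⟨c, hcX, hck, hδ, rfl, _⟩ := hs
    obtain ⟨m, hm0, hm, hme, hmw⟩ := hw
    have hdm := hme.dim_eq
    have hce := (hT.min_le_of_γ (isMin_of_mem hcX hck) (not_isLoop_of_mem hT hcX hck) hm
      (by omega) hm0 hmw.symm).trans hme
    have hvc : Sum.inl v ∈ T.δ c := by rw [hδ]; rfl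
    rcases hT.mem_or_upperNode hce hvc with h | h
    · exact (hel v h (hvw.trans hwf)).elim
    · exact ih h (hvw.trans hwf)

theorem lowerNode_of_loopPath (hT : IsOFS T) {e q w : T.Face}
    (hel : ∀ p, Sum.inl p ∈ T.δ e → f p ≠ f (T.γ e)) (hl : ¬ T.IsLoop e)
    (hq : Sum.inl q ∈ T.δ e) (h : ReflTransGen (loopStep k S T f) q w) : T.LowerNode e w := by
  induction h with
  | refl => exact IsOFS.lowerNode_of_mem hl hq
  | @tail v w h' hs ih =>
    have hvw := (hf.loopPath_le (h'.tail hs)).2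
    obtain ⟨c, hcX, hck, hδ, rfl, _⟩ := hs
    obtain ⟨m, hm, hme, hmw⟩ := ih
    have hvc : Sum.inl v ∈ T.δ c := by rw [hδ]; rfl
    have hcl := not_isLoop_of_mem hT hcX hck
    have hd := T.dim_δ c v hvc
    have hce := (hT.min_le_of_δ (isMin_of_mem hcX hck) hcl hm hvc hmw).trans hme
    rcases IsOFS.UpperNode.cases hT ⟨c, by omega, hcl, hce, rfl⟩ with h | h
    · exact (hel q hq (hvw.trans (by rw [h]))).elim
    · exact h

omit hf in
/-- Nodes above a node of the tree of `δ(a)`. -/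
theorem _root_.FaceStructure.IsOFS.lowerNode_of_chain (hT : IsOFS T) {a v w : T.Face}
    (h : ReflTransGen (IsOFS.chain T a) v (T.γ (T.γ a))) (hle : T.le v w) :
    T.le (T.γ (T.γ a)) w ∨ ∃ e ∈ T.δNonloop a, T.LowerNode e w := by
  induction h using ReflTransGen.head_induction_on with
  | refl => exact Or.inl hle
  | head hs _ ih =>
    obtain ⟨e, he, hv, rfl⟩ := hs
    have hL := IsOFS.lowerNode_of_mem he.2 hv
    rcases IsOFS.LowerNode.up hT hL hle with rfl | h | h
    · exact Or.inr ⟨e, he, hL⟩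
    · exact ih h
    · exact Or.inr ⟨e, he, h.2⟩

/-- All faces over the inner face `γ(p) = q'` of `t` lie in the tree of `δ(t)`. -/
theorem nodes_of_fiber (hT : IsOFS T) {t p q q' w : T.Face} (ht : T.dim t = k + 1) (h0 : 0 < k)
    (hp : Sum.inl p ∈ T.δ t) (hq : Sum.inl q ∈ T.δ t) (hq' : Sum.inl q' ∈ T.δ q)
    (hpl : ∀ x, Sum.inl x ∈ T.δ p → f x ≠ f (T.γ p))
    (hql : ∀ x, Sum.inl x ∈ T.δ q → f x ≠ f (T.γ q)) (hpl' : ¬ T.IsLoop p)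
    (hql' : ¬ T.IsLoop q) (hpq : f (T.γ p) = f q') (hw : T.dim w + 1 = k) (hwf : f w = f q') :
    (∃ e ∈ T.δNonloop t, T.LowerNode e w) ∧ ∃ e ∈ T.δNonloop t, T.UpperNode e w := by
  have dp := T.dim_δ t p hp
  have dq := T.dim_δ t q hq
  have dγ := T.dim_γ p (by omega)
  have dq' := T.dim_δ q q' hq'
  have hpU := IsOFS.upperNode_γ (by omega) hpl'
  have hqL := IsOFS.lowerNode_of_mem hql' hq'
  -- A fibre is linearly ordered by loop paths. If `q'` came strictly before `γ(p)`, it would be a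
  -- lower node of `p`, forcing `p = q`, and then `p` would collapse to a loop.
  have hle : T.le (T.γ p) q' := by
    rcases hf.fiber (T.γ p) q' (by omega) (by omega) hpq with h | h
    · exact (hf.loopPath_le h).1
    · rcases IsOFS.UpperNode.cases hT (hf.upperNode_of_loopPath hT (by omega) hpl h hpU rfl)
        with h' | ⟨m, hm, hmp, hqm⟩
      · rw [h']
      · exfalso
        have hcmp : T.le p q ∨ T.le q p := by
          rcases hT.comparable hm hql' hqm hq' with rfl | h | h
          · exact Or.inr hmp
          · exact hT.up_linear _ _ _ hmp h.le
          · exact Or.inr (h.le.trans hmp)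
        have : p = q := by
          rcases hcmp with h | h
          · exact (le_iff.1 h).resolve_right (hT.discrete t _ _ hp hq)
          · exact ((le_iff.1 h).resolve_right (hT.discrete t _ _ hq hp)).symm
        subst this
        exact hpl q' hq' hpq.symm
  have hroot : ∀ x, T.le x q' → ¬ T.le (T.γ (T.γ t)) x := by
    intro x hx h
    have h1 := ltPlus_of_mem hql' hq'
    have h2 := hT.le_γ (by omega) (le_of_mem hq)
    exact hT.not_le_of_lt (h1.trans_left h2) (h.trans hx)
  have hchain := hT.chain_top (a := t) (by omega) _ p hp rfl
  -- The part of the fibre before `γ(p)` lies inside `p`, the part after `q'` inside `q`, and the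
  -- part in between is above `γ(p)` without reaching `γγ(t)`, so it lies in a face of the chain
  -- from `γ(p)` to `γγ(t)`.
  have hLow : ∀ w, T.dim w + 1 = k → f w = f q' → ∃ e ∈ T.δNonloop t, T.LowerNode e w := by
    intro w hw hwf
    rcases hf.fiber w q' hw (by omega) hwf with h2 | h2
    · rcases hf.fiber w (T.γ p) hw (by omega) (hwf.trans hpq.symm) with h1 | h1
      · rcases IsOFS.UpperNode.cases hT (hf.upperNode_of_loopPath hT (by omega) hpl h1 hpU rfl)
          with h' | h'
        · exact (hT.lowerNode_of_chain hchain (h' ▸ ReflTransGen.refl)).resolve_left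
            (hroot _ (hf.loopPath_le h2).1)
        · exact ⟨p, ⟨hp, hpl'⟩, h'⟩
      · exact (hT.lowerNode_of_chain hchain (hf.loopPath_le h1).1).resolve_left
          (hroot _ (hf.loopPath_le h2).1)
    · exact ⟨q, ⟨hq, hql'⟩, hf.lowerNode_of_loopPath hT hql hql' hq' h2⟩
  refine ⟨hLow w hw hwf, ?_⟩
  rcases hf.fiber w (T.γ p) hw (by omega) (hwf.trans hpq.symm) with h1 | h1
  · exact ⟨p, ⟨hp, hpl'⟩, hf.upperNode_of_loopPath hT (by omega) hpl h1 hpU rfl⟩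
  · rcases ReflTransGen.cases_tail h1 with rfl | ⟨v, hv, hs⟩
    · exact ⟨p, ⟨hp, hpl'⟩, hpU⟩
    · have hvf := (hf.loopPath_le hv).2
      obtain ⟨c, hcX, hck, hδ, rfl, _⟩ := hs
      have hvc : Sum.inl v ∈ T.δ c := by rw [hδ]; rfl
      have hd := T.dim_δ c v hvc
      obtain ⟨e, he, m, hm, hme, hvm⟩ := hLow v (by omega) (hvf.symm.trans hpq)
      have hcl := not_isLoop_of_mem hT hcX hck
      exact ⟨e, he, c, by omega, hcl,
        (hT.min_le_of_δ (isMin_of_mem hcX hck) hcl hm hvc hvm).trans hme, rfl⟩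

end IsGluing

/-! ## The tensor -/

section TensorOrder

variable {k : ℕ} {S T : OFS.{u}} (φ : cod k S ≅ dom k T)

local notation "𝐏" => tensor k S T φ
local notation "𝐟" => glueMap k S T φ
local notation "𝛋" => tensorRight k S T φ
local notation "𝐗" => domSet k T.toOrd.toHypergraph

theorem le_dim_of_not_mem {t : T.toOrd.Face} (ht : t ∉ 𝐗) : k ≤ T.toOrd.dim t := by
  by_contra h
  exact ht (Or.inl (by omega))

theorem dim_of_mem_of_le {t : T.toOrd.Face} (ht : t ∈ 𝐗) (h : k ≤ T.toOrd.dim t) :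
    T.toOrd.dim t = k := by
  rcases ht with h' | h'
  · omega
  · exact h'.1

theorem not_mem_of_γNonloops {t : T.toOrd.Face} (h : k ≤ T.toOrd.dim t)
    (ht : t ∈ T.toOrd.γNonloops) : t ∉ 𝐗 := fun hX =>
  IsGluing.isMin_of_mem hX (dim_of_mem_of_le hX h) ht

theorem γNonloops_of_not_mem {t : T.toOrd.Face} (h : T.toOrd.dim t = k) (ht : t ∉ 𝐗) :
    t ∈ T.toOrd.γNonloops := by
  by_contra hn
  exact ht (Or.inr ⟨h, hn⟩)

theorem not_mem_of_lt_dim {t : T.toOrd.Face} (h : k < T.toOrd.dim t) : t ∉ 𝐗 := fun hX => by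
  have := dim_of_mem_of_le hX h.le
  omega

theorem tensorRight_eq_inl {t : T.toOrd.Face} {s : S.toOrd.Face} :
    𝛋 t = Sum.inl s ↔ t ∈ 𝐗 ∧ 𝐟 t = s := by
  by_cases ht : t ∈ 𝐗
  · rw [tensorRight_of_mem φ ht]
    exact ⟨fun h => ⟨ht, Sum.inl_injective h⟩, fun h => congrArg Sum.inl h.2⟩
  · rw [tensorRight_of_not_mem φ ht]
    exact ⟨fun h => (by cases h), fun h => (ht h.1).elim⟩

theorem tensorRight_eq_inr {t : T.toOrd.Face} {t' : {t : T.toOrd.Face // t ∉ 𝐗}} :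
    𝛋 t = Sum.inr t' ↔ t = t'.1 := by
  by_cases ht : t ∈ 𝐗
  · rw [tensorRight_of_mem φ ht]
    exact ⟨fun h => (by cases h), fun h => (t'.2 (h ▸ ht)).elim⟩
  · rw [tensorRight_of_not_mem φ ht]
    refine ⟨fun h => ?_, fun h => ?_⟩
    · exact congrArg Subtype.val (Sum.inr_injective h)
    · exact congrArg Sum.inr (Subtype.ext h)

theorem inr_eq_tensorRight (t : {t : T.toOrd.Face // t ∉ 𝐗}) : Sum.inr t = 𝛋 t.1 :=
  ((tensorRight_eq_inr φ).2 rfl).symm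

theorem tensorRight_low {t : T.toOrd.Face} (h : T.toOrd.dim t + 1 = k) : 𝛋 t = Sum.inl (𝐟 t) :=
  tensorRight_of_mem φ (Or.inl (by omega))

theorem tensorRight_inj {a b : T.toOrd.Face} (hd : T.toOrd.dim a + 1 ≠ k) (h : 𝛋 a = 𝛋 b) :
    a = b := by
  by_cases ha : a ∈ 𝐗
  · rw [tensorRight_of_mem φ ha] at h
    obtain ⟨hb, e⟩ := (tensorRight_eq_inl φ).1 h.symm
    exact (isGluing_glueMap φ).inj a ha b hb hd e.symm
  · rw [tensorRight_of_not_mem φ ha] at h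
    exact ((tensorRight_eq_inr φ).1 h.symm).symm

/-- The inclusion of `S`, as a morphism of hypergraphs. -/
noncomputable def leftHom : HgHom S.toOrd.toHypergraph (𝐏).toHypergraph where
  toFun := Sum.inl
  dim_map _ := rfl
  map_γ _ _ := rfl
  bij_δ a _ := by
    change Set.BijOn _ _ (Sum.map (tensorLeft k S T) (tensorLeft k S T) '' S.toOrd.δ a)
    refine Set.InjOn.bijOn_image fun x _ y _ h => ?_
    exact Sum.map_injective.2 ⟨Sum.inl_injective, Sum.inl_injective⟩ h

theorem tensorδ_mem {t : T.toOrd.Face} (ht : t ∈ 𝐗) (h0 : 0 < T.toOrd.dim t) :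
    (𝐏).δ (𝛋 t) = Sum.map 𝛋 𝛋 '' T.toOrd.δ t := by
  have hX := domSet_isSub k T.toOrd.toHypergraph
  rw [tensorRight_of_mem φ ht]
  change Sum.map (tensorLeft k S T) (tensorLeft k S T) '' S.toOrd.δ (𝐟 t) = _
  rw [← ((isGluing_glueMap φ).bij_δ t ht h0).image_eq, Set.image_image]
  refine Set.image_congr fun y hy => ?_
  rcases y with y | v
  · exact congrArg Sum.inl (tensorRight_of_mem φ (hX.δ_mem t ht y hy)).symm
  · exact congrArg Sum.inr (tensorRight_of_mem φ (hX.δ_empty_mem t ht v hy)).symm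

/-- The map `κ_T`, as a morphism of hypergraphs. -/
noncomputable def rightHom : HgHom T.toOrd.toHypergraph (𝐏).toHypergraph where
  toFun := 𝛋
  dim_map := tensorDim_right k S T φ
  map_γ a h0 := by
    by_cases ha : a ∈ 𝐗
    · rw [tensorRight_of_mem φ ha,
        tensorRight_of_mem φ ((domSet_isSub k T.toOrd.toHypergraph).γ_mem a ha),
        (isGluing_glueMap φ).map_γ a ha h0]
      rfl
    · rw [tensorRight_of_not_mem φ ha]
      rfl
  bij_δ a h0 := by
    have e : (𝐏).δ (𝛋 a) = Sum.map 𝛋 𝛋 '' T.toOrd.δ a := by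
      by_cases ha : a ∈ 𝐗
      · exact tensorδ_mem φ ha h0
      · rw [tensorRight_of_not_mem φ ha]
        rfl
    rw [e]
    refine Set.InjOn.bijOn_image ?_
    rintro (x | v) hx (y | w) hy h
    · have h' := Sum.inl_injective h
      have hdx := T.toOrd.dim_δ a x hx
      have hdy := T.toOrd.dim_δ a y hy
      by_cases hk : T.toOrd.dim x + 1 = k
      · rw [tensorRight_low φ hk, tensorRight_low φ (by omega)] at h'
        rw [(isGluing_glueMap φ).eq_of_mem_δ T.isOFS (by omega) hx hy (Sum.inl_injective h')]
      · rw [tensorRight_inj φ hk h']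
    · cases h
    · cases h
    · rw [δ_eq_of_inr hx] at hy
      exact (Set.mem_singleton_iff.1 hy).symm

theorem leftHom_isLoop {s : S.toOrd.Face} (h : (𝐏).IsLoop (Sum.inl s)) : S.toOrd.IsLoop s :=
  (leftHom φ).isLoop_of_map h fun _ _ _ _ e => Sum.inl_injective e

/-- Being a loop compares faces one dimension down, and `κ_T` identifies faces only in dimension `k
- 1`. New loops therefore appear in dimension `k` only. -/
theorem rightHom_isLoop {t : T.toOrd.Face} (hd : T.toOrd.dim t ≠ k) (h : (𝐏).IsLoop (𝛋 t)) :
    T.toOrd.IsLoop t :=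
  (rightHom φ).isLoop_of_map h fun _ _ hx _ e => tensorRight_inj φ (by omega) e

theorem rightHom_isLoop_iff {t : T.toOrd.Face} (hd : T.toOrd.dim t = k) :
    (𝐏).IsLoop (𝛋 t) ↔ ∃ p, Sum.inl p ∈ T.toOrd.δ t ∧ 𝐟 p = 𝐟 (T.toOrd.γ t) := by
  constructor
  · intro h
    have h0 : 0 < T.toOrd.dim t := by
      rw [← (rightHom φ).dim_map]
      exact h.1
    have hm : Sum.inl (𝛋 (T.toOrd.γ t)) ∈ (𝐏).δ (𝛋 t) := by
      rw [h.2]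
      exact congrArg Sum.inl ((rightHom φ).map_γ t h0)
    obtain ⟨p, hp, e⟩ := (rightHom φ).exists_inl hm
    have h1 := T.toOrd.dim_δ t p hp
    have h2 := T.toOrd.dim_γ t h0
    change 𝛋 p = _ at e
    rw [tensorRight_low φ (by omega), tensorRight_low φ (by omega)] at e
    exact ⟨p, hp, Sum.inl_injective e⟩
  · rintro ⟨p, hp, e⟩
    have h1 := T.toOrd.dim_δ t p hp
    have h2 := T.toOrd.dim_γ t (by omega)
    refine ⟨by rw [show (𝐏).dim (𝛋 t) = _ from (rightHom φ).dim_map t]; omega, ?_⟩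
    have hb := ((rightHom φ).bij_δ t (by omega)).image_eq
    rw [(isGluing_glueMap φ).δ_eq_of_map_eq T.isOFS hd hp e] at hb
    have e' : 𝛋 p = 𝛋 (T.toOrd.γ t) := by
      rw [tensorRight_low φ (by omega), tensorRight_low φ (by omega), e]
    have h3 := (rightHom φ).map_γ t (by omega)
    rw [show (rightHom φ).toFun t = 𝛋 t from rfl] at hb h3
    rw [← hb, ← h3]
    simp only [Set.image_singleton, Sum.map_inl]
    rw [show (rightHom φ).toFun p = (rightHom φ).toFun (T.toOrd.γ t) from e']

/-! ### The upper order of the tensor -/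

/-- A step out of `S` starts at a glued `k`-face. A step along a new `k`-face stays in `S`, and it
is strict there because an equality would make the face a loop of the tensor. -/
theorem upperStep_tensor_inl {a : S.toOrd.Face} {y : (𝐏).Face}
    (h : (𝐏).upperStep (Sum.inl a) y) :
    (∃ b, y = Sum.inl b ∧ S.toOrd.ltPlus a b) ∨
      ∃ z ∈ 𝐗, T.toOrd.dim z = k ∧ 𝐟 z = a ∧ ∃ t, y = Sum.inr t ∧ T.toOrd.ltPlus z t.1 := by
  obtain ⟨c, hc, hac, rfl⟩ := h
  rcases c with c | t
  · obtain ⟨x, hx, e⟩ := (leftHom φ).exists_inl (a := c) hac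
    cases Sum.inl_injective e
    exact Or.inl ⟨_, rfl, ltPlus_of_mem (fun hl => hc ((leftHom φ).isLoop_map hl)) hx⟩
  · rw [inr_eq_tensorRight φ] at hc hac
    have e : (𝐏).γ (Sum.inr t) = 𝛋 (T.toOrd.γ t.1) := rfl
    rw [e]
    obtain ⟨p, hp, hpa⟩ := (rightHom φ).exists_inl hac
    obtain ⟨hpX, hpf⟩ := (tensorRight_eq_inl φ).1 hpa
    have hk := le_dim_of_not_mem t.2
    have h1 := T.toOrd.dim_δ _ _ hp
    have h2 := T.toOrd.dim_γ t.1 (by omega)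
    have hcl : ¬ T.toOrd.IsLoop t.1 := fun hl => hc ((rightHom φ).isLoop_map hl)
    by_cases hdk : T.toOrd.dim t.1 = k
    · left
      rw [tensorRight_low φ (by omega)]
      refine ⟨_, rfl, ?_⟩
      rcases le_iff.1 ((isGluing_glueMap φ).le_map T.isOFS (by omega) (le_of_mem hp)) with h | h
      · exact (hc ((rightHom_isLoop_iff φ hdk).2 ⟨p, hp, h⟩)).elim
      · rwa [hpf] at h
    · right
      have hpk := dim_of_mem_of_le hpX (by omega)
      have hγ : T.toOrd.γ t.1 ∉ 𝐗 := not_mem_of_γNonloops (by omega) ⟨t.1, by omega, hcl, rfl⟩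
      exact ⟨p, hpX, hpk, hpf, ⟨_, hγ⟩, tensorRight_of_not_mem φ hγ, ltPlus_of_mem hcl hp⟩

theorem upperStep_tensor_inr {t : {t : T.toOrd.Face // t ∉ 𝐗}} {y : (𝐏).Face}
    (h : (𝐏).upperStep (Sum.inr t) y) :
    ∃ t', y = Sum.inr t' ∧ T.toOrd.ltPlus t.1 t'.1 := by
  obtain ⟨c, hc, hac, rfl⟩ := h
  rcases c with c | c
  · obtain ⟨x, hx, e⟩ := (leftHom φ).exists_inl (a := c) hac
    cases e
  · rw [inr_eq_tensorRight φ] at hc hac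
    have e : (𝐏).γ (Sum.inr c) = 𝛋 (T.toOrd.γ c.1) := rfl
    rw [e]
    obtain ⟨p, hp, hpa⟩ := (rightHom φ).exists_inl hac
    have hpt := (tensorRight_eq_inr φ).1 hpa
    subst hpt
    have hk := le_dim_of_not_mem t.2
    have h1 := T.toOrd.dim_δ _ _ hp
    have h2 := T.toOrd.dim_γ c.1 (by omega)
    have hcl : ¬ T.toOrd.IsLoop c.1 := fun hl => hc ((rightHom φ).isLoop_map hl)
    have hγ : T.toOrd.γ c.1 ∉ 𝐗 := not_mem_of_γNonloops (by omega) ⟨c.1, by omega, hcl, rfl⟩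
    exact ⟨⟨_, hγ⟩, tensorRight_of_not_mem φ hγ, ltPlus_of_mem hcl hp⟩

theorem ltPlus_tensor_inr {t : {t : T.toOrd.Face // t ∉ 𝐗}} {y : (𝐏).Face}
    (h : (𝐏).ltPlus (Sum.inr t) y) : ∃ t', y = Sum.inr t' ∧ T.toOrd.ltPlus t.1 t'.1 := by
  induction h with
  | single hs => exact upperStep_tensor_inr φ hs
  | tail _ hs ih =>
    obtain ⟨t', rfl, h⟩ := ih
    obtain ⟨t'', rfl, h'⟩ := upperStep_tensor_inr φ hs
    exact ⟨t'', rfl, h.trans h'⟩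

theorem ltPlus_tensor_inl {a : S.toOrd.Face} {y : (𝐏).Face} (h : (𝐏).ltPlus (Sum.inl a) y) :
    (∃ b, y = Sum.inl b ∧ S.toOrd.ltPlus a b) ∨
      ∃ z ∈ 𝐗, T.toOrd.dim z = k ∧ S.toOrd.le a (𝐟 z) ∧
        ∃ t, y = Sum.inr t ∧ T.toOrd.ltPlus z t.1 := by
  induction h with
  | single hs =>
    rcases upperStep_tensor_inl φ hs with h | ⟨z, hz, hzk, rfl, h⟩
    · exact Or.inl h
    · exact Or.inr ⟨z, hz, hzk, ReflTransGen.refl, h⟩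
  | tail _ hs ih =>
    rcases ih with ⟨b, rfl, h⟩ | ⟨z, hz, hzk, hle, t, rfl, h⟩
    · rcases upperStep_tensor_inl φ hs with ⟨b', rfl, h'⟩ | ⟨z, hz, hzk, rfl, h'⟩
      · exact Or.inl ⟨b', rfl, h.trans h'⟩
      · exact Or.inr ⟨z, hz, hzk, h.le, h'⟩
    · obtain ⟨t', rfl, h'⟩ := upperStep_tensor_inr φ hs
      exact Or.inr ⟨z, hz, hzk, hle, t', rfl, h.trans h'⟩

theorem ltPlus_inl_inl {a b : S.toOrd.Face} :
    (𝐏).ltPlus (Sum.inl a) (Sum.inl b) ↔ S.toOrd.ltPlus a b := by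
  constructor
  · intro h
    rcases ltPlus_tensor_inl φ h with ⟨b', e, h⟩ | ⟨_, _, _, _, _, e, _⟩
    · cases Sum.inl_injective e
      exact h
    · cases e
  · exact fun h => (leftHom φ).ltPlus_map h fun c _ => leftHom_isLoop φ

theorem not_ltPlus_inr_inl {t : {t : T.toOrd.Face // t ∉ 𝐗}} {a : S.toOrd.Face} :
    ¬ (𝐏).ltPlus (Sum.inr t) (Sum.inl a) := by
  intro h
  obtain ⟨_, e, _⟩ := ltPlus_tensor_inr φ h
  cases e

theorem top_of_mem {z : T.toOrd.Face} (hz : z ∈ 𝐗) (hzk : T.toOrd.dim z = k) :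
    𝐟 z ∉ S.toOrd.δNonloops := (isGluing_glueMap φ).top z hz hzk

/-- The glued `k`-faces are the maximal ones and a face is below only one maximal face. So the `z`
in the mixed clauses of the order is determined by `a`. -/
theorem eq_of_le_le {a : S.toOrd.Face} {z w : T.toOrd.Face} (hz : z ∈ 𝐗)
    (hzk : T.toOrd.dim z = k) (hw : w ∈ 𝐗) (hwk : T.toOrd.dim w = k) (h : S.toOrd.le a (𝐟 z))
    (h' : S.toOrd.le a (𝐟 w)) : z = w :=
  (isGluing_glueMap φ).inj z hz w hw (by omega)
    (S.isOFS.top_unique (top_of_mem φ hz hzk) (top_of_mem φ hw hwk) h h')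

/-- Steps in dimension at least `k` run along faces of dimension above `k`, among which there are no
new loops; a glued `k`-face is maximal in `S`, so paths from it leave `S` at once. -/
theorem ltPlus_right {p q : T.toOrd.Face} (hp : k ≤ T.toOrd.dim p) :
    (𝐏).ltPlus (𝛋 p) (𝛋 q) ↔ T.toOrd.ltPlus p q := by
  constructor
  · intro h
    by_cases hpX : p ∈ 𝐗
    · have hpk := dim_of_mem_of_le hpX hp
      rw [tensorRight_of_mem φ hpX] at h
      rcases ltPlus_tensor_inl φ h with ⟨b, _, h⟩ | ⟨z, hz, hzk, hle, t, e, h⟩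
      · have := IsOFS.eq_of_top_le (top_of_mem φ hpX hpk) h.le
        rw [this] at h
        exact (S.isOFS.ltPlus_irrefl _ h).elim
      · rw [(tensorRight_eq_inr φ).1 e, eq_of_le_le φ hpX hpk hz hzk ReflTransGen.refl hle]
        exact h
    · rw [tensorRight_of_not_mem φ hpX] at h
      obtain ⟨t, e, h⟩ := ltPlus_tensor_inr φ h
      rw [(tensorRight_eq_inr φ).1 e]
      exact h
  · exact fun h => (rightHom φ).ltPlus_map h fun c hc => rightHom_isLoop φ (by omega)

theorem le_inl_inl {a b : S.toOrd.Face} :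
    (𝐏).le (Sum.inl a) (Sum.inl b) ↔ S.toOrd.le a b := by
  refine le_iff.trans (Iff.trans ?_ le_iff.symm)
  exact or_congr ⟨fun h => Sum.inl_injective h, fun h => congrArg Sum.inl h⟩ (ltPlus_inl_inl φ)

theorem le_right {p q : T.toOrd.Face} (hp : k ≤ T.toOrd.dim p) :
    (𝐏).le (𝛋 p) (𝛋 q) ↔ T.toOrd.le p q := by
  refine le_iff.trans (Iff.trans ?_ le_iff.symm)
  exact or_congr ⟨fun h => tensorRight_inj φ (by omega) h, fun h => congrArg 𝛋 h⟩
    (ltPlus_right φ hp)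

theorem not_le_inr_inl {t : {t : T.toOrd.Face // t ∉ 𝐗}} {a : S.toOrd.Face} :
    ¬ (𝐏).le (Sum.inr t) (Sum.inl a) := by
  intro h
  rcases le_iff.1 h with h | h
  · cases h
  · exact not_ltPlus_inr_inl φ h

theorem le_inl_inr {a : S.toOrd.Face} {t : {t : T.toOrd.Face // t ∉ 𝐗}}
    (h : (𝐏).le (Sum.inl a) (Sum.inr t)) :
    ∃ z ∈ 𝐗, T.toOrd.dim z = k ∧ S.toOrd.le a (𝐟 z) ∧ T.toOrd.ltPlus z t.1 := by
  rcases le_iff.1 h with h | h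
  · cases h
  · rcases ltPlus_tensor_inl φ h with ⟨_, e, _⟩ | ⟨z, hz, hzk, hle, t', e, h⟩
    · cases e
    · cases Sum.inr_injective e
      exact ⟨z, hz, hzk, hle, h⟩

theorem ltPlus_inl_inr {a : S.toOrd.Face} {z : T.toOrd.Face} {t : {t : T.toOrd.Face // t ∉ 𝐗}}
    (hz : z ∈ 𝐗) (hzk : T.toOrd.dim z = k) (hle : S.toOrd.le a (𝐟 z))
    (h : T.toOrd.ltPlus z t.1) : (𝐏).ltPlus (Sum.inl a) (Sum.inr t) := by
  have h1 : (𝐏).le (Sum.inl a) (𝛋 z) := by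
    rw [tensorRight_of_mem φ hz]
    exact (le_inl_inl φ).2 hle
  have h2 : (𝐏).ltPlus (𝛋 z) (Sum.inr t) := by
    rw [inr_eq_tensorRight φ]
    exact (ltPlus_right φ hzk.ge).2 h
  exact h2.trans_right h1

theorem ltMinus_inl_inl {a b : S.toOrd.Face} :
    (𝐏).ltMinus (Sum.inl a) (Sum.inl b) ↔ S.toOrd.ltMinus a b := by
  constructor
  · intro h
    obtain ⟨h0, p, hp, hle⟩ := ltMinus_iff.1 h
    obtain ⟨x, hx, rfl⟩ := (leftHom φ).exists_inl (a := b) hp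
    exact ltMinus_iff.2 ⟨h0, x, hx, (le_inl_inl φ).1 hle⟩
  · exact (leftHom φ).ltMinus_map

/-- The lower relation is stable under going down on the left. -/
theorem ltMinus_of_le {H : Hypergraph.{u}} {a b c : H.Face} (h0 : 0 < H.dim a)
    (h : H.le (H.γ a) (H.γ b)) (hm : H.ltMinus b c) : H.ltMinus a c := by
  obtain ⟨_, p, hp, hle⟩ := ltMinus_iff.1 hm
  exact ltMinus_iff.2 ⟨h0, p, hp, h.trans hle⟩

theorem ltMinus_inl_of_le {a : S.toOrd.Face} {z : T.toOrd.Face} {y : (𝐏).Face} (hz : z ∈ 𝐗)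
    (hle : S.toOrd.le a (𝐟 z)) (h : (𝐏).ltMinus (𝛋 z) y) : (𝐏).ltMinus (Sum.inl a) y := by
  rw [tensorRight_of_mem φ hz] at h
  have h0 : 0 < S.toOrd.dim a := by
    rw [hle.dim_eq]
    exact (ltMinus_iff.1 h).1
  exact ltMinus_of_le (H := (𝐏).toHypergraph) (a := Sum.inl a) (b := Sum.inl (𝐟 z)) h0
    ((le_inl_inl φ).2 (S.isOFS.le_γ h0 hle)) h

/-! ### The order `<~` of the tensor -/

theorem tensorLt_cases {x y : (𝐏).Face} (h : (𝐏).lt x y) :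
    (∃ a b, x = Sum.inl a ∧ y = Sum.inl b ∧ S.toOrd.lt a b) ∨
    (∃ a b, x = 𝛋 a ∧ y = 𝛋 b ∧ k ≤ T.toOrd.dim a ∧ T.toOrd.lt a b) ∨
    (∃ a b, x = Sum.inl a ∧ y = 𝛋 b ∧ S.toOrd.dim a = k + 1 ∧ T.toOrd.dim b = k + 1 ∧
      (𝐏).ltMinus x y) ∨
    (∃ a b z, x = Sum.inl a ∧ y = 𝛋 b ∧ S.toOrd.dim a = k ∧ b ∉ 𝐗 ∧ z ∈ 𝐗 ∧
      T.toOrd.dim z = k ∧ S.toOrd.le a (𝐟 z) ∧ T.toOrd.lt z b) ∨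
    (∃ a b z, x = 𝛋 b ∧ y = Sum.inl a ∧ S.toOrd.dim a = k ∧ b ∉ 𝐗 ∧ z ∈ 𝐗 ∧
      T.toOrd.dim z = k ∧ S.toOrd.le a (𝐟 z) ∧ T.toOrd.lt b z ∧ (𝐏).ltMinus x y) := by
  have hle : ∀ a b : S.toOrd.Face, S.toOrd.lePlus a b → S.toOrd.le a b := fun a b h =>
    le_iff.2 h
  change TensorLt k S T φ x y at h
  cases h with
  | left a b h => exact Or.inl ⟨a, b, rfl, rfl, h⟩
  | right a b hk h => exact Or.inr (Or.inl ⟨a, b, rfl, rfl, hk, h⟩)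
  | cross a b ha hb h => exact Or.inr (Or.inr (Or.inl ⟨a, b, rfl, rfl, ha, hb, h⟩))
  | below a zS b zT ha _ hb hbγ hz hle' h =>
    obtain ⟨hzX, rfl⟩ := (tensorRight_eq_inl φ).1 hz.2
    exact Or.inr (Or.inr (Or.inr (Or.inl ⟨a, b, zT, rfl, rfl, ha,
      not_mem_of_γNonloops hb.ge hbγ, hzX, hz.1, hle _ _ hle', h⟩)))
  | above a zS b zT ha _ hb hbγ hm hz hle' h =>
    obtain ⟨hzX, rfl⟩ := (tensorRight_eq_inl φ).1 hz.2
    exact Or.inr (Or.inr (Or.inr (Or.inr ⟨a, b, zT, rfl, rfl, ha,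
      not_mem_of_γNonloops hb.ge hbγ, hzX, hz.1, hle _ _ hle', h, hm⟩)))

theorem lt_inl_inl {a b : S.toOrd.Face} :
    (𝐏).lt (Sum.inl a) (Sum.inl b) ↔ S.toOrd.lt a b := by
  refine ⟨fun h => ?_, fun h => TensorLt.left a b h⟩
  rcases tensorLt_cases φ h with ⟨a', b', e, e', h1⟩ | ⟨a', b', e, e', _, h1⟩ |
    ⟨a', b', e, e', _, hb, _⟩ | ⟨a', b', z, e, e', _, hb, _⟩ | ⟨a', b', z, e, e', _, hb, _⟩
  · cases Sum.inl_injective e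
    cases Sum.inl_injective e'
    exact h1
  · obtain ⟨ha, rfl⟩ := (tensorRight_eq_inl φ).1 e.symm
    obtain ⟨hb, rfl⟩ := (tensorRight_eq_inl φ).1 e'.symm
    exact ((isGluing_glueMap φ).lt_iff _ ha _ hb).1 h1
  · obtain ⟨hb', _⟩ := (tensorRight_eq_inl φ).1 e'.symm
    exact (not_mem_of_lt_dim (by omega) hb').elim
  · exact (hb ((tensorRight_eq_inl φ).1 e'.symm).1).elim
  · exact (hb ((tensorRight_eq_inl φ).1 e.symm).1).elim

theorem lt_inr_inr {a b : {t : T.toOrd.Face // t ∉ 𝐗}} :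
    (𝐏).lt (Sum.inr a) (Sum.inr b) ↔ T.toOrd.lt a.1 b.1 := by
  refine ⟨fun h => ?_, fun h => ?_⟩
  · rcases tensorLt_cases φ h with ⟨a', b', e, e', h⟩ | ⟨a', b', e, e', _, h⟩ |
      ⟨a', b', e, e', _⟩ | ⟨a', b', z, e, e', _⟩ | ⟨a', b', z, e, e', _⟩
    · cases e
    · rwa [(tensorRight_eq_inr φ).1 e.symm, (tensorRight_eq_inr φ).1 e'.symm] at h
    · cases e
    · cases e
    · cases e'
  · rw [inr_eq_tensorRight φ, inr_eq_tensorRight φ]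
    exact TensorLt.right _ _ (le_dim_of_not_mem a.2) h

/-- In dimension `k` the clauses `right` and `below` merge: a face outside `δ(S^{-λ})` is maximal,
so it equals `f(z)` itself. -/
theorem lt_inl_inr {a : S.toOrd.Face} {t : {t : T.toOrd.Face // t ∉ 𝐗}} :
    (𝐏).lt (Sum.inl a) (Sum.inr t) ↔
      (S.toOrd.dim a = k ∧ ∃ z ∈ 𝐗, T.toOrd.dim z = k ∧ S.toOrd.le a (𝐟 z) ∧
        T.toOrd.lt z t.1) ∨
      (S.toOrd.dim a = k + 1 ∧ T.toOrd.dim t.1 = k + 1 ∧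
        (𝐏).ltMinus (Sum.inl a) (Sum.inr t)) := by
  constructor
  · intro h0
    rcases tensorLt_cases φ h0 with ⟨a', b', e, e', h⟩ | ⟨a', b', e, e', hk, h⟩ |
      ⟨a', b', e, e', ha, hb, h⟩ | ⟨a', b', z, e, e', ha, _, hz, hzk, hle, h⟩ |
      ⟨a', b', z, e, e', _⟩
    · cases e'
    · obtain ⟨ha, rfl⟩ := (tensorRight_eq_inl φ).1 e.symm
      have hak := dim_of_mem_of_le ha hk
      rw [(tensorRight_eq_inr φ).1 e'.symm] at h
      exact Or.inl ⟨by rw [(isGluing_glueMap φ).dim_map _ ha, hak], a', ha, hak,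
        ReflTransGen.refl, h⟩
    · cases Sum.inl_injective e
      rw [(tensorRight_eq_inr φ).1 e'.symm] at hb
      exact Or.inr ⟨ha, hb, h⟩
    · cases Sum.inl_injective e
      rw [(tensorRight_eq_inr φ).1 e'.symm] at h
      exact Or.inl ⟨ha, z, hz, hzk, hle, h⟩
    · cases e'
  · rintro (⟨ha, z, hz, hzk, hle, h⟩ | ⟨ha, hb, h⟩)
    · have hdt := T.toOrd.lt_dim _ _ h
      rw [inr_eq_tensorRight φ]
      by_cases hδ : a ∈ S.toOrd.δNonloops
      · exact TensorLt.below a (𝐟 z) t.1 z ha hδ (by omega)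
          (γNonloops_of_not_mem (by omega) t.2) ⟨hzk, tensorRight_of_mem φ hz⟩
          (le_iff.1 hle) h
      · rw [IsOFS.eq_of_top_le hδ hle, ← tensorRight_of_mem φ hz]
        exact TensorLt.right _ _ hzk.ge h
    · rw [inr_eq_tensorRight φ] at h ⊢
      exact TensorLt.cross a t.1 ha hb h

theorem lt_inr_inl {a : S.toOrd.Face} {t : {t : T.toOrd.Face // t ∉ 𝐗}} :
    (𝐏).lt (Sum.inr t) (Sum.inl a) ↔
      (𝐏).ltMinus (Sum.inr t) (Sum.inl a) ∧ S.toOrd.dim a = k ∧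
        ∃ z ∈ 𝐗, T.toOrd.dim z = k ∧ S.toOrd.le a (𝐟 z) ∧ T.toOrd.lt t.1 z := by
  constructor
  · intro h0
    rcases tensorLt_cases φ h0 with ⟨a', b', e, e', h⟩ | ⟨a', b', e, e', hk, h⟩ |
      ⟨a', b', e, e', ha, hb, h⟩ | ⟨a', b', z, e, e', ha, _⟩ |
      ⟨a', b', z, e, e', ha, _, hz, hzk, hle, h, hm⟩
    · cases e
    · obtain ⟨hb, rfl⟩ := (tensorRight_eq_inl φ).1 e'.symm
      have hd := T.toOrd.lt_dim _ _ h
      have hbk := dim_of_mem_of_le hb (by omega)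
      have hm := (rightHom φ).ltMinus_map (T.isOFS.lt_ltMinus _ _ h)
      rw [show (rightHom φ).toFun a' = _ from e.symm, show (rightHom φ).toFun b' = _ from e'.symm]
        at hm
      rw [(tensorRight_eq_inr φ).1 e.symm] at h
      exact ⟨hm, by rw [(isGluing_glueMap φ).dim_map _ hb, hbk], b', hb, hbk,
        ReflTransGen.refl, h⟩
    · cases e
    · cases e
    · cases Sum.inl_injective e'
      rw [(tensorRight_eq_inr φ).1 e.symm] at h
      exact ⟨hm, ha, z, hz, hzk, hle, h⟩
  · rintro ⟨hm, ha, z, hz, hzk, hle, h⟩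
    have hdt := T.toOrd.lt_dim _ _ h
    rw [inr_eq_tensorRight φ] at hm ⊢
    by_cases hδ : a ∈ S.toOrd.δNonloops
    · exact TensorLt.above a (𝐟 z) t.1 z ha hδ (by omega)
        (γNonloops_of_not_mem (by omega) t.2) hm ⟨hzk, tensorRight_of_mem φ hz⟩
        (le_iff.1 hle) h
    · rw [IsOFS.eq_of_top_le hδ hle, ← tensorRight_of_mem φ hz]
      exact TensorLt.right _ _ (by omega) h

theorem lt_right {a b : T.toOrd.Face} (h : T.toOrd.lt a b) : (𝐏).lt (𝛋 a) (𝛋 b) := by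
  by_cases hk : k ≤ T.toOrd.dim a
  · exact TensorLt.right a b hk h
  · have ha : a ∈ 𝐗 := Or.inl (by omega)
    have hb : b ∈ 𝐗 := Or.inl (by rw [← T.toOrd.lt_dim _ _ h]; omega)
    rw [tensorRight_of_mem φ ha, tensorRight_of_mem φ hb]
    exact (lt_inl_inl φ).2 (((isGluing_glueMap φ).lt_iff a ha b hb).1 h)

theorem ltMinus_of_tensorLt {x y : (𝐏).Face} (h : (𝐏).lt x y) : (𝐏).ltMinus x y := by
  rcases tensorLt_cases φ h with ⟨a, b, rfl, rfl, h'⟩ | ⟨a, b, rfl, rfl, _, h'⟩ |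
    ⟨a, b, _, _, _, _, h'⟩ | ⟨a, b, z, rfl, rfl, _, _, hz, _, hle, h'⟩ |
    ⟨_, _, _, _, _, _, _, _, _, _, _, h'⟩
  · exact (leftHom φ).ltMinus_map (S.isOFS.lt_ltMinus _ _ h')
  · exact (rightHom φ).ltMinus_map (T.isOFS.lt_ltMinus _ _ h')
  · exact h'
  · exact ltMinus_inl_of_le φ hz hle ((rightHom φ).ltMinus_map (T.isOFS.lt_ltMinus _ _ h'))
  · exact h'

/-- The maximal `k`-faces above faces of `S` related by `<~` are equal or related by `<~`. -/
theorem eq_or_lt_of_tops {a b : S.toOrd.Face} {z w : T.toOrd.Face} (hz : z ∈ 𝐗)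
    (hzk : T.toOrd.dim z = k) (hw : w ∈ 𝐗) (hwk : T.toOrd.dim w = k) (ha : S.toOrd.le a (𝐟 z))
    (hb : S.toOrd.le b (𝐟 w)) (h : S.toOrd.lt a b) : z = w ∨ T.toOrd.lt z w := by
  by_cases hzw : z = w
  · exact Or.inl hzw
  right
  have h1 : S.toOrd.lt (𝐟 z) b := S.isOFS.lt_of_lt_of_le_left h ha fun h' =>
    hzw (eq_of_le_le φ hz hzk hw hwk h' hb)
  have h2 : S.toOrd.lt (𝐟 z) (𝐟 w) := S.isOFS.lt_of_lt_of_le_right h1 hb fun h' =>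
    hzw (eq_of_le_le φ hz hzk hw hwk ReflTransGen.refl h')
  exact ((isGluing_glueMap φ).lt_iff z hz w hw).2 h2

theorem tensorLt_trans {x y w : (𝐏).Face} (h : (𝐏).lt x y) (h' : (𝐏).lt y w) : (𝐏).lt x w := by
  have hm := (ltMinus_of_tensorLt φ h).trans (ltMinus_of_tensorLt φ h')
  have htop := fun a (ha : S.toOrd.dim a = k) => (isGluing_glueMap φ).exists_top S.isOFS ha
  rcases x with a | s <;> rcases y with b | t <;> rcases w with c | r
  · rw [lt_inl_inl φ] at h h' ⊢
    exact S.isOFS.lt_trans _ _ _ h h'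
  · rw [lt_inl_inl φ] at h
    rw [lt_inl_inr φ] at h' ⊢
    have hd := S.toOrd.lt_dim _ _ h
    rcases h' with ⟨hb, z, hz, hzk, hle, h'⟩ | ⟨hb, hr, h'⟩
    -- Both faces of `S` are replaced by the maximal faces above them, which are equal or still
    -- related by `<~`.
    · obtain ⟨z', hz', hzk', hle'⟩ := htop a (by omega)
      refine Or.inl ⟨by omega, z', hz', hzk', hle', ?_⟩
      rcases eq_or_lt_of_tops φ hz' hzk' hz hzk hle' hle h with rfl | h''
      · exact h'
      · exact T.isOFS.lt_trans _ _ _ h'' h'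
    · exact Or.inr ⟨by omega, hr, hm⟩
  · rw [lt_inl_inr φ] at h
    obtain ⟨_, hc, z', hz', hzk', hle', h'⟩ := (lt_inr_inl φ).1 h'
    have hd := T.toOrd.lt_dim _ _ h'
    rcases h with ⟨ha, z, hz, hzk, hle, h⟩ | ⟨_, ht, _⟩
    · rw [lt_inl_inl φ]
      -- The relation `z <~ z'` returns to `S` and is then lowered to `a` and `c`; lowering on the
      -- right uses the `<⁻` recorded in `hm`.
      have h1 := ((isGluing_glueMap φ).lt_iff z hz z' hz').1 (T.isOFS.lt_trans _ _ _ h h')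
      exact S.isOFS.lt_of_lt_of_le (S.isOFS.lt_of_le_of_lt hle h1) hle'
        ((ltMinus_inl_inl φ).1 hm)
    · omega
  · rw [lt_inl_inr φ] at h ⊢
    rw [lt_inr_inr φ] at h'
    have hd := T.toOrd.lt_dim _ _ h'
    rcases h with ⟨ha, z, hz, hzk, hle, h⟩ | ⟨ha, ht, _⟩
    · exact Or.inl ⟨ha, z, hz, hzk, hle, T.isOFS.lt_trans _ _ _ h h'⟩
    · exact Or.inr ⟨ha, by omega, hm⟩
  · rw [lt_inr_inl φ] at h ⊢
    rw [lt_inl_inl φ] at h'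
    obtain ⟨_, hb, z, hz, hzk, hle, h⟩ := h
    have hd := S.toOrd.lt_dim _ _ h'
    obtain ⟨z', hz', hzk', hle'⟩ := htop c (by omega)
    refine ⟨hm, by omega, z', hz', hzk', hle', ?_⟩
    rcases eq_or_lt_of_tops φ hz hzk hz' hzk' hle hle' h' with rfl | h''
    · exact h
    · exact T.isOFS.lt_trans _ _ _ h h''
  · obtain ⟨_, hb, z, hz, hzk, hle, h⟩ := (lt_inr_inl φ).1 h
    rw [lt_inl_inr φ] at h'
    rw [lt_inr_inr φ]
    rcases h' with ⟨_, z', hz', hzk', hle', h'⟩ | ⟨hb', _⟩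
    · cases eq_of_le_le φ hz hzk hz' hzk' hle hle'
      exact T.isOFS.lt_trans _ _ _ h h'
    · omega
  · rw [lt_inr_inr φ] at h
    rw [lt_inr_inl φ] at h' ⊢
    obtain ⟨_, hb, z, hz, hzk, hle, h'⟩ := h'
    exact ⟨hm, hb, z, hz, hzk, hle, T.isOFS.lt_trans _ _ _ h h'⟩
  · rw [lt_inr_inr φ] at h h' ⊢
    exact T.isOFS.lt_trans _ _ _ h h'

theorem tensorLt_disjoint {x y : (𝐏).Face} (h : (𝐏).lt x y) :
    ¬ (𝐏).ltPlus x y ∧ ¬ (𝐏).ltPlus y x := by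
  rcases x with a | s <;> rcases y with b | t
  · rw [lt_inl_inl φ] at h
    rw [ltPlus_inl_inl φ, ltPlus_inl_inl φ]
    exact S.isOFS.disjoint _ _ h
  · refine ⟨fun h' => ?_, not_ltPlus_inr_inl φ⟩
    obtain ⟨z, hz, hzk, hle, h'⟩ := le_inl_inr φ h'.le
    rcases (lt_inl_inr φ).1 h with ⟨_, z', hz', hzk', hle', h⟩ | ⟨ha, _⟩
    · cases eq_of_le_le φ hz hzk hz' hzk' hle hle'
      exact (T.isOFS.disjoint _ _ h).1 h'
    · have := hle.dim_eq
      rw [(isGluing_glueMap φ).dim_map z hz] at this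
      omega
  · refine ⟨not_ltPlus_inr_inl φ, fun h' => ?_⟩
    obtain ⟨z, hz, hzk, hle, h'⟩ := le_inl_inr φ h'.le
    obtain ⟨_, _, z', hz', hzk', hle', h⟩ := (lt_inr_inl φ).1 h
    cases eq_of_le_le φ hz hzk hz' hzk' hle hle'
    exact (T.isOFS.disjoint _ _ h).2 h'
  · rw [lt_inr_inr φ] at h
    have hs := le_dim_of_not_mem s.2
    have ht := le_dim_of_not_mem t.2
    rw [inr_eq_tensorRight φ, inr_eq_tensorRight φ, ltPlus_right φ hs, ltPlus_right φ ht]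
    exact T.isOFS.disjoint _ _ h

end TensorOrder

/-! ### Faces with empty domain -/

theorem IsOFS.isLoop_γ_of_isEmptyDom {S : OrdHypergraph.{u}} (hS : IsOFS S) {a v : S.Face}
    (h : S.δ a = {Sum.inr v}) : S.IsLoop (S.γ a) ∧ S.γ (S.γ a) = v := by
  have hv : Sum.inr v ∈ S.δ a := by rw [h]; rfl
  have hd := S.dim_δ_empty a v hv
  have hγ := S.dim_γ a (by omega)
  have hγv : S.γ (S.γ a) = v := by
    obtain ⟨y, hy, e⟩ := hS.exists_γExt (a := a) (by omega)
    rw [h] at hy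
    rw [Set.mem_singleton_iff.1 hy] at e
    exact e.symm
  have hm : ∀ q, Sum.inl q ∈ S.δ (S.γ a) ↔ q = v := by
    intro q
    rw [hS.mem_δγ_iff (by omega)]
    constructor
    · rintro ⟨⟨y, hy, hq⟩, -⟩
      rw [h] at hy
      rw [Set.mem_singleton_iff.1 hy] at hq
      exact Sum.inl_injective (Set.mem_singleton_iff.1 hq)
    · rintro rfl
      refine ⟨⟨_, hv, rfl⟩, fun z hz => ?_⟩
      have := hz.1
      rw [h] at this
      cases this
  refine ⟨⟨by omega, ?_⟩, hγv⟩
  rw [hγv]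
  have hv' := (hm v).2 rfl
  rcases S.δ_total (S.γ a) (by omega) with ⟨y, hy⟩ | ⟨_, hall⟩
  · rw [hy] at hv' ⊢
    rw [Set.mem_singleton_iff.1 hv']
  · refine Set.eq_singleton_iff_unique_mem.2 ⟨hv', fun y hy => ?_⟩
    obtain ⟨q, rfl⟩ := hall y hy
    rw [(hm q).1 hy]

/-- `v` lies in `δ(w)` as an empty face or in `θ` of a face in `δ(w)`. -/
def Touches (S : Hypergraph.{u}) (w v : S.Face) : Prop :=
  Sum.inr v ∈ S.δ w ∨ ∃ q, Sum.inl q ∈ S.δ w ∧ v ∈ S.θFaces q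

theorem IsOFS.touches_of_θFaces_γ {S : OrdHypergraph.{u}} (hS : IsOFS S) {z v : S.Face}
    (hz : 2 ≤ S.dim z) (h : v ∈ S.θFaces (S.γ z)) : Touches S.toHypergraph z v := by
  obtain ⟨_, h | rfl⟩ := mem_θFaces.1 h
  · obtain ⟨⟨y | w, hy, hv⟩, -⟩ := (hS.mem_δγ_iff hz).1 h
    · exact Or.inr ⟨y, hy, θFaces_of_mem hv⟩
    · cases Sum.inl_injective (Set.mem_singleton_iff.1 hv)
      exact Or.inl hy
  · obtain ⟨y | w, hy, hv⟩ := hS.exists_γExt hz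
    · have := S.dim_δ z y hy
      rw [← hv]
      exact Or.inr ⟨y, hy, γ_mem_θFaces (by omega)⟩
    · cases hv
      exact Or.inl hy

theorem IsOFS.touches_γ {S : OrdHypergraph.{u}} (hS : IsOFS S) {c v q : S.Face}
    (hc : 3 ≤ S.dim c) : ∀ s, Sum.inl s ∈ S.δ c → Sum.inl q ∈ S.δ s → v ∈ S.θFaces q →
      Touches S.toHypergraph (S.γ c) v := by
  induction q using hS.wf_ltPlus.induction with
  | _ q ih =>
    intro s hs hq hv
    rcases hS.mem_or_of_mem (by omega) hs hq with h | ⟨z, hz, rfl⟩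
    · exact Or.inr ⟨q, h, hv⟩
    · have := S.dim_δ c z hz.1
      rcases hS.touches_of_θFaces_γ (by omega) hv with h | ⟨q, hq, hv⟩
      · exact (hS.globAt (by omega)).γ_of_inr z v hz.1 h
      · exact ih q (ltPlus_of_mem hz.2 hq) z hz.1 hq hv

/-- An empty domain `1_v` need not persist upwards, as globularity of `δ` holds only up to `≡₁`.
What persists is that `1_v`, or a face with `v` in its `θ`, is in the domain. -/
theorem IsOFS.touches_of_le {S : OrdHypergraph.{u}} (hS : IsOFS S) {s s' v : S.Face}
    (hle : S.le s s') (h : Touches S.toHypergraph s v) (hd : 2 ≤ S.dim s) :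
    Touches S.toHypergraph s' v := by
  induction hle with
  | refl => exact h
  | tail hle hs ih =>
    have := le.dim_eq hle
    obtain ⟨c, _, hc, rfl⟩ := hs
    have := S.dim_δ c _ hc
    rcases ih with h | ⟨q, hq, hv⟩
    · exact (hS.globAt (by omega)).γ_of_inr _ v hc h
    · exact hS.touches_γ (by omega) _ hc hq hv

theorem HgHom.θ_map {S T : Hypergraph.{u}} (h : HgHom S T) {a : S.Face} {y : S.Face ⊕ S.Face}
    (hy : y ∈ S.θ a) : Sum.map h.toFun h.toFun y ∈ T.θ (h.toFun a) := by
  obtain ⟨h0, hy⟩ := hy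
  refine ⟨by rwa [h.dim_map], ?_⟩
  rcases hy with hy | rfl
  · exact Or.inl ((h.bij_δ a h0).mapsTo hy)
  · exact Or.inr (congrArg Sum.inl (h.map_γ a h0))

theorem HgHom.θ_inter_eq_empty {S T : Hypergraph.{u}} (h : HgHom S T) {a b : S.Face}
    (hab : T.θ (h.toFun a) ∩ T.θ (h.toFun b) = ∅) : S.θ a ∩ S.θ b = ∅ :=
  Set.eq_empty_iff_forall_notMem.2 fun _ hy =>
    Set.eq_empty_iff_forall_notMem.1 hab _ ⟨h.θ_map hy.1, h.θ_map hy.2⟩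

section TensorOFS

variable {k : ℕ} {S T : OFS.{u}} (φ : cod k S ≅ dom k T)

local notation "𝐏" => tensor k S T φ
local notation "𝐟" => glueMap k S T φ
local notation "𝛋" => tensorRight k S T φ
local notation "𝐗" => domSet k T.toOrd.toHypergraph

/-! ### Local discreteness, strictness, linearity and loop filling in the tensor -/

theorem map_eq_of_tensorRight_eq {p q : T.toOrd.Face} (hp : T.toOrd.dim p + 1 = k)
    (hq : T.toOrd.dim q + 1 = k) (h : 𝛋 p = 𝛋 q) : 𝐟 p = 𝐟 q := by
  rw [tensorRight_low φ hp, tensorRight_low φ hq] at h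
  exact Sum.inl_injective h

theorem tensorRight_eq_of_map_eq {p q : T.toOrd.Face} (hp : T.toOrd.dim p + 1 = k)
    (hq : T.toOrd.dim q + 1 = k) (h : 𝐟 p = 𝐟 q) : 𝛋 p = 𝛋 q := by
  rw [tensorRight_low φ hp, tensorRight_low φ hq, h]

theorem le_low {p q : T.toOrd.Face} (hp : T.toOrd.dim p + 1 = k)
    (hq : T.toOrd.dim q + 1 = k) (h : (𝐏).le (𝛋 p) (𝛋 q)) : S.toOrd.le (𝐟 p) (𝐟 q) := by
  rw [tensorRight_low φ hp, tensorRight_low φ hq] at h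
  exact (le_inl_inl φ).1 h

theorem tensor_discrete (a x y : (𝐏).Face) (hx : Sum.inl x ∈ (𝐏).δ a)
    (hy : Sum.inl y ∈ (𝐏).δ a) : ¬ (𝐏).ltPlus x y := by
  intro h
  rcases a with s | t
  · obtain ⟨p, hp, rfl⟩ := (leftHom φ).exists_inl (a := s) hx
    obtain ⟨q, hq, rfl⟩ := (leftHom φ).exists_inl (a := s) hy
    exact S.isOFS.discrete _ _ _ hp hq ((ltPlus_inl_inl φ).1 h)
  · rw [inr_eq_tensorRight φ] at hx hy
    obtain ⟨p, hp, rfl⟩ := (rightHom φ).exists_inl hx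
    obtain ⟨q, hq, rfl⟩ := (rightHom φ).exists_inl hy
    have h1 := le_dim_of_not_mem t.2
    have h2 := T.toOrd.dim_δ _ _ hp
    have h3 := T.toOrd.dim_δ _ _ hq
    by_cases hk : k ≤ T.toOrd.dim p
    · exact T.isOFS.discrete _ _ _ hp hq ((ltPlus_right φ hk).1 h)
    · change (𝐏).ltPlus (𝛋 p) (𝛋 q) at h
      rw [tensorRight_low φ (by omega), tensorRight_low φ (by omega)] at h
      exact T.isOFS.discrete _ _ _ hp hq ((isGluing_glueMap φ).ltPlus_of_map S.isOFS T.isOFS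
        (by omega) ((ltPlus_inl_inl φ).1 h) (by omega))

theorem tensor_ltPlus_irrefl (a : (𝐏).Face) : ¬ (𝐏).ltPlus a a := by
  intro h
  rcases a with s | t
  · exact S.isOFS.ltPlus_irrefl _ ((ltPlus_inl_inl φ).1 h)
  · rw [inr_eq_tensorRight φ] at h
    exact T.isOFS.ltPlus_irrefl _ ((ltPlus_right φ (le_dim_of_not_mem t.2)).1 h)

theorem tensor_lt_irrefl (a : (𝐏).Face) : ¬ (𝐏).lt a a := by
  intro h
  rcases a with s | t
  · exact S.isOFS.lt_irrefl _ ((lt_inl_inl φ).1 h)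
  · exact T.isOFS.lt_irrefl _ ((lt_inr_inr φ).1 h)

/-- A face outside `d^(k) T` has dimension at least `k`, so this only occurs for `k = 0`. -/
theorem tensor_linear_inl_inr {a : S.toOrd.Face} {t : {t : T.toOrd.Face // t ∉ 𝐗}}
    (ha : S.toOrd.dim a = 0) (ht : T.toOrd.dim t.1 = 0) :
    (𝐏).ltPlus (Sum.inl a) (Sum.inr t) := by
  have h1 := le_dim_of_not_mem t.2
  obtain ⟨z, hz, hzk, hle⟩ := (isGluing_glueMap φ).exists_top S.isOFS (a := a) (by omega)
  refine ltPlus_inl_inr φ hz hzk hle ?_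
  rcases T.isOFS.ltPlus_linear z t.1 (by omega) ht with h | h | h
  · exact (t.2 (h ▸ hz)).elim
  · exact h
  · exact (IsOFS.IsMin.not_lt (IsGluing.isMin_of_mem hz hzk) h).elim

theorem tensor_linear (a b : (𝐏).Face) (ha : (𝐏).dim a = 0) (hb : (𝐏).dim b = 0) :
    a = b ∨ (𝐏).ltPlus a b ∨ (𝐏).ltPlus b a := by
  rcases a with a | t <;> rcases b with b | t'
  · refine (S.isOFS.ltPlus_linear a b ha hb).imp (congrArg Sum.inl) ?_
    exact Or.imp (ltPlus_inl_inl φ).2 (ltPlus_inl_inl φ).2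
  · exact Or.inr (Or.inl (tensor_linear_inl_inr φ ha hb))
  · exact Or.inr (Or.inr (tensor_linear_inl_inr φ hb ha))
  · rw [inr_eq_tensorRight φ, inr_eq_tensorRight φ]
    refine (T.isOFS.ltPlus_linear t.1 t'.1 ha hb).imp (congrArg 𝛋) ?_
    exact Or.imp (ltPlus_right φ (le_dim_of_not_mem t.2)).2
      (ltPlus_right φ (le_dim_of_not_mem t'.2)).2

theorem tensor_loop_filling (a : (𝐏).Face) (h : (𝐏).IsLoop a) : a ∈ (𝐏).γNonloops := by
  have key : ∀ t : T.toOrd.Face, k ≤ T.toOrd.dim t → t ∈ T.toOrd.γNonloops →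
      (𝛋 t : (𝐏).Face) ∈ (𝐏).γNonloops := by
    rintro _ hd ⟨c, h0, hc, rfl⟩
    have := T.toOrd.dim_γ c h0
    refine ⟨𝛋 c, ?_, fun hl => hc (rightHom_isLoop φ (by omega) hl),
      ((rightHom φ).map_γ c h0).symm⟩
    exact ((rightHom φ).dim_map c).symm ▸ h0
  rcases a with s | t
  · obtain ⟨c, h0, hc, rfl⟩ := S.isOFS.loop_filling s (leftHom_isLoop φ h)
    exact ⟨Sum.inl c, h0, fun hl => hc (leftHom_isLoop φ hl), rfl⟩
  · have hk := le_dim_of_not_mem t.2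
    rw [inr_eq_tensorRight φ] at h ⊢
    refine key t.1 hk ?_
    -- In dimension `k` the face may be a loop only in the tensor; but outside `d^(k) T` it is a
    -- codomain of a non-loop anyway.
    by_cases hd : T.toOrd.dim t.1 = k
    · exact γNonloops_of_not_mem hd t.2
    · exact T.isOFS.loop_filling _ (rightHom_isLoop φ hd h)

/-! ### Globularity -/

theorem exists_δNonloop_tensor {t : T.toOrd.Face} (ht : T.toOrd.dim t = k + 1) {z : (𝐏).Face}
    (hz : z ∈ (𝐏).δNonloop (𝛋 t)) : ∃ e ∈ T.toOrd.δNonloop t, 𝛋 e = z ∧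
      ∀ p, Sum.inl p ∈ T.toOrd.δ e → 𝐟 p ≠ 𝐟 (T.toOrd.γ e) := by
  obtain ⟨e, he, rfl⟩ := (rightHom φ).exists_δNonloop hz
  have := T.toOrd.dim_δ t e he.1
  exact ⟨e, he, rfl, fun p hp h => hz.2 ((rightHom_isLoop_iff φ (by omega)).2 ⟨p, hp, h⟩)⟩

theorem isLoop_or_mem_δNonloop {t e : T.toOrd.Face} (ht : T.toOrd.dim t = k + 1)
    (he : Sum.inl e ∈ T.toOrd.δ t) :
    (∃ p, Sum.inl p ∈ T.toOrd.δ e ∧ 𝐟 p = 𝐟 (T.toOrd.γ e)) ∨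
      (𝛋 e : (𝐏).Face) ∈ (𝐏).δNonloop (𝛋 t) := by
  have := T.toOrd.dim_δ t e he
  by_cases h : (𝐏).IsLoop (𝛋 e)
  · exact Or.inl ((rightHom_isLoop_iff φ (by omega)).1 h)
  · exact Or.inr ⟨(rightHom φ).inl_mem he, h⟩

/-- Dimension `k + 1` is the critical one: faces of `δ(t)` may turn into loops, and faces two
dimensions down are identified. -/
theorem globAt_tensorRight {t : T.toOrd.Face} (ht : T.toOrd.dim t = k + 1) (hk : 0 < k) :
    (𝐏).GlobAt (𝛋 t) := by
  have hT := T.isOFS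
  have hf := isGluing_glueMap φ
  have hg := hT.globAt (a := t) (by omega)
  have dγ := T.toOrd.dim_γ t (by omega)
  have dγγ := T.toOrd.dim_γ (T.toOrd.γ t) (by omega)
  refine (rightHom φ).globAt_of (by omega) hg ?_ ?_ ?_ ?_
  · intro z hz hm
    obtain ⟨e, he, rfl, hel⟩ := exists_δNonloop_tensor φ ht hz
    have de := T.toOrd.dim_δ t e he.1
    obtain ⟨p, hp, hpe⟩ := (rightHom φ).exists_inl hm
    have dp := T.toOrd.dim_δ e p hp
    have dγe := T.toOrd.dim_γ e (by omega)
    have h1 := hf.le_map hT (by omega) (le_of_mem hp)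
    have h2 := hf.le_map hT (by omega) (hT.le_γ (by omega) (le_of_mem he.1))
    rw [← map_eq_of_tensorRight_eq φ (by omega) (by omega) hpe] at h2
    exact hel p hp (S.isOFS.le_antisymm h1 h2)
  -- If the next face of the chain collapses, its domain is the single face `v` and its codomain has
  -- the same image, so the search continues from there.
  · suffices h : ∀ v, ∀ y ∈ T.toOrd.δ t, T.toOrd.γExt y = v →
        𝛋 v = 𝛋 (T.toOrd.γ (T.toOrd.γ t)) ∨
          ∃ z ∈ (𝐏).δNonloop (𝛋 t), Sum.inl (𝛋 v) ∈ (𝐏).δ z from fun y hy => h _ y hy rfl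
    intro v
    induction v using hT.wf.induction with
    | _ v ih =>
      rintro y hy rfl
      rcases hg.step y hy with h | ⟨z, hz, hm⟩
      · exact Or.inl (congrArg 𝛋 h)
      have dz := T.toOrd.dim_δ t z hz.1
      have dγz := T.toOrd.dim_γ z (by omega)
      rcases isLoop_or_mem_δNonloop φ ht hz.1 with ⟨p, hp, e⟩ | h
      · have hm' := hm
        rw [hf.δ_eq_of_map_eq hT (by omega) hp e] at hm'
        have hvp := Sum.inl_injective (Set.mem_singleton_iff.1 hm')
        have dp := T.toOrd.dim_δ z p hp
        rw [hvp] at hm ih ⊢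
        rw [tensorRight_eq_of_map_eq φ (by omega) (by omega) e]
        exact ih _ (ltPlus_of_mem hz.2 hm) _ hz.1 rfl
      · exact Or.inr ⟨_, h, (rightHom φ).inl_mem hm⟩
  · intro q hq z hz h
    obtain ⟨e, he, rfl, hel⟩ := exists_δNonloop_tensor φ ht hz
    have de := T.toOrd.dim_δ t e he.1
    have dγe := T.toOrd.dim_γ e (by omega)
    have dq := T.toOrd.dim_δ _ q hq
    have hle := le_of_mem he.1
    have h' := map_eq_of_tensorRight_eq φ (by omega) (by omega)
      (((rightHom φ).map_γ e (by omega)).trans h)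
    -- A loop path from `γ(e)` to `q` would give `e <⁻ γ(t)` although `e ≤⁺ γ(t)`; a loop path from
    -- `q` to `γ(e)` would make `q` an upper node of `γ(t)`, which cannot lie in `δγ(t)`.
    rcases hf.fiber _ _ (by omega) (by omega) h' with hp | hp
    · exact hT.not_ltMinus_of_le he.2 hle
        (ltMinus_iff.2 ⟨by omega, q, hq, (hf.loopPath_le hp).1⟩)
    · exact IsOFS.UpperNode.not_mem hT ((hf.upperNode_of_loopPath hT (by omega) hel hp
        (IsOFS.upperNode_γ (by omega) he.2) rfl).mono hle) hq
  · intro q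
    induction q using hT.wf_ltPlus.induction with
    | _ q ih =>
      intro hq hne
      by_cases h : ∀ z ∈ T.toOrd.δNonloop t, T.toOrd.γ z ≠ q
      · exact ⟨q, (hg.mem_iff q).2 ⟨hq, h⟩, rfl⟩
      push Not at h
      obtain ⟨e, he, rfl⟩ := h
      have de := T.toOrd.dim_δ t e he.1
      have dγe := T.toOrd.dim_γ e (by omega)
      rcases isLoop_or_mem_δNonloop φ ht he.1 with ⟨p, hp, h⟩ | h
      · have dp := T.toOrd.dim_δ e p hp
        have h' : (rightHom φ).toFun p = (rightHom φ).toFun (T.toOrd.γ e) :=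
          tensorRight_eq_of_map_eq φ (by omega) (by omega) h
        rw [← h'] at hne ⊢
        exact ih p (ltPlus_of_mem he.2 hp) ⟨_, he.1, hp⟩ hne
      · exact (hne _ h ((rightHom φ).map_γ e (by omega)).symm).elim

theorem tensor_globAt (a : (𝐏).Face) (ha : 2 ≤ (𝐏).dim a) : (𝐏).GlobAt a := by
  rcases a with s | t
  · exact (leftHom φ).globAt_map ha (S.isOFS.globAt ha) fun _ _ _ _ h => Sum.inl_injective h
  · have ha' : 2 ≤ T.toOrd.dim t.1 := ha
    rw [inr_eq_tensorRight φ]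
    by_cases hd : T.toOrd.dim t.1 = k + 1
    · exact globAt_tensorRight φ hd (by omega)
    · exact (rightHom φ).globAt_map ha' (T.isOFS.globAt ha') fun _ _ _ _ h =>
        tensorRight_inj φ (by omega) h

/-! ### Lower comparability -/

theorem lt_of_ltMinus_of_mem {z t : T.toOrd.Face} (hz : z ∈ 𝐗) (hzk : T.toOrd.dim z = k)
    (ht : t ∉ 𝐗) (h : T.toOrd.ltMinus z t) : T.toOrd.lt z t := by
  have hl := IsGluing.not_isLoop_of_mem T.isOFS hz hzk
  refine T.isOFS.lt_of_not_le (Or.inl h) (fun h' => T.isOFS.not_ltMinus_of_le hl h' h)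
    (fun h' => ?_) fun h' => ?_
  · exact ht (IsOFS.IsMin.eq_of_le (IsGluing.isMin_of_mem hz hzk) h' ▸ hz)
  · exact T.isOFS.not_ltMinus_of_le hl ReflTransGen.refl (h.trans (T.isOFS.lt_ltMinus _ _ h'))

theorem lt_of_ltMinus_of_mem' {z t : T.toOrd.Face} (hz : z ∈ 𝐗) (hzk : T.toOrd.dim z = k)
    (ht : t ∉ 𝐗) (h : T.toOrd.ltMinus t z) : T.toOrd.lt t z := by
  have hl := IsGluing.not_isLoop_of_mem T.isOFS hz hzk
  refine T.isOFS.lt_of_not_le (Or.inl h) (fun h' => ?_)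
    (fun h' => T.isOFS.not_ltMinus_of_le' hl h' h) fun h' => ?_
  · exact ht (IsOFS.IsMin.eq_of_le (IsGluing.isMin_of_mem hz hzk) h' ▸ hz)
  · exact T.isOFS.not_ltMinus_of_le hl ReflTransGen.refl ((T.isOFS.lt_ltMinus _ _ h').trans h)

/-- The relation `<⁻` is reflected unless the path from `γ(a)` to `δ(b)` collapses to a point of the
tensor. That point would be a common face, against disjointness of the sets `θ`. -/
theorem lt_of_ltMinus_right {a b : T.toOrd.Face} (hk : k ≤ T.toOrd.dim a)
    (hab : (𝐏).θ (𝛋 a) ∩ (𝐏).θ (𝛋 b) = ∅) (h : (𝐏).ltMinus (𝛋 a) (𝛋 b)) :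
    T.toOrd.lt a b := by
  refine T.isOFS.lt_of_ltMinus _ _ ((rightHom φ).θ_inter_eq_empty hab) ?_
  have hd := h.dim_eq
  rw [show (𝐏).dim (𝛋 a) = _ from (rightHom φ).dim_map a,
    show (𝐏).dim (𝛋 b) = _ from (rightHom φ).dim_map b] at hd
  obtain ⟨h0, p, hp, hle⟩ := ltMinus_iff.1 h
  rw [show (𝐏).dim (𝛋 a) = _ from (rightHom φ).dim_map a] at h0
  obtain ⟨q, hq, rfl⟩ := (rightHom φ).exists_inl hp
  have hγ := (rightHom φ).map_γ a h0
  change (𝐏).le ((𝐏).γ ((rightHom φ).toFun a)) _ at hle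
  rw [← hγ] at hle
  have d1 := T.toOrd.dim_γ a h0
  have d2 := T.toOrd.dim_δ b q hq
  refine ltMinus_iff.2 ⟨h0, q, hq, ?_⟩
  by_cases hk' : k ≤ T.toOrd.dim (T.toOrd.γ a)
  · exact (le_right φ hk').1 hle
  · rcases (isGluing_glueMap φ).le_of_map S.isOFS T.isOFS (by omega) (by omega)
      (le_low φ (by omega) (by omega) hle) with h' | h'
    · have e : 𝛋 (T.toOrd.γ a) = 𝛋 q := tensorRight_eq_of_map_eq φ (by omega) (by omega) h'
      have e' : (rightHom φ).toFun q = (𝐏).γ (𝛋 a) := e.symm.trans hγ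
      refine (Set.eq_empty_iff_forall_notMem.1 hab (Sum.inl ((rightHom φ).toFun q))
        ⟨⟨(ltMinus_iff.1 h).1, Or.inr (congrArg Sum.inl e')⟩, ?_, Or.inl hp⟩).elim
      rw [← h.dim_eq]
      exact (ltMinus_iff.1 h).1
    · exact h'.le

theorem lt_of_ltMinus_inl_inr {a : S.toOrd.Face} {t : {t : T.toOrd.Face // t ∉ 𝐗}}
    (hab : ((𝐏).θ (Sum.inl a) ∩ (𝐏).θ (Sum.inr t) : Set ((𝐏).Face ⊕ (𝐏).Face)) = ∅)
    (h : (𝐏).ltMinus (Sum.inl a) (Sum.inr t)) : (𝐏).lt (Sum.inl a) (Sum.inr t) := by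
  have hS := S.isOFS
  have hT := T.isOFS
  have hf := isGluing_glueMap φ
  have hk := le_dim_of_not_mem t.2
  have hd : S.toOrd.dim a = T.toOrd.dim t.1 := h.dim_eq
  obtain ⟨h0, p, hp, hle⟩ := ltMinus_iff.1 h
  have h0' : 0 < S.toOrd.dim a := h0
  have hle' : (𝐏).le (Sum.inl (S.toOrd.γ a)) p := hle
  rw [inr_eq_tensorRight φ] at hp
  obtain ⟨q, hq, rfl⟩ := (rightHom φ).exists_inl hp
  have dγ := S.toOrd.dim_γ a h0'
  have dq := T.toOrd.dim_δ _ q hq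
  change (𝐏).le (Sum.inl (S.toOrd.γ a)) (𝛋 q) at hle'
  have hne : 𝛋 q ≠ Sum.inl (S.toOrd.γ a) := by
    intro e
    refine Set.eq_empty_iff_forall_notMem.1 hab (Sum.inl (𝛋 q)) ⟨⟨h0, Or.inr ?_⟩, ?_, Or.inl ?_⟩
    · exact congrArg Sum.inl e
    · exact (ltMinus.dim_eq h) ▸ h0
    · rw [inr_eq_tensorRight φ]
      exact hp
  rcases Nat.lt_trichotomy (S.toOrd.dim a) (k + 1) with hak | hak | hak
  · refine (lt_inl_inr φ).2 (Or.inl ⟨by omega, ?_⟩)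
    -- The path from `γ(a)` starts at `γ(f(z))` or passes through it, since it ends in a face that
    -- is not an inner node. Equal images at its ends are harmless because `γ(z)` is the least
    -- element of its fibre.
    obtain ⟨z, hz, hzk, haz⟩ := hf.exists_top hS (a := a) (by omega)
    refine ⟨z, hz, hzk, haz, lt_of_ltMinus_of_mem hz hzk t.2 ?_⟩
    refine ltMinus_iff.2 ⟨by omega, q, hq, ?_⟩
    have hlow := tensorRight_low φ (t := q) (by omega)
    rw [hlow] at hle' hne
    have hle2 := (le_inl_inl φ).1 hle'
    have hne2 : S.toOrd.γ a ≠ 𝐟 q := fun e => hne (congrArg Sum.inl e.symm)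
    have dz := T.toOrd.dim_γ z (by omega)
    have hγ := hf.map_γ z hz (by omega)
    rcases hS.γ_eq_or_lowerNode h0' haz with e | hL
    · rw [e, ← hγ] at hle2 hne2
      exact ((hf.le_of_map hS hT (by omega) (by omega) hle2).resolve_left hne2).le
    · rcases IsOFS.LowerNode.up hS hL hle2 with e | h' | h'
      · exact (hne2 e).elim
      · rw [← hγ] at h'
        rcases hf.le_of_map hS hT (by omega) (by omega) h' with e | h'
        · obtain ⟨m, hm, hmz, _⟩ := hL
          exact hf.γ_le hT hz hzk (by omega) (hS.not_isLoop_of_le hmz hm) (by omega) e.symm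
        · exact h'.le
      · exact (hf.not_inner hS (by omega) _ h').elim
  · exact (lt_inl_inr φ).2 (Or.inr ⟨hak, by omega, h⟩)
  · have hqX := not_mem_of_lt_dim (k := k) (t := q) (by omega)
    rw [tensorRight_of_not_mem φ hqX] at hle'
    obtain ⟨z, hz, hzk, hle2, _⟩ := le_inl_inr φ hle'
    have := hle2.dim_eq
    rw [hf.dim_map z hz] at this
    omega

theorem lt_of_ltMinus_inr_inl {a : S.toOrd.Face} {t : {t : T.toOrd.Face // t ∉ 𝐗}}
    (hab : ((𝐏).θ (Sum.inr t) ∩ (𝐏).θ (Sum.inl a) : Set ((𝐏).Face ⊕ (𝐏).Face)) = ∅)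
    (h : (𝐏).ltMinus (Sum.inr t) (Sum.inl a)) : (𝐏).lt (Sum.inr t) (Sum.inl a) := by
  have hS := S.isOFS
  have hT := T.isOFS
  have hf := isGluing_glueMap φ
  have hk := le_dim_of_not_mem t.2
  have hd : T.toOrd.dim t.1 = S.toOrd.dim a := h.dim_eq
  obtain ⟨h0, p, hp, hle⟩ := ltMinus_iff.1 h
  have h0' : 0 < T.toOrd.dim t.1 := h0
  have hle' : (𝐏).le (𝛋 (T.toOrd.γ t.1)) p := hle
  obtain ⟨q, hq, rfl⟩ := (leftHom φ).exists_inl (a := a) hp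
  change (𝐏).le (𝛋 (T.toOrd.γ t.1)) (Sum.inl q) at hle'
  have dγ := T.toOrd.dim_γ t.1 h0'
  have dq := S.toOrd.dim_δ _ q hq
  have hγX : T.toOrd.γ t.1 ∈ 𝐗 := by
    by_contra hγX
    rw [tensorRight_of_not_mem φ hγX] at hle'
    exact not_le_inr_inl φ hle'
  rw [tensorRight_of_mem φ hγX] at hle'
  have hle2 := (le_inl_inl φ).1 hle'
  have hne : 𝐟 (T.toOrd.γ t.1) ≠ q := by
    intro e
    refine Set.eq_empty_iff_forall_notMem.1 hab (Sum.inl (Sum.inl q))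
      ⟨⟨h0, Or.inr (congrArg Sum.inl ?_)⟩, ?_, Or.inl hp⟩
    · exact ((tensorRight_eq_inl φ).2 ⟨hγX, e⟩).symm
    · exact (ltMinus.dim_eq h) ▸ h0
  by_cases hdk : T.toOrd.dim t.1 = k
  · obtain ⟨z, hz, hzk, haz⟩ := hf.exists_top hS (a := a) (by omega)
    refine (lt_inr_inl φ).2 ⟨h, by omega, z, hz, hzk, haz,
      lt_of_ltMinus_of_mem' hz hzk t.2 ?_⟩
    rcases hS.mem_or_upperNode haz hq with h1 | h1
    · obtain ⟨q', hq', rfl⟩ := hf.exists_inl hz h1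
      have := T.toOrd.dim_δ _ _ hq'
      exact ltMinus_iff.2 ⟨h0', q', hq',
        ((hf.le_of_map hS hT (by omega) (by omega) hle2).resolve_left hne).le⟩
    · rcases IsOFS.UpperNode.down hS h1 hle2 with e | ⟨_, hz', h2⟩ | h2
      · exact (hne e).elim
      · obtain ⟨q', hq', rfl⟩ := hf.exists_inl hz hz'
        have := T.toOrd.dim_δ _ _ hq'
        refine ltMinus_iff.2 ⟨h0', q', hq', ?_⟩
        rcases hf.le_of_map hS hT (by omega) (by omega) h2 with e | h2
        · obtain ⟨m, _, hm, hmz, _⟩ := h1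
          exact hf.le_of_δ hT hz hzk (hS.not_isLoop_of_le hmz hm) hq' (by omega) e
        · exact h2.le
      · exact (hf.not_inner hS (by omega) _ h2).elim
  · have hγk := dim_of_mem_of_le hγX (by omega)
    exact (hne (IsOFS.eq_of_top_le (top_of_mem φ hγX hγk) hle2)).elim

theorem tensor_lt_of_ltMinus (a b : (𝐏).Face) (hab : (𝐏).θ a ∩ (𝐏).θ b = ∅)
    (h : (𝐏).ltMinus a b) : (𝐏).lt a b := by
  rcases a with a | s <;> rcases b with b | t
  · exact (lt_inl_inl φ).2 (S.isOFS.lt_of_ltMinus _ _ ((leftHom φ).θ_inter_eq_empty hab)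
      ((ltMinus_inl_inl φ).1 h))
  · exact lt_of_ltMinus_inl_inr φ hab h
  · exact lt_of_ltMinus_inr_inl φ hab h
  · rw [inr_eq_tensorRight φ, inr_eq_tensorRight φ] at hab h
    exact (lt_inr_inr φ).2 (lt_of_ltMinus_right φ (le_dim_of_not_mem s.2) hab h)

end TensorOFS

section TensorPencil

variable {k : ℕ} {S T : OFS.{u}} (φ : cod k S ≅ dom k T)

local notation "𝐏" => tensor k S T φ
local notation "𝐟" => glueMap k S T φ
local notation "𝛋" => tensorRight k S T φ
local notation "𝐗" => domSet k T.toOrd.toHypergraph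

/-! ### Pencil linearity -/

theorem pencil_of_map_eq {t t' x x' : T.toOrd.Face} (ht : T.toOrd.dim t = k)
    (ht' : T.toOrd.dim t' = k) (hx : x ∈ T.toOrd.θFaces t) (hx' : x' ∈ T.toOrd.θFaces t')
    (h : 𝐟 x = 𝐟 x') :
    (T.toOrd.le t t' ∨ T.toOrd.le t' t) ∨ (T.toOrd.lt t t' ∨ T.toOrd.lt t' t) := by
  have h1 := dim_of_mem_θFaces hx
  have h2 := dim_of_mem_θFaces hx'
  rcases (isGluing_glueMap φ).le_or_le (by omega) (by omega) h with h | h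
  · exact T.isOFS.pencil_of_le hx hx' h
  · exact (T.isOFS.pencil_of_le hx' hx h).imp Or.symm Or.symm

theorem pencil_inr_inr {a b : {t : T.toOrd.Face // t ∉ 𝐗}} (hne : a ≠ b)
    (h : ((𝐏).θFaces (Sum.inr a) ∩ (𝐏).θFaces (Sum.inr b)).Nonempty) :
    (T.toOrd.lt a.1 b.1 ∨ T.toOrd.lt b.1 a.1) ∨
      (T.toOrd.ltPlus a.1 b.1 ∨ T.toOrd.ltPlus b.1 a.1) := by
  obtain ⟨y, hy, hy'⟩ := h
  rw [inr_eq_tensorRight φ] at hy hy'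
  obtain ⟨x, hx, rfl⟩ := (rightHom φ).exists_mem_θFaces hy
  obtain ⟨x', hx', e⟩ := (rightHom φ).exists_mem_θFaces hy'
  have e' : 𝛋 x' = 𝛋 x := e
  have hne' : a.1 ≠ b.1 := fun h => hne (Subtype.ext h)
  have hx'd : T.toOrd.dim x' = T.toOrd.dim x := by
    rw [← (rightHom φ).dim_map, ← (rightHom φ).dim_map, e]
  have h1 := dim_of_mem_θFaces hx
  have h2 := dim_of_mem_θFaces hx'
  by_cases hd : T.toOrd.dim a.1 = k
  · rcases pencil_of_map_eq φ hd (by omega) hx hx'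
      (map_eq_of_tensorRight_eq φ (by omega) (by omega) e'.symm) with (h | h) | h
    · exact Or.inr (Or.inl ((le_iff.1 h).resolve_left hne'))
    · exact Or.inr (Or.inr ((le_iff.1 h).resolve_left hne'.symm))
    · exact Or.inl h
  · have := tensorRight_inj φ (by omega) e'
    subst this
    exact T.isOFS.pencil _ _ hne' ⟨_, hx, hx'⟩

/-- The face of `f(z)` under a common face of `a ≤ f(z)` and the image of `T`. -/
theorem exists_mem_θFaces_of_le {a : S.toOrd.Face} {z p : T.toOrd.Face} (hz : z ∈ 𝐗)
    (hp : T.toOrd.dim p + 1 = k) (haz : S.toOrd.le a (𝐟 z))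
    (h : 𝐟 p ∈ S.toOrd.θFaces a) : ∃ x ∈ T.toOrd.θFaces z, 𝐟 x = 𝐟 p := by
  have hf := isGluing_glueMap φ
  have hS := S.isOFS
  obtain ⟨h0, h⟩ := mem_θFaces.1 h
  have hdz := haz.dim_eq
  rw [hf.dim_map z hz] at hdz
  have hγ := hf.map_γ z hz (by omega)
  have hδ : Sum.inl (𝐟 p) ∈ S.toOrd.δ (𝐟 z) → ∃ x ∈ T.toOrd.θFaces z, 𝐟 x = 𝐟 p := fun h => by
    obtain ⟨x, hx, e⟩ := hf.exists_inl hz h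
    exact ⟨x, θFaces_of_mem hx, e⟩
  have hγ' : 𝐟 p = S.toOrd.γ (𝐟 z) → ∃ x ∈ T.toOrd.θFaces z, 𝐟 x = 𝐟 p := fun h =>
    ⟨_, γ_mem_θFaces (by omega), hγ.trans h.symm⟩
  rcases h with h | h
  · rcases hS.mem_or_upperNode haz h with h | h
    · exact hδ h
    · rcases IsOFS.UpperNode.cases hS h with h' | h'
      · exact hγ' h'
      · exact (hf.not_inner hS hp _ ⟨h, h'⟩).elim
  · rcases hS.γ_eq_or_lowerNode h0 haz with h' | h'
    · exact hγ' (h.trans h')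
    · rw [← h] at h'
      rcases IsOFS.LowerNode.cases hS h' with h | h
      · exact hδ h
      · exact (hf.not_inner hS hp _ ⟨h, h'⟩).elim

/-- There is `q ∈ δ(z)` with `f(p) ≤⁺ f(γ(t)) ≤⁺ f(q)`, and `f(q) ≤⁺ f(x) = f(p)`: if `x ∈ δ(z)`,
local discreteness even gives equality. So all these faces coincide. -/
theorem map_γ_eq_of_lt {z t x p : T.toOrd.Face} (hz : z ∈ 𝐗) (hzk : T.toOrd.dim z = k)
    (hx : x ∈ T.toOrd.θFaces z) (hp : p ∈ T.toOrd.θFaces t) (e : 𝐟 x = 𝐟 p)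
    (h : T.toOrd.lt t z) : 𝐟 (T.toOrd.γ t) = 𝐟 p := by
  have hf := isGluing_glueMap φ
  have hS := S.isOFS
  have hT := T.isOFS
  have hdt := T.toOrd.lt_dim _ _ h
  obtain ⟨h0, q, hq, hle⟩ := ltMinus_iff.1 (hT.lt_ltMinus _ _ h)
  have d1 := T.toOrd.dim_γ t h0
  have d2 := dim_of_mem_θFaces hp
  have dq := T.toOrd.dim_δ _ _ hq
  have dx := dim_of_mem_θFaces hx
  have l1 := hf.le_map hT (by omega) (le_γ_of_mem_θFaces hp)
  have l2 := hf.le_map hT (by omega) hle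
  suffices h : S.toOrd.le (𝐟 q) (𝐟 x) by
    rw [e] at h
    exact hS.le_antisymm (l2.trans h) l1
  rcases (mem_θFaces.1 hx).2 with hxδ | rfl
  · have hle' := l1.trans l2
    rw [← e] at hle'
    rcases le_iff.1 hle' with h' | h'
    · rw [h']
    · exact (hS.discrete _ _ _ (hf.inl_mem hz hxδ) (hf.inl_mem hz hq) h').elim
  · exact hf.le_map hT (by omega) (le_of_mem hq)

theorem pencil_inl_inr {a : S.toOrd.Face} {t : {t : T.toOrd.Face // t ∉ 𝐗}}
    (h : ((𝐏).θFaces (Sum.inl a) ∩ (𝐏).θFaces (Sum.inr t)).Nonempty) :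
    ((𝐏).lt (Sum.inl a) (Sum.inr t) ∨ (𝐏).lt (Sum.inr t) (Sum.inl a)) ∨
      (𝐏).ltPlus (Sum.inl a) (Sum.inr t) := by
  have hf := isGluing_glueMap φ
  have hS := S.isOFS
  have hT := T.isOFS
  obtain ⟨y, hy, hy'⟩ := h
  rw [inr_eq_tensorRight φ] at hy'
  obtain ⟨v, hv, rfl⟩ := (leftHom φ).exists_mem_θFaces (a := a) hy
  obtain ⟨p, hp, e⟩ := (rightHom φ).exists_mem_θFaces hy'
  obtain ⟨hpX, rfl⟩ := (tensorRight_eq_inl φ).1 e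
  have d1 := dim_of_mem_θFaces hv
  have d2 := dim_of_mem_θFaces hp
  rw [hf.dim_map p hpX] at d1
  have hk := le_dim_of_not_mem t.2
  by_cases hdk : T.toOrd.dim t.1 = k
  · obtain ⟨z, hz, hzk, haz⟩ := hf.exists_top hS (a := a) (by omega)
    obtain ⟨x, hx, hxp⟩ := exists_mem_θFaces_of_le φ hz (by omega) haz hv
    have hzt : z ≠ t.1 := fun h => t.2 (h ▸ hz)
    rcases pencil_of_map_eq φ hzk hdk hx hp hxp with (h | h) | (h | h)
    · exact Or.inr (ltPlus_inl_inr φ hz hzk haz ((le_iff.1 h).resolve_left hzt))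
    · exact (hzt (IsOFS.IsMin.eq_of_le (IsGluing.isMin_of_mem hz hzk) h).symm).elim
    · exact Or.inl (Or.inl ((lt_inl_inr φ).2 (Or.inl ⟨by omega, z, hz, hzk, haz, h⟩)))
    · refine Or.inl (Or.inr ((lt_inr_inl φ).2 ⟨?_, by omega, z, hz, hzk, haz, h⟩))
      -- Besides `t <~ z` the order of the tensor demands `t <⁻ a`. As the common face is the
      -- codomain of `κ_T(t)`, it suffices that it lies in `δ(a)`.
      have hγp := map_γ_eq_of_lt φ hz hzk hx hp hxp h
      have dγ := T.toOrd.dim_γ t.1 (by omega)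
      suffices hm : Sum.inl (𝐟 p) ∈ S.toOrd.δ a by
        refine ltMinus_iff.2 ⟨?_, Sum.inl (𝐟 p), (leftHom φ).inl_mem hm, ?_⟩
        · change 0 < T.toOrd.dim t.1
          omega
        · change (𝐏).le (𝛋 (T.toOrd.γ t.1)) _
          rw [tensorRight_low φ (by omega), hγp]
          exact ReflTransGen.refl
      obtain ⟨h0, hm | hm⟩ := mem_θFaces.1 hv
      · exact hm
      · by_cases hl : S.toOrd.IsLoop a
        · rw [hl.2, hm]
          rfl
        exfalso
        have hU : S.toOrd.UpperNode (𝐟 z) (S.toOrd.γ a) := ⟨a, h0, hl, haz, rfl⟩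
        rcases IsOFS.UpperNode.cases hS hU with h' | h'
        · obtain ⟨h0', q, hq, hle⟩ := ltMinus_iff.1 (hT.lt_ltMinus _ _ h)
          have dq := T.toOrd.dim_δ _ _ hq
          have l1 := hf.le_map hT (by omega) hle
          rw [hγp, hm, h'] at l1
          exact hS.not_le_of_lt (ltPlus_of_mem (hS.not_isLoop_of_le haz hl)
            (hf.inl_mem hz hq)) l1
        · rw [← hm] at hU h'
          exact hf.not_inner hS (by omega) _ ⟨hU, h'⟩
  · have hpk := dim_of_mem_of_le hpX (by omega)
    refine Or.inl (Or.inl ((lt_inl_inr φ).2 (Or.inr ⟨by omega, by omega, ?_⟩)))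
    -- In dimension `k + 1` the common `k`-face is maximal in `S` and minimal in `T`, so it is the
    -- codomain of `a` and belongs to the domain of `t`.
    have hva : 𝐟 p = S.toOrd.γ a := by
      rcases (mem_θFaces.1 hv).2 with hm | hm
      · by_cases hl : S.toOrd.IsLoop a
        · rw [hl.2] at hm
          exact Sum.inl_injective (Set.mem_singleton_iff.1 hm)
        · exact (top_of_mem φ hpX hpk ⟨a, hl, hm⟩).elim
      · exact hm
    have hpt : Sum.inl p ∈ T.toOrd.δ t.1 := by
      obtain ⟨h0, hm | rfl⟩ := mem_θFaces.1 hp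
      · exact hm
      · by_cases hl : T.toOrd.IsLoop t.1
        · rw [hl.2]
          rfl
        · exact (IsGluing.isMin_of_mem hpX hpk ⟨_, h0, hl, rfl⟩).elim
    refine ltMinus_iff.2 ⟨?_, 𝛋 p, ?_, ?_⟩
    · change 0 < S.toOrd.dim a
      omega
    · rw [inr_eq_tensorRight φ]
      exact (rightHom φ).inl_mem hpt
    · rw [tensorRight_of_mem φ hpX, hva]
      exact ReflTransGen.refl

theorem tensor_pencil (a b : (𝐏).Face) (hne : a ≠ b)
    (h : ((𝐏).θFaces a ∩ (𝐏).θFaces b).Nonempty) :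
    ((𝐏).lt a b ∨ (𝐏).lt b a) ∨ ((𝐏).ltPlus a b ∨ (𝐏).ltPlus b a) := by
  rcases a with a | s <;> rcases b with b | t
  · obtain ⟨y, hy, hy'⟩ := h
    obtain ⟨v, hv, rfl⟩ := (leftHom φ).exists_mem_θFaces (a := a) hy
    obtain ⟨v', hv', e⟩ := (leftHom φ).exists_mem_θFaces (a := b) hy'
    cases Sum.inl_injective e
    exact (S.isOFS.pencil a b (fun h => hne (congrArg Sum.inl h)) ⟨_, hv, hv'⟩).imp
      (Or.imp (lt_inl_inl φ).2 (lt_inl_inl φ).2) (Or.imp (ltPlus_inl_inl φ).2 (ltPlus_inl_inl φ).2)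
  · exact (pencil_inl_inr φ h).imp id Or.inl
  · rw [Set.inter_comm] at h
    exact (pencil_inl_inr φ h).imp Or.symm Or.inr
  · have := pencil_inr_inr φ (fun h => hne (congrArg Sum.inr h)) h
    rw [inr_eq_tensorRight φ, inr_eq_tensorRight φ]
    exact this.imp (Or.imp (lt_right φ) (lt_right φ))
      (Or.imp (ltPlus_right φ (le_dim_of_not_mem s.2)).2
        (ltPlus_right φ (le_dim_of_not_mem t.2)).2)

/-! ### Pencil linearity for faces with empty domain -/

theorem mem_ι_of_inl {b u : S.toOrd.Face} (h : (Sum.inl u : (𝐏).Face) ∈ (𝐏).ι (Sum.inl b)) :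
    u ∈ S.toOrd.ι b := by
  obtain ⟨p, hp, q, hq, h0, e, hu⟩ := h
  obtain ⟨p, hp', rfl⟩ := (leftHom φ).exists_δNonloop (a := b) hp
  obtain ⟨q, hq', rfl⟩ := (leftHom φ).exists_δNonloop (a := b) hq
  obtain ⟨w, hw, e'⟩ := (leftHom φ).exists_inl hu
  cases Sum.inl_injective e'
  exact ⟨p, hp', q, hq', h0, Sum.inl_injective e, hw⟩

theorem mem_ι_inl {b u : S.toOrd.Face} (h : u ∈ S.toOrd.ι b) :
    (Sum.inl u : (𝐏).Face) ∈ (𝐏).ι (Sum.inl b) :=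
  (leftHom φ).mem_ι_map h fun _ _ => leftHom_isLoop φ

theorem exists_of_mem_ι {t : T.toOrd.Face} {y : (𝐏).Face} (h : y ∈ (𝐏).ι (𝛋 t)) :
    ∃ p, Sum.inl p ∈ T.toOrd.δ t ∧ ∃ q, Sum.inl q ∈ T.toOrd.δ t ∧ ∃ w,
      Sum.inl w ∈ T.toOrd.δ q ∧ 𝛋 w = y ∧ 𝛋 (T.toOrd.γ p) = y ∧ 0 < T.toOrd.dim p ∧
      ¬ (𝐏).IsLoop (𝛋 p) ∧ ¬ (𝐏).IsLoop (𝛋 q) := by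
  obtain ⟨p, hp, q, hq, h0, e, hu⟩ := h
  obtain ⟨p, hp', rfl⟩ := (rightHom φ).exists_δNonloop hp
  obtain ⟨q, hq', rfl⟩ := (rightHom φ).exists_δNonloop hq
  obtain ⟨w, hw, e'⟩ := (rightHom φ).exists_inl hu
  rw [(rightHom φ).dim_map] at h0
  exact ⟨p, hp'.1, q, hq'.1, w, hw, e', ((rightHom φ).map_γ p h0).trans e, h0, hp.2, hq.2⟩

theorem exists_mem_ι {t : T.toOrd.Face} {y : (𝐏).Face} (ht : T.toOrd.dim t ≠ k + 1)
    (h : y ∈ (𝐏).ι (𝛋 t)) : ∃ u ∈ T.toOrd.ι t, 𝛋 u = y := by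
  obtain ⟨p, hp, q, hq, w, hw, e, e', h0, hpl, hql⟩ := exists_of_mem_ι φ h
  have dq := T.toOrd.dim_δ _ _ hq
  have dw := T.toOrd.dim_δ _ _ hw
  have := tensorRight_inj φ (by omega) (e.trans e'.symm)
  subst this
  exact ⟨_, ⟨p, ⟨hp, fun hl => hpl ((rightHom φ).isLoop_map hl)⟩, q,
    ⟨hq, fun hl => hql ((rightHom φ).isLoop_map hl)⟩, h0, rfl, hw⟩, e⟩

/-- In dimension `k + 1`, all faces over an inner face of `κ(t)` lie in the tree of `δ(t)`. -/
theorem exists_nodes {t : T.toOrd.Face} {u : S.toOrd.Face} (ht : T.toOrd.dim t = k + 1)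
    (hk : 0 < k) (h : (Sum.inl u : (𝐏).Face) ∈ (𝐏).ι (𝛋 t)) :
    ¬ T.toOrd.IsLoop t ∧ (∃ w, T.toOrd.dim w + 1 = k ∧ 𝐟 w = u) ∧
    ∀ w, T.toOrd.dim w + 1 = k → 𝐟 w = u →
      (∃ e ∈ T.toOrd.δNonloop t, T.toOrd.LowerNode e w) ∧
        ∃ e ∈ T.toOrd.δNonloop t, T.toOrd.UpperNode e w := by
  obtain ⟨p, hp, q, hq, w, hw, e, e', h0, hpl, hql⟩ := exists_of_mem_ι φ h
  have dp := T.toOrd.dim_δ _ _ hp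
  have dq := T.toOrd.dim_δ _ _ hq
  have dw := T.toOrd.dim_δ _ _ hw
  have dγ := T.toOrd.dim_γ p h0
  have hwu := ((tensorRight_eq_inl φ).1 e).2
  have hpu := ((tensorRight_eq_inl φ).1 e').2
  have hlp : ∀ x, Sum.inl x ∈ T.toOrd.δ p → 𝐟 x ≠ 𝐟 (T.toOrd.γ p) := fun x hx h =>
    hpl ((rightHom_isLoop_iff φ (by omega)).2 ⟨x, hx, h⟩)
  have hlq : ∀ x, Sum.inl x ∈ T.toOrd.δ q → 𝐟 x ≠ 𝐟 (T.toOrd.γ q) := fun x hx h =>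
    hql ((rightHom_isLoop_iff φ (by omega)).2 ⟨x, hx, h⟩)
  refine ⟨fun hl => ?_, ⟨w, by omega, hwu⟩, fun w' hw' hwu' => ?_⟩
  · rw [hl.2] at hp hq
    have hpq : p = q := (Sum.inl_injective (Set.mem_singleton_iff.1 hp)).trans
      (Sum.inl_injective (Set.mem_singleton_iff.1 hq)).symm
    subst hpq
    exact hlp w hw (hwu.trans hpu.symm)
  · exact (isGluing_glueMap φ).nodes_of_fiber T.isOFS ht hk hp hq hw hlp hlq
      (fun hl => hpl ((rightHom φ).isLoop_map hl)) (fun hl => hql ((rightHom φ).isLoop_map hl))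
      (hpu.trans hwu.symm) hw' (hwu'.trans hwu.symm)

/-- If `w` is an inner node of one face `e` of `δ(t)`, the loop `γ(s)` over it is below `e`, so `s
<⁻ t`. Otherwise `w` is the codomain of one face of `δ(t)` and in the domain of another, hence
internal to `t`, and the axiom for `T` applies. -/
theorem pencil_empty_of_nodes {s t w : T.toOrd.Face} (hs : 2 ≤ T.toOrd.dim s)
    (hst : T.toOrd.dim s = T.toOrd.dim t)
    (he : T.toOrd.IsEmptyDom s) (hw : T.toOrd.γ (T.toOrd.γ s) = w) (hl : ¬ T.toOrd.IsLoop t)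
    (h : ∃ e ∈ T.toOrd.δNonloop t, T.toOrd.LowerNode e w)
    (h' : ∃ e ∈ T.toOrd.δNonloop t, T.toOrd.UpperNode e w) :
    T.toOrd.lt s t ∨ T.toOrd.ltPlus s t := by
  have hT := T.isOFS
  have hinner : ∀ e ∈ T.toOrd.δNonloop t, T.toOrd.Inner e w → T.toOrd.lt s t := by
    intro e hem hI
    obtain ⟨v, hv⟩ := he
    have hsl := not_isLoop_of_isEmptyDom ⟨v, hv⟩
    have hle := hT.loop_le_of_inner hI (hT.isLoop_γ_of_isEmptyDom hv).1 hw
    have hm : T.toOrd.ltMinus s t := ltMinus_iff.2 ⟨by omega, e, hem.1, hle⟩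
    exact hT.lt_of_not_le (Or.inl hm) (fun h => hT.not_ltMinus_of_le hsl h hm)
      (fun h => hT.not_ltMinus_of_le' hl h hm)
      fun h => hT.not_ltMinus_of_le hsl ReflTransGen.refl (hm.trans (hT.lt_ltMinus _ _ h))
  obtain ⟨e, hem, hL⟩ := h
  obtain ⟨e', hem', hU⟩ := h'
  have de' := T.toOrd.dim_δ _ _ hem'.1
  rcases IsOFS.LowerNode.cases hT hL with h1 | h1
  · rcases IsOFS.UpperNode.cases hT hU with h2 | h2
    · exact hT.pencil_empty s t hs (by omega) he
        (hw ▸ ⟨e', hem', e, hem, by omega, h2.symm, h1⟩)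
    · exact Or.inl (hinner e' hem' ⟨hU, h2⟩)
  · exact Or.inl (hinner e hem ⟨h1, hL⟩)

theorem pencil_empty_right {s t : T.toOrd.Face} (hs : 2 ≤ T.toOrd.dim s)
    (he : T.toOrd.IsEmptyDom s)
    (h : 𝛋 (T.toOrd.γ (T.toOrd.γ s)) ∈ (𝐏).ι (𝛋 t)) : T.toOrd.lt s t ∨ T.toOrd.ltPlus s t := by
  have d1 := T.toOrd.dim_γ s (by omega)
  have d2 := T.toOrd.dim_γ (T.toOrd.γ s) (by omega)
  have d3 := dim_of_mem_ι h
  rw [show (𝐏).dim (𝛋 _) = _ from (rightHom φ).dim_map _,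
    show (𝐏).dim (𝛋 _) = _ from (rightHom φ).dim_map _] at d3
  by_cases ht : T.toOrd.dim t = k + 1
  · rw [tensorRight_low φ (t := T.toOrd.γ (T.toOrd.γ s)) (by omega)] at h
    obtain ⟨hl, -, hn⟩ := exists_nodes φ ht (by omega) h
    obtain ⟨h1, h2⟩ := hn _ (by omega) rfl
    exact pencil_empty_of_nodes hs (by omega) he rfl hl h1 h2
  · obtain ⟨u, hu, e⟩ := exists_mem_ι φ ht h
    have := dim_of_mem_ι hu
    have := tensorRight_inj φ (by omega) e
    subst this
    exact T.isOFS.pencil_empty s t hs (by omega) he hu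

theorem lt_or_ltPlus_of_mem {z t p u : T.toOrd.Face} (hz : z ∈ 𝐗) (hzk : T.toOrd.dim z = k)
    (hk : 2 ≤ k) (ht : t ∉ 𝐗) (htk : T.toOrd.dim t = k) (hp : Sum.inl p ∈ T.toOrd.δ z)
    (hu : u ∈ T.toOrd.θFaces p) (h : u ∈ T.toOrd.ι t) :
    T.toOrd.lt z t ∨ T.toOrd.ltPlus z t := by
  rcases T.isOFS.lt_or_le_of_inner (IsGluing.isMin_of_mem hz hzk)
    (IsGluing.not_isLoop_of_mem T.isOFS hz hzk) hp (T.isOFS.not_isLoop_of_mem_ι h) (by omega) hu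
    (IsOFS.inner_of_ι h) with h | h
  · exact Or.inr ((le_iff.1 h).resolve_left fun e => ht (e ▸ hz))
  · exact Or.inl h

theorem pencil_empty_inl_inr {a : S.toOrd.Face} {t : {t : T.toOrd.Face // t ∉ 𝐗}}
    (ha : 2 ≤ S.toOrd.dim a) (he : S.toOrd.IsEmptyDom a)
    (h : (Sum.inl (S.toOrd.γ (S.toOrd.γ a)) : (𝐏).Face) ∈ (𝐏).ι (Sum.inr t)) :
    (𝐏).lt (Sum.inl a) (Sum.inr t) ∨ (𝐏).ltPlus (Sum.inl a) (Sum.inr t) := by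
  have hS := S.isOFS
  have hT := T.isOFS
  have hf := isGluing_glueMap φ
  have hk := le_dim_of_not_mem t.2
  have d1 := S.toOrd.dim_γ a (by omega)
  have d2 := S.toOrd.dim_γ (S.toOrd.γ a) (by omega)
  have d3 : S.toOrd.dim (S.toOrd.γ (S.toOrd.γ a)) + 2 = T.toOrd.dim t.1 := dim_of_mem_ι h
  obtain ⟨v, hv⟩ := he
  obtain ⟨hloop, hγv⟩ := hS.isLoop_γ_of_isEmptyDom hv
  rw [inr_eq_tensorRight φ] at h
  by_cases hd : T.toOrd.dim t.1 = k + 1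
  · left
    obtain ⟨hl, ⟨w, hwk, hwu⟩, hn⟩ := exists_nodes φ hd (by omega) h
    refine (lt_inl_inr φ).2 (Or.inr ⟨by omega, hd, ?_⟩)
    -- Some face of `z` lies over `γγ(a)`, hence is a node of the tree of `δ(t)`; as `z` is minimal,
    -- it is below a face of `δ(t)`.
    obtain ⟨z, hz, hzk, hlz⟩ := hf.exists_top hS (a := S.toOrd.γ a) (by omega)
    suffices h : ∃ e, Sum.inl e ∈ T.toOrd.δ t.1 ∧ T.toOrd.le z e by
      obtain ⟨e, het, hze⟩ := h
      refine ltMinus_iff.2 ⟨?_, 𝛋 e, ?_, ?_⟩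
      · change 0 < S.toOrd.dim a
        omega
      · rw [inr_eq_tensorRight φ]
        exact (rightHom φ).inl_mem het
      · have h1 := (le_inl_inl φ).2 hlz
        rw [← tensorRight_of_mem φ hz] at h1
        exact h1.trans ((le_right φ hzk.ge).2 hze)
    have hzl := IsGluing.not_isLoop_of_mem hT hz hzk
    have hzm := IsGluing.isMin_of_mem hz hzk
    have hmem : 𝐟 w ∈ S.toOrd.θFaces (S.toOrd.γ a) := by
      rw [hwu]
      exact γ_mem_θFaces (by omega)
    obtain ⟨x, hx, hxw⟩ := exists_mem_θFaces_of_le φ hz hwk hlz hmem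
    have dx := dim_of_mem_θFaces hx
    obtain ⟨⟨e, het, m, hm, hme, hxm⟩, ⟨e', het', m', hm0, hm', hme', hxm'⟩⟩ :=
      hn x (by omega) (hxw.trans hwu)
    rcases (mem_θFaces.1 hx).2 with hx | hx
    · exact ⟨e, het.1, (hT.min_le_of_δ hzm hzl hm hx hxm).trans hme⟩
    · exact ⟨e', het'.1, (hT.min_le_of_γ hzm hzl hm' (by omega) hm0
        (hx.symm.trans hxm'.symm)).trans hme'⟩
  obtain ⟨u, hu, e⟩ := exists_mem_ι φ hd h
  obtain ⟨huX, hua⟩ := (tensorRight_eq_inl φ).1 e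
  have du := dim_of_mem_ι hu
  by_cases htk : T.toOrd.dim t.1 = k
  · obtain ⟨z, hz, hzk, haz⟩ := hf.exists_top hS (a := a) (by omega)
    suffices h : T.toOrd.lt z t.1 ∨ T.toOrd.ltPlus z t.1 from
      h.imp (fun h => (lt_inl_inr φ).2 (Or.inl ⟨by omega, z, hz, hzk, haz, h⟩))
        (ltPlus_inl_inr φ hz hzk haz)
    -- The maximal face `f(z)` may have lost the empty domain. If `1_v` persists, the axiom for `z`
    -- in `T` applies; otherwise `v` belongs to a face of `δ(f(z))`, and minimality of `z` decides.
    have hta : Touches S.toOrd.toHypergraph a v := Or.inl (by rw [hv]; rfl)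
    have hX := domSet_isSub k T.toOrd.toHypergraph
    rcases hS.touches_of_le haz hta ha with h' | ⟨q, hq, hvq⟩
    · obtain ⟨y | x, hx, e'⟩ := (hf.bij_δ z hz (by omega)).surjOn h'
      · cases e'
      have e'' : 𝐟 x = v := Sum.inr_injective e'
      have hxu : x = u := hf.inj x (hX.δ_empty_mem z hz x hx) u huX
        (by have := T.toOrd.dim_δ_empty z x hx; omega) (e''.trans (hγv.symm.trans hua.symm))
      subst hxu
      have hδz := δ_eq_of_inr hx
      exact hT.pencil_empty z t.1 (by omega) (by omega) ⟨_, hδz⟩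
        ((hT.isLoop_γ_of_isEmptyDom hδz).2 ▸ hu)
    · obtain ⟨p, hp, rfl⟩ := hf.exists_inl hz hq
      have dp := T.toOrd.dim_δ _ _ hp
      have hpX := hX.δ_mem z hz p hp
      have : ∃ x ∈ T.toOrd.θFaces p, x ∈ 𝐗 ∧ 𝐟 x = v := by
        obtain ⟨_, hm | hm⟩ := mem_θFaces.1 hvq
        · obtain ⟨x, hx, e⟩ := hf.exists_inl hpX hm
          exact ⟨x, θFaces_of_mem hx, hX.δ_mem p hpX x hx, e⟩
        · exact ⟨_, γ_mem_θFaces (by omega), hX.γ_mem p hpX,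
            (hf.map_γ p hpX (by omega)).trans hm.symm⟩
      obtain ⟨x, hx, hxX, e⟩ := this
      have dx := dim_of_mem_θFaces hx
      have hxu : x = u := hf.inj x hxX u huX (by omega) (e.trans (hγv.symm.trans hua.symm))
      subst hxu
      exact lt_or_ltPlus_of_mem hz hzk (by omega) t.2 htk hp hx hu
  · exfalso
    have huk := dim_of_mem_of_le huX (by omega)
    obtain ⟨p, hp, _, _, h0, e, _⟩ := hu
    exact IsGluing.isMin_of_mem huX huk ⟨p, h0, hp.2, e⟩

theorem pencil_empty_inr_inl {a : S.toOrd.Face} {t : {t : T.toOrd.Face // t ∉ 𝐗}}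
    (ht : 2 ≤ T.toOrd.dim t.1) (he : T.toOrd.IsEmptyDom t.1)
    (h : (𝛋 (T.toOrd.γ (T.toOrd.γ t.1)) : (𝐏).Face) ∈ (𝐏).ι (Sum.inl a)) :
    (𝐏).lt (Sum.inr t) (Sum.inl a) := by
  have hS := S.isOFS
  have hT := T.isOFS
  have hf := isGluing_glueMap φ
  have hX := domSet_isSub k T.toOrd.toHypergraph
  have hk := le_dim_of_not_mem t.2
  have d1 := T.toOrd.dim_γ t.1 (by omega)
  have d2 := T.toOrd.dim_γ (T.toOrd.γ t.1) (by omega)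
  have d3 := dim_of_mem_ι h
  rw [show (𝐏).dim (𝛋 _) = _ from (rightHom φ).dim_map _] at d3
  change _ + 2 = S.toOrd.dim a at d3
  have huX : T.toOrd.γ (T.toOrd.γ t.1) ∈ 𝐗 := by
    obtain ⟨p, hp, _, _, _, e, _⟩ := h
    obtain ⟨p, _, rfl⟩ := (leftHom φ).exists_δNonloop (a := a) hp
    exact ((tensorRight_eq_inl φ).1 e.symm).1
  rw [tensorRight_of_mem φ huX] at h
  have hι := mem_ι_of_inl φ h
  by_cases hd : T.toOrd.dim t.1 = k + 1
  · exact (hf.not_mem_ι _ (by omega) _ hι).elim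
  by_cases htk : T.toOrd.dim t.1 = k
  · obtain ⟨z, hz, hzk, haz⟩ := hf.exists_top hS (a := a) (by omega)
    have hιz : T.toOrd.γ (T.toOrd.γ t.1) ∈ T.toOrd.ι z := by
      have h' := mem_ι_inl φ (hS.ι_mono haz hι)
      rw [← tensorRight_of_mem φ hz] at h'
      obtain ⟨u, hu, e⟩ := exists_mem_ι φ (by omega) h'
      have du := dim_of_mem_ι hu
      obtain ⟨huX', e⟩ := (tensorRight_eq_inl φ).1 e
      rwa [← hf.inj _ huX' _ huX (by omega) e]
    have hlt : T.toOrd.lt t.1 z := by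
      rcases hT.pencil_empty t.1 z ht (by omega) he hιz with h | h
      · exact h
      · exact (IsOFS.IsMin.not_lt (IsGluing.isMin_of_mem hz hzk) h).elim
    refine (lt_inr_inl φ).2 ⟨?_, by omega, z, hz, hzk, haz, hlt⟩
    obtain ⟨v, hv⟩ := he
    have hγX : T.toOrd.γ t.1 ∈ 𝐗 := Or.inl (by omega)
    -- This loop lies over an inner node of `γ(a)`, so it is below `γ(a)`; the path from it enters
    -- through `δ(a)`, which provides the required `t <⁻ a`.
    have hloop : S.toOrd.IsLoop (𝐟 (T.toOrd.γ t.1)) := by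
      have := (rightHom φ).isLoop_map (hT.isLoop_γ_of_isEmptyDom hv).1
      rw [show (rightHom φ).toFun _ = _ from tensorRight_of_mem φ hγX] at this
      exact leftHom_isLoop φ this
    have hI := IsOFS.inner_of_ι hι
    have hle := hS.loop_le_of_inner hI hloop (hf.map_γ _ hγX (by omega)).symm
    have hal := hS.not_isLoop_of_mem_ι hι
    rcases IsOFS.UpperNode.down hS (IsOFS.upperNode_γ (by omega) hal) hle with h | ⟨q, hq, hle⟩ | h
    · obtain ⟨m, _, hm, hma, _⟩ := hI.1
      rw [h] at hloop
      exact (hS.not_isLoop_of_le hma hm hloop).elim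
    · refine ltMinus_iff.2 ⟨?_, Sum.inl q, (leftHom φ).inl_mem hq, ?_⟩
      · change 0 < T.toOrd.dim t.1
        omega
      · change (𝐏).le (𝛋 (T.toOrd.γ t.1)) _
        rw [tensorRight_of_mem φ hγX]
        exact (le_inl_inl φ).2 hle
    · exact (hf.not_inner hS (by omega) _ h).elim
  · exfalso
    have huk := dim_of_mem_of_le huX (by omega)
    obtain ⟨_, _, q, hq, _, _, hu⟩ := hι
    exact top_of_mem φ huX huk ⟨q, hq.2, hu⟩

theorem tensor_pencil_empty (a b : (𝐏).Face) (ha : 2 ≤ (𝐏).dim a)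
    (hb : 2 ≤ (𝐏).dim b) (he : (𝐏).IsEmptyDom a) (h : (𝐏).γ ((𝐏).γ a) ∈ (𝐏).ι b) :
    (𝐏).lt a b ∨ (𝐏).ltPlus a b := by
  have hγ : ∀ t : {t : T.toOrd.Face // t ∉ 𝐗}, 2 ≤ T.toOrd.dim t.1 →
      (𝐏).γ ((𝐏).γ (Sum.inr t)) = 𝛋 (T.toOrd.γ (T.toOrd.γ t.1)) := fun t ht => by
    rw [inr_eq_tensorRight φ]
    exact (rightHom φ).γγ_map ht
  rcases a with a | s
  · have he' : S.toOrd.IsEmptyDom a := (leftHom φ).isEmptyDom_of_map he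
    rcases b with b | t
    · exact (S.isOFS.pencil_empty a b ha hb he' (mem_ι_of_inl φ h)).imp (lt_inl_inl φ).2
        (ltPlus_inl_inl φ).2
    · exact pencil_empty_inl_inr φ ha he' h
  · rw [hγ s ha] at h
    have he' : T.toOrd.IsEmptyDom s.1 := by
      rw [inr_eq_tensorRight φ] at he
      exact (rightHom φ).isEmptyDom_of_map he
    rcases b with b | t
    · exact Or.inl (pencil_empty_inr_inl φ ha he' h)
    · have hk := le_dim_of_not_mem s.2
      rw [inr_eq_tensorRight φ] at h ⊢
      rw [inr_eq_tensorRight φ]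
      exact (pencil_empty_right φ ha he' h).imp (lt_right φ) (ltPlus_right φ hk).2

theorem isOFS_tensor : IsOFS (tensor k S T φ) where
  nonempty := by
    obtain ⟨a, ha⟩ := S.isOFS.nonempty
    exact ⟨Sum.inl a, ha⟩
  glob_γ a ha := (tensor_globAt φ a ha).glob_γ
  glob_δ a ha := (tensor_globAt φ a ha).glob_δ
  discrete := tensor_discrete φ
  ltPlus_irrefl := tensor_ltPlus_irrefl φ
  ltPlus_linear := tensor_linear φ
  lt_irrefl := tensor_lt_irrefl φ
  lt_trans _ _ _ h h' := tensorLt_trans φ h h'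
  disjoint _ _ h := tensorLt_disjoint φ h
  lt_ltMinus _ _ h := ltMinus_of_tensorLt φ h
  lt_of_ltMinus := tensor_lt_of_ltMinus φ
  pencil := tensor_pencil φ
  pencil_empty := tensor_pencil_empty φ
  loop_filling := tensor_loop_filling φ

end TensorPencil

/-! ## The pushout square -/

theorem bijOn_of_comp {A B C : Type*} {F : A → B} {G : B → C} {s : Set A} {t : Set B} {v : Set C}
    (hF : Set.BijOn F s t) (h : Set.BijOn (G ∘ F) s v) : Set.BijOn G t v := by
  rw [← hF.image_eq]
  refine ⟨?_, ?_, ?_⟩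
  · rintro _ ⟨x, hx, rfl⟩
    exact h.mapsTo hx
  · rintro _ ⟨x, hx, rfl⟩ _ ⟨y, hy, rfl⟩ e
    exact congrArg F (h.injOn hx hy e)
  · intro y hy
    obtain ⟨x, hx, e⟩ := h.surjOn hy
    exact ⟨F x, ⟨x, hx, rfl⟩, e⟩

/-- The conditions on a morphism `m` of local face structures, at the face `a`. -/
structure LocalAt (P W : LFS.{u}) (m : P.Face → W.Face) (a : P.Face) : Prop where
  dim_map : W.dim (m a) = P.dim a
  map_γ : 0 < P.dim a → m (P.γ a) = W.γ (m a)
  bij_δ : 0 < P.dim a → Set.BijOn (Sum.map m m) (P.δ a) (W.δ (m a))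
  rel_iff : ∀ x y, 1 < P.dim a → Sum.inl x ∈ P.δ a → Sum.inl y ∈ P.δ a →
    (P.rel a x y ↔ W.rel (m a) (m x) (m y))

/-- The conditions at `f(a)` involve only its dimension, codomain and domain with the local
relation, all of which `f` transports faithfully from `a`; so they follow from those of `g` at `a`.
-/
theorem LocalAt.of_comp {A P W : LFS.{u}} (f : LocalHom A P) (g : LocalHom A W)
    {m : P.Face → W.Face} (h : ∀ a, m (f.toFun a) = g.toFun a) (a : A.Face) :
    LocalAt P W m (f.toFun a) where
  dim_map := by rw [h, g.dim_map, f.dim_map]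
  map_γ h0 := by
    rw [f.dim_map] at h0
    rw [← f.map_γ a h0, h, h, g.map_γ a h0]
  bij_δ h0 := by
    rw [f.dim_map] at h0
    rw [h]
    refine bijOn_of_comp (f.bij_δ a h0) ?_
    rw [Sum.map_comp_map, show m ∘ f.toFun = g.toFun from funext h]
    exact g.bij_δ a h0
  rel_iff x y h1 hx hy := by
    rw [f.dim_map] at h1
    obtain ⟨x, hx', rfl⟩ := f.toHgHom.exists_inl hx
    obtain ⟨y, hy', rfl⟩ := f.toHgHom.exists_inl hy
    rw [h, h, h, ← g.rel_iff a x y h1 hx' hy']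
    exact (f.rel_iff a x y h1 hx' hy').symm

/-- A map that is a morphism at each face. -/
def LocalHom.ofLocalAt {P W : LFS.{u}} (m : P.Face → W.Face) (h : ∀ a, LocalAt P W m a) :
    LocalHom P W where
  toFun := m
  dim_map a := (h a).dim_map
  map_γ a := (h a).map_γ
  bij_δ a := (h a).bij_δ
  rel_iff a x y := (h a).rel_iff x y

section Pushout

variable {k : ℕ} {S T : OFS.{u}} (φ : cod k S ≅ dom k T)

local notation "𝐏" => tensor k S T φ
local notation "𝛋" => tensorRight k S T φ
local notation "𝐗" => domSet k T.toOrd.toHypergraph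

/-- The tensor, as an ordered face structure. -/
noncomputable abbrev tensorOFS : OFS.{u} := OFS.mk 𝐏 (isOFS_tensor φ)

/-- The inclusion of `S`. -/
noncomputable def tensorInl : S ⟶ tensorOFS φ :=
  MonoHom.mk (leftHom φ) fun _ _ h => (lt_inl_inl φ).2 h

/-- The map `κ_T`. -/
noncomputable def tensorInr : T ⟶ tensorOFS φ :=
  MonoHom.mk (rightHom φ) fun _ _ h => lt_right φ h

theorem tensorRight_hom (p : (cod k S).Face) :
    𝛋 ((domMap k T).toFun (φ.hom.toFun p)) = Sum.inl ((codMap k S).toFun p) := by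
  rw [tensorRight_of_mem φ (domMap_mem _), glueMap_hom]

theorem tensor_commSq :
    CommSq (OFS.ofHom (isOFS_cod φ) S.isOFS (codMap k S))
      (OFS.ofHom (isOFS_cod φ) (isOFS_dom k T) φ.hom ≫
        OFS.ofHom (isOFS_dom k T) T.isOFS (domMap k T)) (tensorInl φ) (tensorInr φ) :=
  ⟨MonoHom.ext (funext fun p => (tensorRight_hom φ p).symm)⟩

theorem elim_tensorRight {W : Type*} {g : S.toOrd.Face → W} {h : T.toOrd.Face → W}
    (e : ∀ p, g ((codMap k S).toFun p) = h ((domMap k T).toFun (φ.hom.toFun p)))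
    (t : T.toOrd.Face) :
    Sum.elim g (fun t : {t : T.toOrd.Face // t ∉ 𝐗} => h t.1) (𝛋 t) = h t := by
  by_cases ht : t ∈ 𝐗
  · obtain ⟨p, rfl⟩ := exists_domMap (k := k) (T := T) ht
    have e' := e (φ.inv.toFun p)
    rw [← inv_hom_apply φ p, tensorRight_hom φ]
    rw [inv_hom_apply φ p] at e' ⊢
    exact e'
  · rw [tensorRight_of_not_mem φ ht]
    rfl

/-- The morphism from the tensor to a local face structure under `S` and `T`. -/
noncomputable def tensorDesc {W : LFS.{u}} (g : forget.obj S ⟶ W) (h : forget.obj T ⟶ W)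
    (e : ∀ p, g.toFun ((codMap k S).toFun p) = h.toFun ((domMap k T).toFun (φ.hom.toFun p))) :
    forget.obj (tensorOFS φ) ⟶ W :=
  LocalHom.ofLocalAt
    (Sum.elim g.toFun (fun t : {t : T.toOrd.Face // t ∉ 𝐗} => h.toFun t.1)) (by
      rintro (s | t)
      · exact LocalAt.of_comp (forget.map (tensorInl φ)) g (fun _ => rfl) s
      · have := LocalAt.of_comp (forget.map (tensorInr φ)) h (elim_tensorRight φ e) t.1
        rwa [show (forget.map (tensorInr φ)).toFun t.1 = Sum.inr t from
          (inr_eq_tensorRight φ t).symm] at this)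

/-- Every face of the tensor is in the image of `κ_S` or `κ_T`, which gives uniqueness;
compatibility on the glued faces makes the induced map agree with both legs. -/
theorem tensor_isPushout :
    IsPushout (forget.map (OFS.ofHom (isOFS_cod φ) S.isOFS (codMap k S)))
      (forget.map (OFS.ofHom (isOFS_cod φ) (isOFS_dom k T) φ.hom ≫
        OFS.ofHom (isOFS_dom k T) T.isOFS (domMap k T)))
      (forget.map (tensorInl φ)) (forget.map (tensorInr φ)) where
  w := by rw [← forget.map_comp, (tensor_commSq φ).w, forget.map_comp]
  isColimit' := by
    have he : ∀ {W : LFS.{u}} {a b : forget.obj (OFS.mk (cod k S) (isOFS_cod φ)) ⟶ W},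
        a = b → ∀ p, a.toFun p = b.toFun p := fun h _ => by rw [h]
    refine ⟨Limits.PushoutCocone.IsColimit.mk _
      (fun s => tensorDesc φ s.inl s.inr (he s.condition)) ?_ ?_ ?_⟩
    · intro s
      exact LocalHom.ext rfl
    · intro s
      exact LocalHom.ext (funext (elim_tensorRight φ (he s.condition)))
    · intro s m h1 h2
      refine LocalHom.ext (funext ?_)
      rintro (a | t)
      · exact congrFun (congrArg (fun f : LocalHom _ _ => f.toFun) h1) a
      · refine Eq.trans ?_ (congrFun (congrArg (fun f : LocalHom _ _ => f.toFun) h2) t.1)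
        exact congrArg m.toFun (inr_eq_tensorRight φ t)

end Pushout

end FaceStructure

theorem mainTheorem9 (k : ℕ) (S T : OFS.{u}) (φ : cod k S ≅ dom k T) :
    ∃ (hc : IsOFS (cod k S)) (hd : IsOFS (dom k T)) (ht : IsOFS (tensor k S T φ))
      (κS : S ⟶ OFS.mk (tensor k S T φ) ht) (κT : T ⟶ OFS.mk (tensor k S T φ) ht),
      (∀ s, κS.toFun s = tensorLeft k S T s) ∧
      (∀ t, κT.toFun t = tensorRight k S T φ t) ∧
      CommSq (OFS.ofHom hc S.isOFS (codMap k S))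
        (OFS.ofHom hc hd φ.hom ≫ OFS.ofHom hd T.isOFS (domMap k T)) κS κT ∧
      IsPushout (forget.map (OFS.ofHom hc S.isOFS (codMap k S)))
        (forget.map (OFS.ofHom hc hd φ.hom ≫ OFS.ofHom hd T.isOFS (domMap k T)))
        (forget.map κS) (forget.map κT) :=
  ⟨isOFS_cod φ, isOFS_dom k T, isOFS_tensor φ, tensorInl φ, tensorInr φ, fun _ => rfl,
    fun _ => rfl, tensor_commSq φ, tensor_isPushout φ⟩
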